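/- Let $I=(a,b)$ be a bounded open interval, $\alpha>0$, $\beta\ge 0$ and $g\in L^\infty(I)$. For $u\in SBV(I)$ let $S_u\subset I$ be its singular set (the set of approximate discontinuity points), $u^l(x),u^r(x)$ its left and right traces, and $u'$ its approximate derivative. Let $\Gamma_u$ be the rectifiable $1$-current in $I\times\mathbb R$ with multiplicity one carried by the extended graph $$\{(x,t)\in I\times\mathbb R:\ \min(u^l(x),u^r(x))\le t\le\max(u^l(x),u^r(x))\},$$ oriented by the unit tangent $(1,u')/\sqrt{1+(u')^2}$ over $I\setminus S_u$, and by $(0,\operatorname{sign}(u^r-u^l))$ over $S_u$. Let $K$ be the set of Borel vector fields $\phi=(\phi^x,\phi^t):I\times\mathbb R\to\mathbb R^2$ such that for all $x\in I$ and $t,t_1,t_2\in\mathbb R$ $$\phi^t(x,t)\ \ge\ \tfrac14\,\phi^x(x,t)^2-\beta\,(t-g(x))^2,\qquad \Big|\int_{t_1}^{t_2}\phi^x(x,s)\,ds\Big|\le\alpha ,$$ where $\phi^x(x,\cdot)$ is required to be locally integrable. For a rectifiable $1$-current $T=(\mathcal M,\theta,\xi)$ in $I\times\mathbb R$ with real multiplicity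 $\theta>0$ and unit tangent $\xi=(\xi_1,\xi_2)$, set $\nu_T=(\xi_2,-\xi_1)$ and $$G(T)=\sup_{\phi\in K}\int_{\mathcal M}\theta\,\langle\phi,\nu_T\rangle\,d\mathcal H^1\ \in[0,+\infty],$$ the supremum being over those $\phi\in K$ for which the integral converges absolutely. Let $k\in\mathbb N$, let $u_1,\dots,u_k\in SBV(I)$ be such that $S_{u_1}\cup\dots\cup S_{u_k}$ is finite, and let $T=\sum_{i=1}^k\Gamma_{u_i}$. Then there exist $w_1,\dots,w_k\in SBV(I)$ such that $$T=\sum_{i=1}^k\Gamma_{w_i}\qquad\text{and}\qquad G(T)=\sum_{i=1}^k G(\Gamma_{w_i}).$$ -/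

import Mathlib

open MeasureTheory Set Filter Topology
open scoped Distributions ContDiff

noncomputable section

namespace MumfordShah

/-! ### Special functions of bounded variation on the open interval `(a, b)` -/

/-- `z` is the approximate limit of `u` at `x`. -/
def HasApproxLimit (u : ℝ → ℝ) (x z : ℝ) : Prop :=
  Tendsto (fun r : ℝ => ⨍ y in Ioo (x - r) (x + r), |u y - z|) (𝓝[>] 0) (𝓝 0)

/-- The singular set `S_u`: the points of `(a, b)` at which `u` has no approximate limit. -/
def singularSet (a b : ℝ) (u : ℝ → ℝ) : Set ℝ :=
  {x | x ∈ Ioo a b ∧ ¬ ∃ z, HasApproxLimit u x z}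

/-- The left trace `u^l(x)`. -/
def leftTrace (u : ℝ → ℝ) (x : ℝ) : ℝ :=
  limUnder (𝓝[>] (0 : ℝ)) fun r => ⨍ y in Ioo (x - r) x, u y

/-- The right trace `u^r(x)`. -/
def rightTrace (u : ℝ → ℝ) (x : ℝ) : ℝ :=
  limUnder (𝓝[>] (0 : ℝ)) fun r => ⨍ y in Ioo x (x + r), u y

/-- `u` is approximately differentiable at `x` with approximate derivative `c`. -/
def HasApproxDeriv (u : ℝ → ℝ) (x c : ℝ) : Prop :=
  ∃ z, Tendsto (fun r : ℝ => r⁻¹ * ⨍ y in Ioo (x - r) (x + r), |u y - z - c * (y - x)|)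
    (𝓝[>] 0) (𝓝 0)

open Classical in
/-- The approximate derivative `u'(x)` (zero where it does not exist). For a function of bounded
variation it exists almost everywhere and is the density of the absolutely continuous part of the
distributional derivative. -/
def approxDeriv (u : ℝ → ℝ) (x : ℝ) : ℝ :=
  if h : ∃ c, HasApproxDeriv u x c then h.choose else 0

/-- The finite signed measure `μ` is, on `(a, b)`, the distributional derivative of `u`. -/
def IsDistribDeriv (a b : ℝ) (u : ℝ → ℝ) (μ : SignedMeasure ℝ) : Prop :=
  ∀ η : ℝ → ℝ, ContDiff ℝ ∞ η → HasCompactSupport η → tsupport η ⊆ Ioo a b →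
    ∫ x in Ioo a b, u x * deriv η x =
      -(∫ x, η x ∂μ.toJordanDecomposition.posPart - ∫ x, η x ∂μ.toJordanDecomposition.negPart)

/-- `u ∈ SBV(a, b)`: `u` is integrable, its distributional derivative is a finite signed measure,
and the part of that measure that is singular to Lebesgue measure is concentrated on `S_u`, that is,
the Cantor part vanishes. -/
def SBV (a b : ℝ) (u : ℝ → ℝ) : Prop :=
  IntegrableOn u (Ioo a b) ∧
    ∃ μ : SignedMeasure ℝ, IsDistribDeriv a b u μ ∧
      (μ.singularPart volume).totalVariation (Ioo a b \ singularSet a b u) = 0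

/-! ### Rectifiable one-dimensional currents in `(a, b) × ℝ` -/

/-- The Euclidean plane; a point `p` has coordinates `x = p 0` and `t = p 1`. -/
abbrev Plane : Type := EuclideanSpace ℝ (Fin 2)

/-- The open strip `(a, b) × ℝ`. -/
def strip (a b : ℝ) : TopologicalSpace.Opens Plane where
  carrier := {p | p 0 ∈ Ioo a b}
  is_open' := isOpen_Ioo.preimage (by fun_prop : Continuous fun p : Plane => p 0)

/-- Smooth compactly supported differential `1`-forms on `(a, b) × ℝ`. -/
abbrev TestForm (a b : ℝ) : Type := 𝓓(strip a b, Plane →L[ℝ] ℝ)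

/-- The data `(M, θ, ξ)` of a rectifiable current: carrier, multiplicity and orientation. -/
structure Triple where
  carrier : Set Plane
  mult : Plane → ℝ
  orient : Plane → Plane

/-- `(M, θ, ξ)` defines a rectifiable `1`-current with real multiplicity and finite mass in
`(a, b) × ℝ`: `M` is covered, up to an `ℋ¹`-null set, by countably many Lipschitz curves, the
multiplicity is positive and `ℋ¹`-integrable on `M`, and `ξ` is a unit vector which is tangent to `M`
(that is, to the covering curves). -/
structure Triple.IsRectifiable (a b : ℝ) (R : Triple) : Prop where
  subset : R.carrier ⊆ strip a b
  nullMeasurable : NullMeasurableSet R.carrier (Measure.hausdorffMeasure 1)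
  mult_pos : ∀ p ∈ R.carrier, 0 < R.mult p
  mult_integrable : IntegrableOn R.mult R.carrier (Measure.hausdorffMeasure 1)
  orient_aemeasurable :
    AEMeasurable R.orient ((Measure.hausdorffMeasure 1).restrict R.carrier)
  orient_unit : ∀ᵐ p ∂(Measure.hausdorffMeasure 1).restrict R.carrier, ‖R.orient p‖ = 1
  curves : ∃ γ : ℕ → ℝ → Plane, (∀ j, ∃ L, LipschitzWith L (γ j)) ∧
    Measure.hausdorffMeasure 1 (R.carrier \ ⋃ j, range (γ j)) = 0 ∧
    ∀ j, ∀ᵐ s : ℝ, γ j s ∈ R.carrier → ∃ c : ℝ, deriv (γ j) s = c • R.orient (γ j s)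

/-- The current defined by `(M, θ, ξ)`, as a functional on test forms:
`σ ↦ ∫_M ⟨σ, ξ⟩ θ dℋ¹`. -/
def Triple.current (a b : ℝ) (R : Triple) : TestForm a b → ℝ := fun σ =>
  ∫ p in R.carrier, R.mult p * σ p (R.orient p) ∂(Measure.hausdorffMeasure 1)

/-- The normal `ν = -⋆ξ`, where `⋆(ξ₁, ξ₂) = (-ξ₂, ξ₁)`. -/
def Triple.normal (R : Triple) (p : Plane) : Plane :=
  !₂[R.orient p 1, -R.orient p 0]

/-- The extended graph of `u`: vertical segments fill the jumps. -/
def extendedGraph (a b : ℝ) (u : ℝ → ℝ) : Set Plane :=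
  {p | p 0 ∈ Ioo a b ∧ min (leftTrace u (p 0)) (rightTrace u (p 0)) ≤ p 1 ∧
    p 1 ≤ max (leftTrace u (p 0)) (rightTrace u (p 0))}

open Classical in
/-- The unit tangent to the extended graph, oriented by increasing `x` on the graph part and from
the left trace to the right trace on the vertical segments. -/
def graphTangent (a b : ℝ) (u : ℝ → ℝ) (p : Plane) : Plane :=
  if p 0 ∈ singularSet a b u then
    !₂[0, Real.sign (rightTrace u (p 0) - leftTrace u (p 0))]
  else
    (√(1 + approxDeriv u (p 0) ^ 2))⁻¹ • !₂[1, approxDeriv u (p 0)]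

/-- The extended graph with unit multiplicity, as a triple. -/
def graphTriple (a b : ℝ) (u : ℝ → ℝ) : Triple where
  carrier := extendedGraph a b u
  mult := fun _ => 1
  orient := graphTangent a b u

/-- The current `Γ_u`. -/
def graphCurrent (a b : ℝ) (u : ℝ → ℝ) : TestForm a b → ℝ :=
  (graphTriple a b u).current a b

/-! ### The lifted Mumford-Shah functional -/

/-- The class `K` of Borel vector fields `φ = (φˣ, φᵗ)` satisfying the two convex constraints. -/
def admissible (a b α β : ℝ) (g : ℝ → ℝ) : Set (Plane → Plane) :=
  {φ | Measurable φ ∧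
    (∀ x ∈ Ioo a b, ∀ t : ℝ,
      (φ !₂[x, t] 0) ^ 2 / 4 - β * (t - g x) ^ 2 ≤ φ !₂[x, t] 1) ∧
    (∀ x ∈ Ioo a b, ∀ t₁ t₂ : ℝ,
      IntervalIntegrable (fun t => φ !₂[x, t] 0) volume t₁ t₂ ∧
        |∫ t in t₁..t₂, φ !₂[x, t] 0| ≤ α)}

/-- The supremum over `φ ∈ K` of `∫_M θ ⟨φ, ν⟩ dℋ¹`, taken over those `φ` for which the integral
converges. -/
def Triple.lift (a b α β : ℝ) (g : ℝ → ℝ) (R : Triple) : EReal :=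
  ⨆ φ ∈ admissible a b α β g,
    ⨆ _ : IntegrableOn (fun p => R.mult p * inner ℝ (φ p) (R.normal p)) R.carrier
      (Measure.hausdorffMeasure 1),
    ((∫ p in R.carrier, R.mult p * inner ℝ (φ p) (R.normal p)
      ∂(Measure.hausdorffMeasure 1) : ℝ) : EReal)

/-- The lifted functional `G(T)` of a rectifiable current `T`, computed on the triples `(M, θ, ξ)`
that define `T`. All of them give the same value, since `T` determines the vector measure
`θ ξ ℋ¹⌞M`; a functional that is not a rectifiable current gets the value `⊥`. -/
def G (a b α β : ℝ) (g : ℝ → ℝ) (T : TestForm a b → ℝ) : EReal :=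
  ⨆ R : Triple, ⨆ _ : R.IsRectifiable a b ∧ R.current a b = T, R.lift a b α β g

end MumfordShah

end

/-! In one dimension an `SBV` function with finite singular set agrees almost everywhere with a
primitive of an integrable function plus finitely many jumps (`SBV.exists_represents`). With a
common finite set `F` of jump points, each `Γ_u` is therefore an absolutely continuous graph
together with vertical segments over `F`, and everything is computed from the data `PiecewiseAC`.

Upper bound (`G_sumCurrent_le`). Along a graph of slope `u'` the pairing with `φ` has density `φˣ u'
- φᵗ` in `x`. Completing the square in the first constraint bounds it by `u'² + β (u - g)²`, and the
second constraint bounds the contribution of each jump by `α`. Hence `G` of a sum is at most the sum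
of the Mumford-Shah energies, for any decomposition into graphs.

Equality (`G_sumCurrent_eq`) needs one field that calibrates all graphs at once. On the graphs it
has `φˣ = 2u'` and `φᵗ = u'² - β (t - g)²`. This is consistent because graphs have the same slope
almost everywhere on the set where they meet. Since fields in `K` are only Borel, this part can be
supported on the graphs, where each vertical line off `F` sees finitely many points and the integral
constraint is free. Over a jump point one takes `φˣ = α Φ'` with `0 ≤ Φ ≤ 1`, `Φ = 0` at the left
traces and `Φ = 1` at the right traces of all jumping functions. Such a `Φ` exists when no left
trace of a jumping function is a right trace of a jumping one, which is `Matched`.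

Any family can be rearranged to be matched (`exists_matched`): at each jump point permute the
continuations to the right so that as many functions as possible do not jump
(`exists_perm_matching`). The current is unchanged (`sumCurrent_splice`), because a vertical
integral is a difference of values of one primitive and its sum only sees the collections of left
and right endpoints. A single graph is always matched, so `G` of each summand is its own energy, and
the energies add up to `G` of the sum. -/

noncomputable section

namespace MumfordShah

open scoped NNReal ENNReal Function

/-! ### Length of curves -/

section Area

variable {E : Type*} [NormedAddCommGroup E] [NormedSpace ℝ E] [MeasurableSpace E] [BorelSpace E]

/-- On `s` the curve is Lipschitz with constant `‖A 1‖ + δ`, and `ℋ¹` on the line is Lebesgue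
measure. -/
lemma _root_.ApproximatesLinearOn.hausdorffMeasure_image_le {γ : ℝ → E} {A : ℝ →L[ℝ] E} {s : Set ℝ}
    {δ : ℝ≥0} (h : ApproximatesLinearOn γ A s δ) :
    Measure.hausdorffMeasure 1 (γ '' s) ≤ ENNReal.ofReal (‖A 1‖ + δ) * volume s := by
  have hl : LipschitzOnWith (‖A 1‖₊ + δ) γ s := by
    refine LipschitzOnWith.of_dist_le_mul fun x hx y hy => ?_
    have h1 := h x hx y hy
    have h2 : A (x - y) = (x - y) • A 1 := by rw [← map_smul, smul_eq_mul, mul_one]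
    rw [dist_eq_norm, dist_eq_norm]
    have h3 : γ x - γ y = (γ x - γ y - A (x - y)) + A (x - y) := by abel
    calc ‖γ x - γ y‖ ≤ ‖γ x - γ y - A (x - y)‖ + ‖A (x - y)‖ := by
          conv_lhs => rw [h3]
          exact norm_add_le _ _
      _ ≤ δ * ‖x - y‖ + ‖x - y‖ * ‖A 1‖ := by
          have h5 : ‖A (x - y)‖ = ‖x - y‖ * ‖A 1‖ := by rw [h2, norm_smul]
          rw [h5]
          exact add_le_add_left h1 _
      _ = _ := by push_cast; ring
  have h4 := hl.hausdorffMeasure_image_le (d := 1) zero_le_one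
  rw [ENNReal.rpow_one, hausdorffMeasure_real] at h4
  convert h4 using 2
  rw [← ENNReal.ofReal_coe_nnreal]
  simp

/-- If `δ < ‖A 1‖`, the curve is injective on `s` and its inverse is Lipschitz with constant `(‖A 1‖
- δ)⁻¹`; otherwise the left side is zero. -/
lemma _root_.ApproximatesLinearOn.le_hausdorffMeasure_image {γ : ℝ → E} {A : ℝ →L[ℝ] E} {s : Set ℝ}
    {δ : ℝ≥0} (h : ApproximatesLinearOn γ A s δ) :
    ENNReal.ofReal (‖A 1‖ - δ) * volume s ≤ Measure.hausdorffMeasure 1 (γ '' s) := by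
  rcases le_or_gt (‖A 1‖ - δ) 0 with h0 | h0
  · rw [ENNReal.ofReal_of_nonpos h0, zero_mul]; exact zero_le
  set c := ‖A 1‖ - δ with hc
  have key : ∀ x ∈ s, ∀ y ∈ s, c * ‖x - y‖ ≤ ‖γ x - γ y‖ := by
    intro x hx y hy
    have h1 := h x hx y hy
    have h2 : A (x - y) = (x - y) • A 1 := by rw [← map_smul, smul_eq_mul, mul_one]
    have h3 : A (x - y) = (γ x - γ y) - (γ x - γ y - A (x - y)) := by abel
    have h4 : ‖A (x - y)‖ ≤ ‖γ x - γ y‖ + ‖γ x - γ y - A (x - y)‖ := by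
      conv_lhs => rw [h3]
      exact norm_sub_le _ _
    have h5 : ‖A (x - y)‖ = ‖x - y‖ * ‖A 1‖ := by rw [h2, norm_smul]
    rw [hc]; nlinarith
  have hinj : InjOn γ s := by
    intro x hx y hy hxy
    have := key x hx y hy
    rw [hxy, sub_self, norm_zero] at this
    have h6 : ‖x - y‖ ≤ 0 := by
      by_contra hcon
      push Not at hcon
      nlinarith
    exact sub_eq_zero.1 (norm_le_zero_iff.1 h6)
  set ι := Function.invFunOn γ s
  have hι : ∀ x ∈ s, ι (γ x) = x := fun x hx => hinj.leftInvOn_invFunOn hx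
  have hl : LipschitzOnWith (Real.toNNReal c⁻¹) ι (γ '' s) := by
    refine LipschitzOnWith.of_dist_le_mul ?_
    rintro _ ⟨x, hx, rfl⟩ _ ⟨y, hy, rfl⟩
    rw [hι x hx, hι y hy, dist_eq_norm, dist_eq_norm, Real.coe_toNNReal _ (by positivity)]
    rw [inv_mul_eq_div, le_div_iff₀ h0, mul_comm]
    exact key x hx y hy
  have h4 := hl.hausdorffMeasure_image_le (d := 1) zero_le_one
  have h5 : ι '' (γ '' s) = s := by
    rw [image_image]
    ext x; constructor
    · rintro ⟨y, hy, rfl⟩; simpa only [hι y hy] using hy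
    · intro hx; exact ⟨x, hx, hι x hx⟩
  rw [ENNReal.rpow_one, h5, hausdorffMeasure_real] at h4
  calc ENNReal.ofReal c * volume s
      ≤ ENNReal.ofReal c * (ENNReal.ofReal c⁻¹ * Measure.hausdorffMeasure 1 (γ '' s)) :=
        by gcongr; exact h4
    _ = _ := by
        rw [← mul_assoc, ← ENNReal.ofReal_mul h0.le, mul_inv_cancel₀ h0.ne', ENNReal.ofReal_one,
          one_mul]

variable [SecondCountableTopology E]

/-- A set on which a curve is differentiable splits into countably many measurable pieces on which
the curve is almost affine and its speed almost constant. -/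
lemma exists_partition_almost_affine {γ γ' : ℝ → E} {s : Set ℝ} (hs : MeasurableSet s)
    (hγ : ∀ x ∈ s, HasDerivWithinAt γ (γ' x) s x) (hm : Measurable γ') {δ : ℝ≥0} (hδ : δ ≠ 0) :
    ∃ (t : ℕ × ℕ → Set ℝ) (A : ℕ × ℕ → ℝ →L[ℝ] E), Pairwise (Disjoint on t) ∧
      (∀ p, MeasurableSet (t p)) ∧ (⋃ p, t p = s) ∧
      (∀ p, ApproximatesLinearOn γ (A p) (t p) δ) ∧
      ∀ p, ∀ x ∈ t p, |‖γ' x‖ - ‖A p 1‖| ≤ δ := by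
  have hδ' : (0 : ℝ) < δ := by positivity
  -- Slicing by the integer part of speed over `δ` makes the speed vary by at most `δ` on a slice.
  -- Each `A` is the derivative at some point of its slice, so its norm lies in the same band.
  set q : ℕ → Set ℝ := fun j => {x | x ∈ s ∧ ⌊‖γ' x‖ / δ⌋₊ = j} with hq
  have hqs : ∀ j, q j ⊆ s := fun j x hx => hx.1
  have hqm : ∀ j, MeasurableSet (q j) := fun j =>
    hs.inter ((Nat.measurable_floor.comp (hm.norm.div_const _)) (measurableSet_singleton j))
  choose t A h1 h2 h3 h4 h5 using fun j =>
    exists_partition_approximatesLinearOn_of_hasFDerivWithinAt γ (q j)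
      (fun x => ContinuousLinearMap.toSpanSingleton ℝ (γ' x))
      (fun x hx => ((hγ x hx.1).mono (hqs j)).hasFDerivWithinAt) (fun _ => δ) (fun _ => hδ)
  refine ⟨fun p => q p.1 ∩ t p.1 p.2, fun p => A p.1 p.2, ?_, fun p => (hqm _).inter (h2 _ _), ?_,
    fun p => h4 _ _, ?_⟩
  · intro p r hpr
    rcases eq_or_ne p.1 r.1 with h | h
    · have : p.2 ≠ r.2 := fun h' => hpr (Prod.ext h h')
      refine Set.disjoint_of_subset inter_subset_right inter_subset_right ?_
      rw [h]
      exact h1 r.1 this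
    · refine Set.disjoint_of_subset inter_subset_left inter_subset_left ?_
      rw [Set.disjoint_left]
      rintro x ⟨_, hx⟩ ⟨_, hx'⟩
      exact h (hx.symm.trans hx')
  · ext x
    simp only [mem_iUnion, mem_inter_iff, Prod.exists]
    constructor
    · rintro ⟨i, j, hx, _⟩; exact hx.1
    · intro hx
      have hxq : x ∈ q ⌊‖γ' x‖ / δ⌋₊ := ⟨hx, rfl⟩
      obtain ⟨n, hn⟩ := mem_iUnion.1 (h3 _ hxq)
      exact ⟨_, n, hxq, hn⟩
  · rintro ⟨i, j⟩ x ⟨hx, _⟩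
    obtain ⟨y, hy, hAy⟩ := h5 i ⟨x, hx⟩ j
    have hA1 : A i j 1 = γ' y := by rw [hAy]; simp
    simp only [hA1]
    have hfl : ∀ z ∈ q i, (i : ℝ) * δ ≤ ‖γ' z‖ ∧ ‖γ' z‖ ≤ (i + 1) * δ := by
      intro z hz
      have hz' := hz.2
      constructor
      · rw [← le_div_iff₀ hδ', ← hz']
        exact Nat.floor_le (by positivity)
      · rw [← div_le_iff₀ hδ', ← hz']
        exact (Nat.lt_floor_add_one _).le
    have hx1 := hfl x hx
    have hy1 := hfl y hy
    rw [abs_le]; constructor <;> nlinarith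

lemma tendsto_add_inv_mul_atTop {v : ℝ≥0∞} (hv : v ≠ ⊤) (X : ℝ≥0∞) :
    Tendsto (fun n : ℕ => X + 2 * (((n + 1 : ℝ≥0)⁻¹ : ℝ≥0) : ℝ≥0∞) * v) atTop (𝓝 X) := by
  have h0 : Tendsto (fun n : ℕ => (((n + 1 : ℝ≥0)⁻¹ : ℝ≥0) : ℝ≥0∞)) atTop (𝓝 0) := by
    rw [← ENNReal.coe_zero, ENNReal.tendsto_coe]
    have h2 := tendsto_one_div_add_atTop_nhds_zero_nat (𝕜 := ℝ)
    rw [← NNReal.tendsto_coe]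
    simpa using h2
  have h1 := ENNReal.Tendsto.mul_const (b := v)
    (ENNReal.Tendsto.const_mul h0 (a := 2) (Or.inr (by norm_num))) (Or.inr hv)
  simpa using h1.const_add X

/-- **Length of a curve.** The one-dimensional Hausdorff measure of the injective image of a set of
finite measure is the integral of the speed. -/
theorem hausdorffMeasure_one_image_eq_lintegral {γ γ' : ℝ → E} {s : Set ℝ} (hs : MeasurableSet s)
    (hfin : volume s ≠ ⊤) (hγ : ∀ x ∈ s, HasDerivWithinAt γ (γ' x) s x) (hm : Measurable γ')
    (hinj : InjOn γ s) :
    Measure.hausdorffMeasure 1 (γ '' s) = ∫⁻ x in s, ‖γ' x‖ₑ := by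
  -- The error `2δ` per unit length is one `δ` for the deviation from an affine map and one for the
  -- variation of the speed on a piece.
  have bounds : ∀ δ : ℝ≥0, δ ≠ 0 →
      Measure.hausdorffMeasure 1 (γ '' s) ≤ (∫⁻ x in s, ‖γ' x‖ₑ) + 2 * δ * volume s ∧
      (∫⁻ x in s, ‖γ' x‖ₑ) ≤ Measure.hausdorffMeasure 1 (γ '' s) + 2 * δ * volume s := by
    intro δ hδ
    obtain ⟨t, A, h1, h2, h3, h4, h5⟩ := exists_partition_almost_affine hs hγ hm hδ
    have hts : ∀ p, t p ⊆ s := fun p => h3 ▸ subset_iUnion t p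
    have hcont : ContinuousOn γ s := fun x hx => (hγ x hx).continuousWithinAt
    have hvol : volume s = ∑' p, volume (t p) := by rw [← h3, measure_iUnion h1 h2]
    have hint : ∫⁻ x in s, ‖γ' x‖ₑ = ∑' p, ∫⁻ x in t p, ‖γ' x‖ₑ := by
      rw [← h3, lintegral_iUnion h2 h1]
    have himg : Measure.hausdorffMeasure 1 (γ '' s) =
        ∑' p, Measure.hausdorffMeasure 1 (γ '' t p) := by
      rw [← h3, image_iUnion, measure_iUnion]
      · intro p r hpr
        exact (hinj.mono (union_subset (hts p) (hts r))).image_inter subset_union_left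
          subset_union_right |> fun h => by
            rw [Function.onFun, Set.disjoint_iff_inter_eq_empty, ← h,
              Set.disjoint_iff_inter_eq_empty.1 (h1 hpr), image_empty]
      · intro p
        -- Injective continuous images of Borel sets are Borel (Lusin-Souslin), so the lengths of
        -- the disjoint images add.
        exact (h2 p).image_of_continuousOn_injOn (hcont.mono (hts p)) (hinj.mono (hts p))
    rw [hvol, hint, himg, ← ENNReal.tsum_mul_left, ← ENNReal.tsum_add, ← ENNReal.tsum_add]
    have hconst : ∀ p, 2 * (δ : ℝ≥0∞) * volume (t p) = ∫⁻ _ in t p, 2 * (δ : ℝ≥0∞) := by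
      intro p; rw [setLIntegral_const]
    have h2δ : (2 * (δ : ℝ≥0∞)) = ENNReal.ofReal (2 * δ) := by
      rw [ENNReal.ofReal_mul (by norm_num), ENNReal.ofReal_coe_nnreal]; norm_num
    constructor
    · refine ENNReal.tsum_le_tsum fun p => ?_
      refine (h4 p).hausdorffMeasure_image_le.trans ?_
      rw [hconst, ← lintegral_add_right _ measurable_const, ← setLIntegral_const]
      refine setLIntegral_mono' (h2 p) fun x hx => ?_
      rw [h2δ, ← ofReal_norm, ← ENNReal.ofReal_add (norm_nonneg _) (by positivity)]
      refine ENNReal.ofReal_le_ofReal ?_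
      have := abs_le.1 (h5 p x hx)
      linarith
    · refine ENNReal.tsum_le_tsum fun p => ?_
      have hb := (h4 p).le_hausdorffMeasure_image
      refine le_trans ?_ (add_le_add_left hb _)
      rw [← add_mul, ← setLIntegral_const]
      refine setLIntegral_mono' (h2 p) fun x hx => ?_
      have h6 := abs_le.1 (h5 p x hx)
      rw [h2δ, ← ofReal_norm]
      refine le_trans (ENNReal.ofReal_le_ofReal (?_ : _ ≤ (‖A p 1‖ - δ) + 2 * δ))
        ENNReal.ofReal_add_le
      linarith
  have lim := tendsto_add_inv_mul_atTop hfin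
  refine le_antisymm ?_ ?_
  · exact ge_of_tendsto' (lim _) fun n => (bounds _ (by positivity)).1
  · exact ge_of_tendsto' (lim _) fun n => (bounds _ (by positivity)).2

end Area

/-! ### Measures determined by test functions -/

/-- If a finite sum of finite signed measures vanishes on the smooth functions with compact support
in an open set that carries the measures, then it vanishes on bounded Borel functions. -/
theorem sum_integral_mul_eq_zero_of_contDiff {ι E : Type*} [Fintype ι] [NormedAddCommGroup E]
    [NormedSpace ℝ E] [FiniteDimensional ℝ E] [MeasurableSpace E] [BorelSpace E] {U : Set E}
    (hU : IsOpen U) (ρ : ι → Measure E) [∀ i, IsFiniteMeasure (ρ i)] (hρ : ∀ i, ρ i Uᶜ = 0)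
    (h : ι → E → ℝ) (hh : ∀ i, Integrable (h i) (ρ i))
    (H : ∀ g : E → ℝ, ContDiff ℝ ∞ g → HasCompactSupport g → tsupport g ⊆ U →
      ∑ i, ∫ p, g p * h i p ∂ρ i = 0)
    {ψ : E → ℝ} (hψ : Measurable ψ) {B : ℝ} (hB : ∀ p, |ψ p| ≤ B) :
    ∑ i, ∫ p, ψ p * h i p ∂ρ i = 0 := by
  -- All measures have densities with respect to their sum `m`. The hypothesis becomes the vanishing
  -- of the single density `f` against test functions, hence `f = 0` almost everywhere on `U`.
  set m : Measure E := ∑ i, ρ i with hm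
  have hac : ∀ i, ρ i ≪ m := fun i =>
    Measure.absolutelyContinuous_of_le (Finset.single_le_sum (f := ρ) (fun _ _ => Measure.zero_le _)
      (Finset.mem_univ i))
  set f : E → ℝ := fun p => ∑ i, ((ρ i).rnDeriv m p).toReal * h i p with hf
  have hfi : ∀ i, Integrable (fun p => ((ρ i).rnDeriv m p).toReal * h i p) m := fun i =>
    (integrable_toReal_rnDeriv_mul_iff (hac i)).2 (hh i)
  have hfint : Integrable f m := integrable_finsetSum _ fun i _ => hfi i
  have expand : ∀ g : E → ℝ, Measurable g → (∃ C, ∀ p, |g p| ≤ C) →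
      ∫ p, g p * f p ∂m = ∑ i, ∫ p, g p * h i p ∂ρ i := by
    rintro g hg ⟨C, hC⟩
    have h1 : ∀ i, Integrable (fun p => g p * h i p) (ρ i) := fun i =>
      (hh i).bdd_mul hg.aestronglyMeasurable (ae_of_all _ hC)
    have h2 : ∀ i, ∫ p, g p * h i p ∂ρ i =
        ∫ p, ((ρ i).rnDeriv m p).toReal * (g p * h i p) ∂m := fun i =>
      (integral_toReal_rnDeriv_mul (hac i)).symm
    simp_rw [h2]
    rw [← integral_finsetSum _ fun i _ => (integrable_toReal_rnDeriv_mul_iff (hac i)).2 (h1 i)]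
    refine integral_congr_ae (ae_of_all _ fun p => ?_)
    simp only [hf, Finset.mul_sum]
    exact Finset.sum_congr rfl fun i _ => by ring
  have hzero : ∀ᵐ p ∂m, p ∈ U → f p = 0 := by
    refine hU.ae_eq_zero_of_integral_contDiff_smul_eq_zero
      (hfint.locallyIntegrable.locallyIntegrableOn U) fun g hg hgc hgU => ?_
    simp_rw [smul_eq_mul]
    obtain ⟨C, hC⟩ := hgc.exists_bound_of_continuous hg.continuous
    rw [expand g hg.continuous.measurable ⟨C, hC⟩]
    exact H g hg hgc hgU
  have hmU : ∀ᵐ p ∂m, p ∈ U := by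
    change m Uᶜ = 0
    rw [hm]
    simpa using fun i => hρ i
  rw [← expand ψ hψ ⟨B, hB⟩]
  refine integral_eq_zero_of_ae ?_
  filter_upwards [hzero, hmU] with p h1 h2
  simp [h1 h2]

/-! ### Absolutely continuous functions -/

/-- The derivative of a function vanishes almost everywhere on the zero set of the function. -/
lemma ae_deriv_eq_zero_of_eq_zero {v v' : ℝ → ℝ} (h : ∀ᵐ x, HasDerivAt v (v' x) x) :
    ∀ᵐ x, v x = 0 → v' x = 0 := by
  -- Only countably many zeros are isolated from the right. At any other zero, zeros accumulate from
  -- the right, which excludes a nonzero derivative.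
  have hc : ({x ∈ {x | v x = 0} | 𝓝[{x | v x = 0} ∩ Ioi x] x = ⊥}).Countable :=
    countable_setOfPred_isolated_right_within
  filter_upwards [h, hc.ae_notMem volume] with x hx hxn hx0
  by_contra hne
  refine hxn ⟨hx0, ?_⟩
  have h1 : ∀ᶠ z in 𝓝[≠] x, v z ≠ v x := hx.eventually_ne hne
  rw [← Filter.empty_mem_iff_bot]
  have h2 : 𝓝[{x | v x = 0} ∩ Ioi x] x ≤ 𝓝[≠] x :=
    nhdsWithin_mono _ fun z hz => (ne_of_gt hz.2 : z ≠ x)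
  filter_upwards [h2 h1, self_mem_nhdsWithin] with z hz hz'
  rw [hx0] at hz
  exact hz hz'.1

/-- The graph of a primitive of an integrable function is a Lipschitz curve, with a parametrization
that pulls back null sets of abscissae to null sets. -/
lemma exists_lipschitz_graph_param {f : ℝ → ℝ} (hf : Integrable f) (a C : ℝ) :
    ∃ X : ℝ → ℝ, Function.Surjective X ∧ LipschitzWith 1 X ∧
      LipschitzWith 1 (fun σ => C + ∫ t in a..X σ, f t) ∧
      ∀ N : Set ℝ, volume N = 0 → volume (X ⁻¹' N) = 0 := by
  have hii : ∀ x y, IntervalIntegrable f volume x y := fun x y => hf.intervalIntegrable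
  have hia : ∀ x y, IntervalIntegrable (fun t => |f t|) volume x y := fun x y => (hii x y).abs
  -- The parameter has density `1 + |f|`, which dominates both the increment of `x` and that of the
  -- primitive; so both are 1-Lipschitz functions of it. `X` is the inverse of `s`.
  set s : ℝ → ℝ := fun x => x + ∫ t in a..x, |f t| with hs
  have hsub : ∀ x y, s y - s x = (y - x) + ∫ t in x..y, |f t| := by
    intro x y
    have := intervalIntegral.integral_interval_sub_left (hia a y) (hia a x)
    simp only [hs]; linarith
  have hnn : ∀ x y, x ≤ y → 0 ≤ ∫ t in x..y, |f t| := fun x y h =>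
    intervalIntegral.integral_nonneg h fun _ _ => abs_nonneg _
  have hmono : StrictMono s := by
    intro x y hxy
    have := hsub x y
    have := hnn x y hxy.le
    linarith
  have hcont : Continuous s :=
    continuous_id.add (intervalIntegral.continuous_primitive hia a)
  have hsurj : Function.Surjective s := by
    refine hcont.surjective ?_ ?_
    · refine tendsto_atTop_mono' _ ?_ tendsto_id
      filter_upwards [eventually_ge_atTop a] with x hx
      have := hnn a x hx
      simp only [hs, id]; linarith
    · refine tendsto_atBot_mono' _ ?_ tendsto_id
      filter_upwards [eventually_le_atBot a] with x hx
      have := hnn x a hx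
      rw [intervalIntegral.integral_symm] at this
      simp only [hs, id]; linarith
  set e : ℝ ≃o ℝ := hmono.orderIsoOfSurjective s hsurj with he
  have hes : ∀ x, e x = s x := fun x => rfl
  have hse : ∀ σ, s (e.symm σ) = σ := fun σ => by rw [← hes]; simp
  have hord : ∀ σ τ, σ ≤ τ → e.symm σ ≤ e.symm τ := fun σ τ h => e.symm.monotone h
  have key : ∀ σ τ, σ ≤ τ → τ - σ = (e.symm τ - e.symm σ) + ∫ t in e.symm σ..e.symm τ, |f t| := by
    intro σ τ _
    have := hsub (e.symm σ) (e.symm τ)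
    rwa [hse, hse] at this
  refine ⟨e.symm, e.symm.surjective, ?_, ?_, ?_⟩
  · refine LipschitzWith.of_dist_le_mul fun σ τ => ?_
    wlog h : σ ≤ τ generalizing σ τ
    · rw [dist_comm, dist_comm σ]; exact this τ σ (le_of_not_ge h)
    have h1 := hord σ τ h
    have h2 := hnn _ _ h1
    have h3 := key σ τ h
    rw [dist_comm, dist_comm σ, Real.dist_eq, Real.dist_eq, abs_of_nonneg (by linarith),
      abs_of_nonneg (by linarith)]
    simp; linarith
  · refine LipschitzWith.of_dist_le_mul fun σ τ => ?_
    wlog h : σ ≤ τ generalizing σ τ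
    · rw [dist_comm, dist_comm σ]; exact this τ σ (le_of_not_ge h)
    have h1 := hord σ τ h
    have h3 := key σ τ h
    have h4 := intervalIntegral.integral_interval_sub_left (hii a (e.symm τ)) (hii a (e.symm σ))
    have h5 := intervalIntegral.abs_integral_le_integral_abs (f := f) (μ := volume) h1
    rw [dist_comm, dist_comm σ, Real.dist_eq, Real.dist_eq, abs_of_nonneg (a := τ - σ) (by linarith)]
    rw [add_sub_add_left_eq_sub, h4]
    simp; linarith
  · have hmeas : Measurable e.symm := e.symm.monotone.measurable
    set d : ℝ → ℝ≥0∞ := fun x => ENNReal.ofReal (1 + |f x|) with hd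
    -- The image of Lebesgue measure under `X` has density `1 + |f|`, so preimages of null sets are
    -- null.
    have hmap : Measure.map e.symm volume = volume.withDensity d := by
      have : IsLocallyFiniteMeasure (Measure.map e.symm (volume : Measure ℝ)) := by
        refine ⟨fun x => ⟨Ioo (x - 1) (x + 1), Ioo_mem_nhds (by linarith) (by linarith), ?_⟩⟩
        rw [Measure.map_apply hmeas measurableSet_Ioo, OrderIso.preimage_Ioo, Real.volume_Ioo]
        exact ENNReal.ofReal_lt_top
      refine Real.measure_ext_Ioo_rat fun p q => ?_
      rw [Measure.map_apply hmeas measurableSet_Ioo, OrderIso.preimage_Ioo, Real.volume_Ioo,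
        withDensity_apply _ measurableSet_Ioo]
      simp only [OrderIso.symm_symm, hes]
      rcases le_or_gt (q : ℝ) p with h | h
      · rw [ENNReal.ofReal_of_nonpos (by linarith [hmono.monotone h]), Ioo_eq_empty (not_lt.2 h)]
        simp
      · have hint : IntegrableOn (fun x => 1 + |f x|) (Ioo (p : ℝ) q) :=
          (integrableOn_const (by simp)).add hf.abs.integrableOn
        rw [← ofReal_integral_eq_lintegral_ofReal hint
          (ae_of_all _ fun x => by positivity), hsub, ← integral_Ioc_eq_integral_Ioo,
          ← intervalIntegral.integral_of_le h.le, intervalIntegral.integral_add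
            (by simp) (hia _ _)]
        simp
    intro N hN
    obtain ⟨N', hNN', hN'm, hN'⟩ := exists_measurable_superset_of_null hN
    refine measure_mono_null (preimage_mono hNN') ?_
    rw [← Measure.map_apply hmeas hN'm, hmap]
    exact withDensity_absolutelyContinuous _ _ hN'

/-! ### Piecewise absolutely continuous functions -/

/-- The data of a piecewise absolutely continuous function with jumps in `F`: the initial value at
`a`, the density of the absolutely continuous part of the derivative, and the jumps. -/
structure PiecewiseAC (a : ℝ) (F : Finset ℝ) where
  const : ℝ
  dens : ℝ → ℝ
  jump : ℝ → ℝ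
  measurable_dens : Measurable dens
  integrable_dens : Integrable dens
  jump_eq_zero : ∀ s, s ∉ F → jump s = 0

namespace PiecewiseAC

variable {a b : ℝ} {F : Finset ℝ} (D : PiecewiseAC a F)

/-- The continuous part. -/
def ac (x : ℝ) : ℝ := D.const + ∫ t in a..x, D.dens t

/-- The left continuous representative. -/
def left (x : ℝ) : ℝ := D.ac x + ∑ s ∈ F, if s < x then D.jump s else 0

/-- The right continuous representative. -/
def right (x : ℝ) : ℝ := D.left x + D.jump x

lemma intervalIntegrable_dens (x y : ℝ) : IntervalIntegrable D.dens volume x y :=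
  D.integrable_dens.intervalIntegrable

lemma continuous_ac : Continuous D.ac :=
  continuous_const.add (intervalIntegral.continuous_primitive D.intervalIntegrable_dens a)

lemma ae_hasDerivAt_ac : ∀ᵐ x, HasDerivAt D.ac (D.dens x) x := by
  filter_upwards [LocallyIntegrable.ae_hasDerivAt_integral D.integrable_dens.locallyIntegrable] with x hx
  exact (hx a).const_add _

lemma measurable_left : Measurable D.left := by
  refine D.continuous_ac.measurable.add (Finset.measurable_fun_sum _ fun s _ => ?_)
  exact Measurable.ite measurableSet_Ioi measurable_const measurable_const

lemma measurable_jump : Measurable D.jump := by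
  have : D.jump = fun x => ∑ s ∈ F, if x = s then D.jump s else 0 := by
    ext x
    by_cases hx : x ∈ F
    · rw [Finset.sum_ite_eq]; simp [hx]
    · rw [Finset.sum_ite_eq]; simp [hx, D.jump_eq_zero x hx]
  rw [this]
  refine Finset.measurable_fun_sum _ fun s _ => ?_
  exact Measurable.ite (measurableSet_singleton s) measurable_const measurable_const

lemma measurable_right : Measurable D.right := D.measurable_left.add D.measurable_jump

lemma exists_bound_left : ∃ B, 0 ≤ B ∧ ∀ x, |D.left x| ≤ B := by
  refine ⟨|D.const| + (∫ t, |D.dens t|) + ∑ s ∈ F, |D.jump s|, by positivity, fun x => ?_⟩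
  have h1 : |∫ t in a..x, D.dens t| ≤ ∫ t, |D.dens t| := by
    refine (intervalIntegral.norm_integral_le_integral_norm_uIoc (f := D.dens)).trans ?_
    exact setIntegral_le_integral D.integrable_dens.norm (ae_of_all _ fun _ => norm_nonneg _)
  have h2 : |∑ s ∈ F, if s < x then D.jump s else 0| ≤ ∑ s ∈ F, |D.jump s| := by
    refine (Finset.abs_sum_le_sum_abs _ _).trans (Finset.sum_le_sum fun s _ => ?_)
    split_ifs <;> simp
  have h3 := abs_add_le (D.const + ∫ t in a..x, D.dens t) (∑ s ∈ F, if s < x then D.jump s else 0)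
  have h4 := abs_add_le D.const (∫ t in a..x, D.dens t)
  simp only [left, ac]
  linarith

lemma tendsto_left_nhdsLT (x : ℝ) : Tendsto D.left (𝓝[<] x) (𝓝 (D.left x)) := by
  refine (D.continuous_ac.tendsto x |>.mono_left nhdsWithin_le_nhds).add
    (tendsto_finsetSum _ fun s _ => ?_)
  refine tendsto_const_nhds.congr' ?_
  rcases lt_or_ge s x with h | h
  · filter_upwards [nhdsWithin_le_nhds (Ioi_mem_nhds h)] with y hy
    simp [h, mem_Ioi.1 hy]
  · filter_upwards [self_mem_nhdsWithin] with y hy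
    simp [not_lt.2 h, ((mem_Iio.1 hy).le.trans h).not_gt]

lemma right_eq (x : ℝ) : D.right x = D.ac x + ∑ s ∈ F, if s ≤ x then D.jump s else 0 := by
  have h : D.jump x = ∑ s ∈ F, if s = x then D.jump s else 0 := by
    by_cases hx : x ∈ F
    · rw [Finset.sum_ite_eq']; simp [hx]
    · rw [Finset.sum_ite_eq']; simp [hx, D.jump_eq_zero x hx]
  rw [right, left, add_assoc, h, ← Finset.sum_add_distrib]
  congr 1
  refine Finset.sum_congr rfl fun s _ => ?_
  rcases lt_trichotomy s x with h | h | h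
  · simp [h, h.le, h.ne]
  · simp [h]
  · simp [h.not_gt, h.not_ge, h.ne']

lemma tendsto_left_nhdsGT (x : ℝ) : Tendsto D.left (𝓝[>] x) (𝓝 (D.right x)) := by
  rw [right_eq]
  refine (D.continuous_ac.tendsto x |>.mono_left nhdsWithin_le_nhds).add
    (tendsto_finsetSum _ fun s _ => ?_)
  refine tendsto_const_nhds.congr' ?_
  rcases le_or_gt s x with h | h
  · filter_upwards [self_mem_nhdsWithin] with y hy
    simp [h, h.trans_lt (mem_Ioi.1 hy)]
  · filter_upwards [nhdsWithin_le_nhds (Iio_mem_nhds h)] with y hy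
    simp [h.not_ge, (mem_Iio.1 hy).le.not_gt]

lemma eventually_left_sub_ac {x : ℝ} (hx : x ∉ F) :
    ∀ᶠ y in 𝓝 x, D.left y = D.ac y + (D.left x - D.ac x) := by
  have h : ∀ᶠ y in 𝓝 x, ∀ s ∈ F, (s < y ↔ s < x) := by
    rw [Filter.eventually_all_finset]
    intro s hs
    have hne : s ≠ x := fun h => hx (h ▸ hs)
    rcases lt_or_gt_of_ne hne with h | h
    · filter_upwards [Ioi_mem_nhds h] with y hy
      simp [h, mem_Ioi.1 hy]
    · filter_upwards [Iio_mem_nhds h] with y hy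
      simp [h.le.not_gt, (mem_Iio.1 hy).le.not_gt]
  filter_upwards [h] with y hy
  simp only [left, add_sub_cancel_left]
  congr 1
  exact Finset.sum_congr rfl fun s hs => by simp only [hy s hs]

lemma ae_notMem_finset (F : Finset ℝ) : ∀ᵐ x : ℝ, x ∉ F := by
  have := F.finite_toSet.countable.ae_notMem (volume : Measure ℝ)
  filter_upwards [this] with x hx
  simpa using hx

lemma ae_hasDerivAt_left : ∀ᵐ x, HasDerivAt D.left (D.dens x) x := by
  filter_upwards [D.ae_hasDerivAt_ac, ae_notMem_finset F] with x hx hxF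
  exact (hx.add_const _).congr_of_eventuallyEq (D.eventually_left_sub_ac hxF)

/-- `D` represents `u` almost everywhere on `(a, b)`. -/
def Represents (b : ℝ) (u : ℝ → ℝ) : Prop := u =ᵐ[volume.restrict (Ioo a b)] D.left

end PiecewiseAC

/-! ### Averages -/

lemma abs_setAverage_le {S : Set ℝ} {w : ℝ → ℝ} {ε : ℝ} (hε : 0 ≤ ε)
    (h : ∀ᵐ y ∂volume.restrict S, |w y| ≤ ε) : |⨍ y in S, w y| ≤ ε := by
  rw [setAverage_eq, smul_eq_mul, abs_mul, abs_inv, abs_of_nonneg measureReal_nonneg]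
  rcases eq_or_ne (volume S) ⊤ with htop | htop
  -- Over a set of infinite measure `volume.real` is zero, and so is the average.
  · rw [measureReal_def, htop]; simpa using hε
  have hfin : IsFiniteMeasure (volume.restrict S) := ⟨by simpa using htop.lt_top⟩
  have h1 : |∫ y in S, w y| ≤ ε * volume.real S := by
    have := norm_integral_le_of_norm_le_const (μ := volume.restrict S) (f := w) (C := ε) h
    simpa [measureReal_def] using this
  rcases eq_or_ne (volume.real S) 0 with h0 | h0
  · rw [h0]; simpa using hε
  · have h2 : 0 < volume.real S := lt_of_le_of_ne measureReal_nonneg (Ne.symm h0)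
    rw [inv_mul_le_iff₀ h2, mul_comm]
    exact h1

lemma tendsto_setAverage_zero {S : ℝ → Set ℝ} {w : ℝ → ℝ}
    (h : ∀ ε > 0, ∀ᶠ r in 𝓝[>] (0 : ℝ), ∀ᵐ y ∂volume.restrict (S r), |w y| ≤ ε) :
    Tendsto (fun r => ⨍ y in S r, w y) (𝓝[>] 0) (𝓝 0) := by
  rw [Metric.tendsto_nhds]
  intro ε hε
  filter_upwards [h (ε / 2) (by positivity)] with r hr
  rw [Real.dist_eq, sub_zero]
  exact (abs_setAverage_le (by positivity) hr).trans_lt (by linarith)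

lemma eventually_Ioo_subset {a b x : ℝ} (hx : x ∈ Ioo a b) :
    ∀ᶠ r in 𝓝[>] (0 : ℝ), Ioo (x - r) (x + r) ⊆ Ioo a b := by
  have h : (0 : ℝ) < min (x - a) (b - x) := lt_min (by linarith [hx.1]) (by linarith [hx.2])
  filter_upwards [nhdsWithin_le_nhds (Iio_mem_nhds h)] with r hr y hy
  have h1 := lt_min_iff.1 (mem_Iio.1 hr)
  constructor <;> linarith [hy.1, hy.2, h1.1, h1.2]

lemma eventually_Ioo_left_of_eventually {x : ℝ} {P : ℝ → Prop} (h : ∀ᶠ y in 𝓝[<] x, P y) :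
    ∀ᶠ r in 𝓝[>] (0 : ℝ), ∀ y ∈ Ioo (x - r) x, P y := by
  obtain ⟨l, hl, hP⟩ := mem_nhdsLT_iff_exists_Ioo_subset.1 h
  filter_upwards [nhdsWithin_le_nhds (Iio_mem_nhds (show (0 : ℝ) < x - l by
    linarith [mem_Iio.1 hl]))] with r hr y hy
  exact hP ⟨by linarith [hy.1, mem_Iio.1 hr], hy.2⟩

lemma eventually_Ioo_right_of_eventually {x : ℝ} {P : ℝ → Prop} (h : ∀ᶠ y in 𝓝[>] x, P y) :
    ∀ᶠ r in 𝓝[>] (0 : ℝ), ∀ y ∈ Ioo x (x + r), P y := by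
  obtain ⟨l, hl, hP⟩ := mem_nhdsGT_iff_exists_Ioo_subset.1 h
  filter_upwards [nhdsWithin_le_nhds (Iio_mem_nhds (show (0 : ℝ) < l - x by
    linarith [mem_Ioi.1 hl]))] with r hr y hy
  exact hP ⟨hy.1, by linarith [hy.2, mem_Iio.1 hr]⟩

lemma setAverage_sub_const {S : Set ℝ} {u : ℝ → ℝ} (hu : IntegrableOn u S)
    (h0 : volume S ≠ 0) (h1 : volume S ≠ ⊤) (z : ℝ) :
    ⨍ y in S, (u y - z) = (⨍ y in S, u y) - z := by
  have h2 : volume.real S ≠ 0 := by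
    rw [measureReal_def]; exact ENNReal.toReal_ne_zero.2 ⟨h0, h1⟩
  rw [setAverage_eq, setAverage_eq, integral_sub hu (integrableOn_const h1), setIntegral_const]
  simp only [smul_eq_mul]
  field_simp

namespace PiecewiseAC

variable {a b : ℝ} {F : Finset ℝ} {D : PiecewiseAC a F} {u : ℝ → ℝ}

lemma integrableOn_left (b : ℝ) (D : PiecewiseAC a F) : IntegrableOn D.left (Ioo a b) := by
  obtain ⟨B, _, hB⟩ := D.exists_bound_left
  exact Measure.integrableOn_of_bounded (M := B) (by simp) D.measurable_left.aestronglyMeasurable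
    (ae_of_all _ hB)

lemma Represents.integrableOn (h : D.Represents b u) : IntegrableOn u (Ioo a b) :=
  (D.integrableOn_left b).congr h.symm

lemma Represents.tendsto_average_sub_left (h : D.Represents b u) {x : ℝ} (hx : x ∈ Ioo a b) :
    Tendsto (fun r : ℝ => ⨍ y in Ioo (x - r) x, u y) (𝓝[>] 0) (𝓝 (D.left x)) := by
  have h1 : Tendsto (fun r : ℝ => ⨍ y in Ioo (x - r) x, (u y - D.left x)) (𝓝[>] 0) (𝓝 0) := by
    refine tendsto_setAverage_zero fun ε hε => ?_
    have h2 := (Metric.tendsto_nhds.1 (D.tendsto_left_nhdsLT x)) ε hε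
    filter_upwards [eventually_Ioo_left_of_eventually h2, eventually_Ioo_subset hx,
      self_mem_nhdsWithin] with r hr hr' hr0
    have hsub : Ioo (x - r) x ⊆ Ioo a b := by
      refine Subset.trans (Ioo_subset_Ioo le_rfl ?_) hr'
      linarith [mem_Ioi.1 hr0]
    filter_upwards [ae_restrict_of_ae_restrict_of_subset hsub h, ae_restrict_mem measurableSet_Ioo]
      with y hy hy'
    rw [hy]
    exact (hr y hy').le
  have h3 := h1.add_const (D.left x)
  rw [zero_add] at h3
  refine h3.congr' ?_
  filter_upwards [eventually_Ioo_subset hx, self_mem_nhdsWithin] with r hr' hr0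
  have hr0 := mem_Ioi.1 hr0
  have hsub : Ioo (x - r) x ⊆ Ioo a b := by
    refine Subset.trans (Ioo_subset_Ioo le_rfl ?_) hr'
    linarith
  rw [setAverage_sub_const (h.integrableOn.mono_set hsub) (by simp [hr0]) (by simp)]
  ring

lemma Represents.tendsto_average_sub_right (h : D.Represents b u) {x : ℝ} (hx : x ∈ Ioo a b) :
    Tendsto (fun r : ℝ => ⨍ y in Ioo x (x + r), u y) (𝓝[>] 0) (𝓝 (D.right x)) := by
  have h1 : Tendsto (fun r : ℝ => ⨍ y in Ioo x (x + r), (u y - D.right x)) (𝓝[>] 0) (𝓝 0) := by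
    refine tendsto_setAverage_zero fun ε hε => ?_
    have h2 := (Metric.tendsto_nhds.1 (D.tendsto_left_nhdsGT x)) ε hε
    filter_upwards [eventually_Ioo_right_of_eventually h2, eventually_Ioo_subset hx,
      self_mem_nhdsWithin] with r hr hr' hr0
    have hsub : Ioo x (x + r) ⊆ Ioo a b := by
      refine Subset.trans (Ioo_subset_Ioo ?_ le_rfl) hr'
      linarith [mem_Ioi.1 hr0]
    filter_upwards [ae_restrict_of_ae_restrict_of_subset hsub h, ae_restrict_mem measurableSet_Ioo]
      with y hy hy'
    rw [hy]
    exact (hr y hy').le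
  have h3 := h1.add_const (D.right x)
  rw [zero_add] at h3
  refine h3.congr' ?_
  filter_upwards [eventually_Ioo_subset hx, self_mem_nhdsWithin] with r hr' hr0
  have hr0 := mem_Ioi.1 hr0
  have hsub : Ioo x (x + r) ⊆ Ioo a b := by
    refine Subset.trans (Ioo_subset_Ioo ?_ le_rfl) hr'
    linarith
  rw [setAverage_sub_const (h.integrableOn.mono_set hsub) (by simp [hr0]) (by simp)]
  ring

lemma Represents.leftTrace_eq (h : D.Represents b u) {x : ℝ} (hx : x ∈ Ioo a b) :
    leftTrace u x = D.left x := (h.tendsto_average_sub_left hx).limUnder_eq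

lemma Represents.rightTrace_eq (h : D.Represents b u) {x : ℝ} (hx : x ∈ Ioo a b) :
    rightTrace u x = D.right x := (h.tendsto_average_sub_right hx).limUnder_eq

lemma Represents.hasApproxLimit (h : D.Represents b u) {x : ℝ} (hx : x ∈ Ioo a b)
    (hj : D.jump x = 0) : HasApproxLimit u x (D.left x) := by
  refine tendsto_setAverage_zero fun ε hε => ?_
  have hl := (Metric.tendsto_nhds.1 (D.tendsto_left_nhdsLT x)) ε hε
  have hr := (Metric.tendsto_nhds.1 (D.tendsto_left_nhdsGT x)) ε hε
  rw [right, hj, add_zero] at hr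
  filter_upwards [eventually_Ioo_left_of_eventually hl, eventually_Ioo_right_of_eventually hr,
    eventually_Ioo_subset hx] with r h1 h2 h3
  filter_upwards [ae_restrict_of_ae_restrict_of_subset h3 h, ae_restrict_mem measurableSet_Ioo]
    with y hy hy'
  rw [hy, abs_abs]
  rcases lt_trichotomy y x with hyx | hyx | hyx
  · exact (h1 y ⟨hy'.1, hyx⟩).le
  · rw [hyx]; simpa using hε.le
  · exact (h2 y ⟨hyx, hy'.2⟩).le

/-- A one-sided interval is half of the symmetric one, so averaging over it costs a factor 2. Thus
an approximate limit is also the limit of both one-sided averages, which rules it out at a jump. -/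
lemma tendsto_average_of_subset {x z : ℝ} (hu : IntegrableOn u (Ioo a b)) (hx : x ∈ Ioo a b)
    (hz : HasApproxLimit u x z) {S : ℝ → Set ℝ}
    (hS : ∀ r > 0, S r ⊆ Ioo (x - r) (x + r)) (hv : ∀ r > 0, volume (S r) = ENNReal.ofReal r) :
    Tendsto (fun r : ℝ => ⨍ y in S r, u y) (𝓝[>] 0) (𝓝 z) := by
  rw [tendsto_iff_norm_sub_tendsto_zero]
  have h2 : Tendsto (fun r : ℝ => 2 * ⨍ y in Ioo (x - r) (x + r), |u y - z|) (𝓝[>] 0) (𝓝 0) := by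
    simpa using hz.const_mul 2
  refine squeeze_zero' (Eventually.of_forall fun _ => norm_nonneg _) ?_ h2
  filter_upwards [eventually_Ioo_subset hx, self_mem_nhdsWithin] with r hr hr0
  have hr0 : 0 < r := mem_Ioi.1 hr0
  have hi := hu.mono_set hr
  have hvr := hv r hr0
  rw [← setAverage_sub_const (hi.mono_set (hS r hr0)) (by simp [hvr, hr0]) (by simp [hvr])]
  have hiz : IntegrableOn (fun y => |u y - z|) (Ioo (x - r) (x + r)) :=
    (hi.sub (integrableOn_const (by simp))).abs
  rw [setAverage_eq, setAverage_eq, smul_eq_mul, smul_eq_mul, norm_mul, measureReal_def, hvr,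
    Real.volume_real_Ioo_of_le (by linarith), ENNReal.toReal_ofReal hr0.le, norm_inv,
    Real.norm_of_nonneg hr0.le]
  have h3 : ‖∫ y in S r, (u y - z)‖ ≤ ∫ y in Ioo (x - r) (x + r), |u y - z| :=
    (norm_integral_le_integral_norm _).trans
      (setIntegral_mono_set hiz (ae_of_all _ fun _ => abs_nonneg _) (hS r hr0).eventuallyLE)
  have h4 : ∀ J : ℝ, 2 * ((x + r - (x - r))⁻¹ * J) = r⁻¹ * J := by
    intro J
    have h5 : x + r - (x - r) = 2 * r := by ring
    rw [h5]; field_simp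
  rw [h4]
  gcongr

lemma Represents.mem_singularSet_iff (h : D.Represents b u) {x : ℝ} (hx : x ∈ Ioo a b) :
    x ∈ singularSet a b u ↔ D.jump x ≠ 0 := by
  constructor
  · rintro ⟨_, h1⟩ h2
    exact h1 ⟨_, h.hasApproxLimit hx h2⟩
  · intro hj
    refine ⟨hx, ?_⟩
    rintro ⟨z, hz⟩
    have hl := tendsto_average_of_subset h.integrableOn hx hz (S := fun r => Ioo (x - r) x)
      (fun r hr => Ioo_subset_Ioo le_rfl (by linarith)) (fun r hr => by simp)
    have hr := tendsto_average_of_subset h.integrableOn hx hz (S := fun r => Ioo x (x + r))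
      (fun r hr => Ioo_subset_Ioo (by linarith) le_rfl) (fun r hr => by simp)
    have h1 := tendsto_nhds_unique hl (h.tendsto_average_sub_left hx)
    have h2 := tendsto_nhds_unique hr (h.tendsto_average_sub_right hx)
    apply hj
    have := h1.symm.trans h2
    rw [right] at this
    linarith

lemma Represents.hasApproxDeriv (h : D.Represents b u) {x c : ℝ} (hx : x ∈ Ioo a b)
    (hd : HasDerivAt D.left c x) : HasApproxDeriv u x c := by
  refine ⟨D.left x, ?_⟩
  rw [Metric.tendsto_nhds]
  intro ε hε
  have h1 := (hasDerivAt_iff_isLittleO.1 hd).def (half_pos hε)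
  obtain ⟨δ, hδ, h1⟩ := Metric.eventually_nhds_iff.1 h1
  filter_upwards [eventually_Ioo_subset hx, self_mem_nhdsWithin,
    nhdsWithin_le_nhds (Iio_mem_nhds hδ)] with r hr hr0 hrδ
  have hr0 : 0 < r := mem_Ioi.1 hr0
  have h2 : abs (⨍ y in Ioo (x - r) (x + r), |u y - D.left x - c * (y - x)|) ≤ ε / 2 * r := by
    refine abs_setAverage_le (by positivity) ?_
    filter_upwards [ae_restrict_of_ae_restrict_of_subset hr h, ae_restrict_mem measurableSet_Ioo]
      with y hy hy'
    have hyx : |y - x| < r := by rw [abs_lt]; constructor <;> linarith [hy'.1, hy'.2]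
    have h3 := h1 (y := y) (by rw [Real.dist_eq]; exact hyx.trans hrδ)
    rw [hy, abs_abs]
    simp only [smul_eq_mul, Real.norm_eq_abs] at h3
    rw [mul_comm c]
    refine h3.trans ?_
    gcongr
  rw [Real.dist_eq, sub_zero, abs_mul, abs_inv, abs_of_pos hr0, inv_mul_lt_iff₀ hr0]
  refine h2.trans_lt ?_
  rw [mul_comm r]
  gcongr
  linarith

end PiecewiseAC

/-- The signed integrals over the right and the left half differ by exactly `q r²`, since `p`
cancels. -/
lemma sq_mul_le_integral_abs_affine {x r p q : ℝ} (hr : 0 < r) :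
    |q| * r ^ 2 ≤ ∫ y in Ioo (x - r) (x + r), |p + q * (y - x)| := by
  have hi : ∀ s t, IntervalIntegrable (fun y => p + q * (y - x)) volume s t := fun s t =>
    (by fun_prop : Continuous fun y => p + q * (y - x)).intervalIntegrable s t
  rw [← integral_Ioc_eq_integral_Ioo, ← intervalIntegral.integral_of_le (by linarith),
    ← intervalIntegral.integral_add_adjacent_intervals (hi (x - r) x).abs (hi x (x + r)).abs]
  have h1 := intervalIntegral.abs_integral_le_integral_abs (μ := volume)
    (f := fun y => p + q * (y - x)) (show x - r ≤ x by linarith)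
  have h2 := intervalIntegral.abs_integral_le_integral_abs (μ := volume)
    (f := fun y => p + q * (y - x)) (show x ≤ x + r by linarith)
  have hprim : ∀ s t, ∫ y in s..t, (p + q * (y - x)) =
      (p * t + q * (t - x) ^ 2 / 2) - (p * s + q * (s - x) ^ 2 / 2) := by
    intro s t
    refine intervalIntegral.integral_eq_sub_of_hasDerivAt
      (f := fun y => p * y + q * (y - x) ^ 2 / 2) (fun y _ => ?_) (hi s t)
    have := (((hasDerivAt_id' y).const_mul p)).fun_add
      (((((hasDerivAt_id' y).sub_const x).fun_pow 2).const_mul q).div_const 2)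
    refine this.congr_deriv ?_
    norm_num; ring
  rw [hprim] at h1 h2
  have h3 : q * r ^ 2 = ((p * (x + r) + q * (x + r - x) ^ 2 / 2) - (p * x + q * (x - x) ^ 2 / 2)) -
      ((p * x + q * (x - x) ^ 2 / 2) - (p * (x - r) + q * (x - r - x) ^ 2 / 2)) := by ring
  have h4 : |q| * r ^ 2 = |q * r ^ 2| := by rw [abs_mul, abs_of_pos (by positivity : 0 < r ^ 2)]
  rw [h4, h3]
  refine (abs_sub _ _).trans ?_
  linarith

/-- The two affine approximations differ by a function of mean absolute value at least `|d - c| r /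
2`, while this mean is `o(r)`. Uniqueness is needed because `approxDeriv` is defined by choice. -/
lemma HasApproxDeriv.unique {a b : ℝ} {u : ℝ → ℝ} (hu : IntegrableOn u (Ioo a b)) {x c d : ℝ}
    (hx : x ∈ Ioo a b) (hc : HasApproxDeriv u x c) (hd : HasApproxDeriv u x d) : c = d := by
  obtain ⟨z, hz⟩ := hc
  obtain ⟨w, hw⟩ := hd
  have h := hz.add hw
  rw [add_zero] at h
  have h0 : |d - c| / 2 ≤ 0 := by
    refine ge_of_tendsto h ?_
    filter_upwards [eventually_Ioo_subset hx, self_mem_nhdsWithin] with r hr hr0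
    have hr0 : 0 < r := mem_Ioi.1 hr0
    have hi := hu.mono_set hr
    have hi' : ∀ z c : ℝ, IntegrableOn (fun y => |u y - z - c * (y - x)|)
        (Ioo (x - r) (x + r)) := by
      intro z c
      refine ((hi.sub (integrableOn_const (by simp))).sub ?_).abs
      exact ((by fun_prop : Continuous fun y => c * (y - x)).integrableOn_Icc).mono_set
        Ioo_subset_Icc_self
    have h1 := sq_mul_le_integral_abs_affine (x := x) (p := w - z) (q := d - c) hr0
    have h2 : ∫ y in Ioo (x - r) (x + r), |(w - z) + (d - c) * (y - x)| ≤
        (∫ y in Ioo (x - r) (x + r), |u y - z - c * (y - x)|) +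
        ∫ y in Ioo (x - r) (x + r), |u y - w - d * (y - x)| := by
      rw [← integral_add (hi' z c) (hi' w d)]
      refine integral_mono_of_nonneg (ae_of_all _ fun _ => abs_nonneg _)
        ((hi' z c).add (hi' w d)) (ae_of_all _ fun y => ?_)
      have h3 : (w - z) + (d - c) * (y - x) =
        (u y - z - c * (y - x)) - (u y - w - d * (y - x)) := by ring
      simp only [h3]
      exact abs_sub _ _
    rw [setAverage_eq, setAverage_eq, smul_eq_mul, smul_eq_mul,
      Real.volume_real_Ioo_of_le (by linarith), ← mul_add, ← mul_add]
    have h4 := h1.trans h2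
    have h5 : x + r - (x - r) = 2 * r := by ring
    rw [h5, inv_mul_eq_div, inv_mul_eq_div, div_div, le_div_iff₀ (by positivity)]
    linarith
  have h6 := abs_nonneg (d - c)
  have h7 : |d - c| = 0 := by linarith
  linarith [abs_eq_zero.1 h7]

namespace PiecewiseAC

variable {a b : ℝ} {F : Finset ℝ} {D : PiecewiseAC a F} {u : ℝ → ℝ}

lemma Represents.ae_approxDeriv_eq (h : D.Represents b u) :
    ∀ᵐ x, x ∈ Ioo a b → approxDeriv u x = D.dens x := by
  filter_upwards [D.ae_hasDerivAt_left] with x hd hx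
  have h1 : ∃ c, HasApproxDeriv u x c := ⟨_, h.hasApproxDeriv hx hd⟩
  rw [approxDeriv, dif_pos h1]
  exact h1.choose_spec.unique h.integrableOn hx (h.hasApproxDeriv hx hd)

end PiecewiseAC

/-! ### Functions in `SBV` with finite singular set -/

lemma setIntegral_mul_eq_integral_of_tsupport_subset {S : Set ℝ} {v η : ℝ → ℝ}
    (h : tsupport η ⊆ S) : ∫ x in S, v x * η x = ∫ x, v x * η x :=
  setIntegral_eq_integral_of_forall_compl_eq_zero fun x hx => by
    rw [image_eq_zero_of_notMem_tsupport fun h' => hx (h h'), mul_zero]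

/-- A smooth function with compact support and zero integral is the derivative of a smooth function
with compact support. -/
lemma exists_primitive_hasCompactSupport {a b : ℝ} (hab : a < b) {ζ : ℝ → ℝ}
    (hζ : ContDiff ℝ ∞ ζ) (hc : HasCompactSupport ζ) (hs : tsupport ζ ⊆ Ioo a b)
    (h0 : ∫ x, ζ x = 0) :
    ∃ η : ℝ → ℝ, ContDiff ℝ ∞ η ∧ HasCompactSupport η ∧ tsupport η ⊆ Ioo a b ∧ deriv η = ζ := by
  -- The primitive based at `a` vanishes before `m`, and after `M` it equals the total integral,
  -- which is zero.
  obtain ⟨m, M, hm, hM, hmM⟩ : ∃ m M, a < m ∧ M < b ∧ tsupport ζ ⊆ Icc m M := by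
    rcases (tsupport ζ).eq_empty_or_nonempty with he | hne
    · exact ⟨(a + b) / 2, (a + b) / 2, by linarith, by linarith, by simp [he]⟩
    · have hcs : IsCompact (tsupport ζ) := hc
      obtain ⟨m, hm, hm'⟩ := hcs.exists_isLeast hne
      obtain ⟨M, hM, hM'⟩ := hcs.exists_isGreatest hne
      exact ⟨m, M, (hs hm).1, (hs hM).2, fun x hx => ⟨hm' hx, hM' hx⟩⟩
  have hcont : Continuous ζ := hζ.continuous
  have hii : ∀ x y, IntervalIntegrable ζ volume x y := fun x y => hcont.intervalIntegrable x y
  set η : ℝ → ℝ := fun x => ∫ t in a..x, ζ t with hη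
  have hd : ∀ x, HasDerivAt η (ζ x) x := fun x =>
    intervalIntegral.integral_hasDerivAt_right (hii a x)
      hcont.stronglyMeasurable.stronglyMeasurableAtFilter hcont.continuousAt
  have hderiv : deriv η = ζ := funext fun x => (hd x).deriv
  have hsupp : tsupport η ⊆ Icc m M := by
    refine closure_minimal (fun x hx => ?_) isClosed_Icc
    by_contra hxn
    apply hx
    have hz : ∀ y, y ∉ Icc m M → ζ y = 0 := fun y hy =>
      image_eq_zero_of_notMem_tsupport fun h' => hy (hmM h')
    rcases lt_or_ge x m with hxm | hxm
    · refine intervalIntegral.integral_zero_ae (ae_of_all _ fun y hy => hz y fun hy' => ?_)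
      have h2 : y ≤ max a x := hy.2
      have h3 : max a x < m := max_lt hm hxm
      linarith [hy'.1]
    · have hxM : M < x := by
        by_contra hcon
        exact hxn ⟨hxm, not_lt.1 hcon⟩
      rw [hη]
      simp only
      rw [intervalIntegral.integral_eq_integral_of_support_subset, h0]
      intro y hy
      have hy' := hmM (subset_tsupport _ hy)
      exact ⟨by linarith [hy'.1], by linarith [hy'.2]⟩
  have hsub : Icc m M ⊆ Ioo a b := fun x hx => ⟨hm.trans_le hx.1, hx.2.trans_lt hM⟩
  refine ⟨η, ?_, isCompact_Icc.of_isClosed_subset (isClosed_tsupport _) hsupp, hsupp.trans hsub,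
    hderiv⟩
  rw [contDiff_infty_iff_deriv]
  exact ⟨fun x => (hd x).differentiableAt, hderiv ▸ hζ⟩

/-- An integrable function whose distributional derivative vanishes is constant. -/
lemma ae_eq_const_of_integral_mul_deriv_eq_zero {a b : ℝ} (hab : a < b) {v : ℝ → ℝ}
    (hv : IntegrableOn v (Ioo a b))
    (H : ∀ η : ℝ → ℝ, ContDiff ℝ ∞ η → HasCompactSupport η → tsupport η ⊆ Ioo a b →
      ∫ x in Ioo a b, v x * deriv η x = 0) :
    ∃ C : ℝ, ∀ᵐ x, x ∈ Ioo a b → v x = C := by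
  -- A fixed bump `ρ` determines the constant as a weighted mean of `v`. Any test function minus the
  -- right multiple of `ρ` has zero integral, hence is the derivative of a test function.
  obtain ⟨ρ, hρs, hρc, hρ, hρr, hρ1⟩ := exists_contDiff_tsupport_subset (n := ⊤)
    (Ioo_mem_nhds (show a < (a + b) / 2 by linarith) (show (a + b) / 2 < b by linarith))
  have hρint : 0 < ∫ x, ρ x := by
    refine hρ.continuous.integral_pos_of_hasCompactSupport_nonneg_nonzero hρc
      (fun x => (hρr ⟨x, rfl⟩).1) (x := (a + b) / 2) (by rw [hρ1]; norm_num)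
  set C := (∫ x in Ioo a b, v x * ρ x) / ∫ x, ρ x with hC
  refine ⟨C, ?_⟩
  have hvC : IntegrableOn (fun x => v x - C) (Ioo a b) := hv.sub (integrableOn_const (by simp))
  have key := isOpen_Ioo.ae_eq_zero_of_integral_contDiff_smul_eq_zero (U := Ioo a b)
    (f := fun x => v x - C) (μ := volume) hvC.locallyIntegrableOn ?_
  · filter_upwards [key] with x hx hxI
    linarith [hx hxI]
  intro ψ hψ hψc hψs
  set k := (∫ x, ψ x) / ∫ x, ρ x with hk
  have hψi : Integrable ψ := hψ.continuous.integrable_of_hasCompactSupport hψc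
  have hρi : Integrable ρ := hρ.continuous.integrable_of_hasCompactSupport hρc
  have hbd : ∀ {χ : ℝ → ℝ}, Continuous χ → HasCompactSupport χ →
      IntegrableOn (fun x => v x * χ x) (Ioo a b) := by
    intro χ hχ hχc
    obtain ⟨B, hB⟩ := hχc.exists_bound_of_continuous hχ
    exact hv.mul_bdd hχ.aestronglyMeasurable (ae_of_all _ hB)
  have hsub : tsupport (fun x => ψ x - k * ρ x) ⊆ tsupport ψ ∪ tsupport ρ := by
    refine closure_minimal (fun x hx => ?_)
      ((isClosed_tsupport ψ).union (isClosed_tsupport ρ))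
    by_contra hcon
    rw [mem_union, not_or] at hcon
    apply hx
    simp [image_eq_zero_of_notMem_tsupport hcon.1, image_eq_zero_of_notMem_tsupport hcon.2]
  obtain ⟨η, hη, hηc, hηs, hηd⟩ := exists_primitive_hasCompactSupport hab
    (ζ := fun x => ψ x - k * ρ x) (hψ.sub (contDiff_const.mul hρ))
    ((hψc.isCompact.union hρc.isCompact).of_isClosed_subset (isClosed_tsupport _) hsub)
    (hsub.trans (union_subset hψs hρs))
    (by rw [integral_sub hψi (hρi.const_mul k), integral_const_mul, hk]; field_simp; ring)
  have h1 := H η hη hηc hηs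
  rw [hηd] at h1
  have h2 : ∫ x in Ioo a b, v x * (ψ x - k * ρ x) =
      (∫ x in Ioo a b, v x * ψ x) - k * ∫ x in Ioo a b, v x * ρ x := by
    rw [← integral_const_mul, ← integral_sub (hbd hψ.continuous hψc)
      ((hbd hρ.continuous hρc).const_mul k)]
    refine integral_congr_ae (ae_of_all _ fun x => ?_)
    simp only; ring
  rw [h2] at h1
  have h3 : ∫ x, ψ x • (v x - C) = ∫ x in Ioo a b, (v x - C) * ψ x := by
    rw [setIntegral_mul_eq_integral_of_tsupport_subset hψs]
    exact integral_congr_ae (ae_of_all _ fun x => by simp only [smul_eq_mul]; ring)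
  have h4 : ∫ x in Ioo a b, (v x - C) * ψ x = (∫ x in Ioo a b, v x * ψ x) - C * ∫ x, ψ x := by
    rw [← integral_const_mul, ← setIntegral_mul_eq_integral_of_tsupport_subset
      (v := fun _ => C) hψs, ← integral_sub (hbd hψ.continuous hψc) (hψi.const_mul C).integrableOn]
    refine integral_congr_ae (ae_of_all _ fun x => ?_)
    simp only; ring
  rw [h3, h4]
  have h5 : C * ∫ x, ψ x = k * ∫ x in Ioo a b, v x * ρ x := by
    rw [hC, hk]; field_simp
  linarith

namespace PiecewiseAC

variable {a b : ℝ} {F : Finset ℝ}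

/-- Integration by parts against a test function. -/
lemma integral_left_mul_deriv (D : PiecewiseAC a F) (hab : a < b) (hF : ↑F ⊆ Ioo a b) {η : ℝ → ℝ}
    (hη : ContDiff ℝ ∞ η) (hs : tsupport η ⊆ Ioo a b) :
    ∫ x in Ioo a b, D.left x * deriv η x =
      -((∫ x, D.dens x * η x) + ∑ s ∈ F, D.jump s * η s) := by
  have hz : ∀ x, x ∉ Ioo a b → η x = 0 := fun x hx =>
    image_eq_zero_of_notMem_tsupport fun h' => hx (hs h')
  have hηa : η a = 0 := hz a (by simp)
  have hηb : η b = 0 := hz b (by simp)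
  have hη1 : ContDiff ℝ 1 η := hη.of_le (by exact_mod_cast le_top)
  have hdc : Continuous (deriv η) := hη1.continuous_deriv le_rfl
  rw [← integral_Ioc_eq_integral_Ioo, ← intervalIntegral.integral_of_le hab.le]
  have hac : AbsolutelyContinuousOnInterval D.ac a b := by
    have h1 := (D.intervalIntegrable_dens a b).absolutelyContinuousOnInterval_intervalIntegral
      (c := a) (by simp)
    have h2 : AbsolutelyContinuousOnInterval (fun _ : ℝ => D.const) a b :=
      (contDiff_const (n := 1)).contDiffOn.absolutelyContinuousOnInterval
    exact h2.add h1
  have hparts := hac.integral_mul_deriv_eq_deriv_mul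
    (hη1.contDiffOn.absolutelyContinuousOnInterval (a := a) (b := b))
  have hdens : ∫ x in a..b, deriv D.ac x * η x = ∫ x, D.dens x * η x := by
    rw [← setIntegral_mul_eq_integral_of_tsupport_subset hs, ← integral_Ioc_eq_integral_Ioo,
      ← intervalIntegral.integral_of_le hab.le]
    refine intervalIntegral.integral_congr_ae ?_
    filter_upwards [D.ae_hasDerivAt_ac] with x hx _
    rw [hx.deriv]
  rw [hdens, hηa, hηb] at hparts
  have hjump : ∀ s ∈ F, ∫ x in a..b, (if s < x then D.jump s else 0) * deriv η x =
      - (D.jump s * η s) := by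
    intro s hsF
    have hsI := hF hsF
    have h1 : ∫ x in a..b, (if s < x then D.jump s else 0) * deriv η x =
        ∫ x in s..b, D.jump s * deriv η x := by
      rw [intervalIntegral.integral_of_le hab.le, intervalIntegral.integral_of_le hsI.2.le]
      have h2 : Ioc s b = Ioc a b ∩ Ioi s := by
        ext x; simp only [mem_Ioc, mem_inter_iff, mem_Ioi]
        constructor
        · rintro ⟨h1, h2⟩; exact ⟨⟨hsI.1.trans h1, h2⟩, h1⟩
        · rintro ⟨⟨_, h2⟩, h3⟩; exact ⟨h3, h2⟩
      rw [h2, ← setIntegral_indicator measurableSet_Ioi]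
      refine integral_congr_ae (ae_of_all _ fun x => ?_)
      by_cases hx : s < x <;> simp [hx]
    rw [h1, intervalIntegral.integral_const_mul, intervalIntegral.integral_deriv_eq_sub
      (fun x _ => hη1.differentiable one_ne_zero x) (hdc.intervalIntegrable _ _), hηb]
    ring
  have hi1 : IntervalIntegrable (fun x => D.ac x * deriv η x) volume a b :=
    (D.continuous_ac.mul hdc).intervalIntegrable _ _
  have hi2 : ∀ s ∈ F, IntervalIntegrable (fun x => (if s < x then D.jump s else 0) * deriv η x)
      volume a b := by
    intro s _
    refine IntervalIntegrable.mul_continuousOn ?_ hdc.continuousOn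
    rw [intervalIntegrable_iff]
    refine Measure.integrableOn_of_bounded (M := |D.jump s|) (by simp) ?_ (ae_of_all _ fun x => ?_)
    · exact (Measurable.ite measurableSet_Ioi measurable_const
        measurable_const).aestronglyMeasurable
    · split_ifs <;> simp
  simp_rw [left, add_mul, Finset.sum_mul]
  have hi3 : IntervalIntegrable (fun x => ∑ s ∈ F, (if s < x then D.jump s else 0) * deriv η x)
      volume a b := by
    refine IntervalIntegrable.congr (fun x _ => ?_) (IntervalIntegrable.sum F hi2)
    simp
  rw [intervalIntegral.integral_add hi1 hi3,
    intervalIntegral.integral_finsetSum hi2, Finset.sum_congr rfl hjump,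
    hparts, Finset.sum_neg_distrib]
  ring

end PiecewiseAC

/-- Without a Cantor part, the singular part seen by `η` consists of atoms in `F`. It is applied to
the positive and the negative part of the derivative separately. -/
lemma integral_eq_sum_singularPart_add {a b : ℝ} {F : Finset ℝ}
    (P : Measure ℝ) [IsFiniteMeasure P] (hP : P.singularPart volume (Ioo a b \ F) = 0)
    {η : ℝ → ℝ} (hη : Continuous η) (hc : HasCompactSupport η) (hs : tsupport η ⊆ Ioo a b) :
    ∫ x, η x ∂P = (∑ s ∈ F, (P.singularPart volume).real {s} * η s) +
      ∫ x, (P.rnDeriv volume x).toReal * η x := by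
  obtain ⟨B, hB⟩ := hc.exists_bound_of_continuous hη
  have hdec := P.haveLebesgueDecomposition_add volume
  have hi : ∀ Q : Measure ℝ, IsFiniteMeasure Q → Integrable η Q := fun Q _ =>
    Integrable.of_bound hη.aestronglyMeasurable B (ae_of_all _ hB)
  have hfin : IsFiniteMeasure (volume.withDensity (P.rnDeriv volume)) :=
    isFiniteMeasure_of_le P (Measure.withDensity_rnDeriv_le P volume)
  conv_lhs => rw [hdec]
  rw [integral_add_measure (hi _ inferInstance) (hi _ hfin)]
  congr 1
  · have h1 : ∫ x, η x ∂P.singularPart volume = ∫ x in (F : Set ℝ), η x ∂P.singularPart volume := by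
      symm
      refine setIntegral_eq_integral_of_ae_compl_eq_zero ?_
      have h2 : ∀ᵐ x ∂P.singularPart volume, x ∉ Ioo a b \ ↑F := by
        rw [ae_iff]; simp only [not_not]; exact hP
      filter_upwards [h2] with x hx hxF
      refine image_eq_zero_of_notMem_tsupport fun h' => hx ⟨hs h', hxF⟩
    rw [h1, setIntegral_finset _ (hi _ inferInstance).integrableOn]
    rfl
  · rw [integral_withDensity_eq_integral_toReal_smul (Measure.measurable_rnDeriv _ _)
      (Measure.rnDeriv_lt_top _ _)]
    rfl

/-- A function in `SBV` with finite singular set is piecewise absolutely continuous. -/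
theorem SBV.exists_represents {a b : ℝ} (hab : a < b) {u : ℝ → ℝ} (hu : SBV a b u) {F : Finset ℝ}
    (hF : ↑F ⊆ Ioo a b) (hS : singularSet a b u ⊆ F) :
    ∃ D : PiecewiseAC a F, D.Represents b u := by
  obtain ⟨hint, μ, hμ, hsing⟩ := hu
  set P := μ.toJordanDecomposition.posPart with hPdef
  set N := μ.toJordanDecomposition.negPart with hNdef
  rw [SignedMeasure.singularPart_totalVariation, Measure.add_apply, add_eq_zero] at hsing
  have hP : P.singularPart volume (Ioo a b \ F) = 0 :=
    measure_mono_null (sdiff_subset_sdiff_right hS) hsing.1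
  have hN : N.singularPart volume (Ioo a b \ F) = 0 :=
    measure_mono_null (sdiff_subset_sdiff_right hS) hsing.2
  set f : ℝ → ℝ := fun x => (P.rnDeriv volume x).toReal - (N.rnDeriv volume x).toReal with hf
  set c : ℝ → ℝ := fun s => if s ∈ F then
    (P.singularPart volume).real {s} - (N.singularPart volume).real {s} else 0 with hc
  have hPi : Integrable (fun x => (P.rnDeriv volume x).toReal) := Measure.integrable_toReal_rnDeriv
  have hNi : Integrable (fun x => (N.rnDeriv volume x).toReal) := Measure.integrable_toReal_rnDeriv
  have hfm : Measurable f := (Measure.measurable_rnDeriv _ _).ennreal_toReal.sub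
    (Measure.measurable_rnDeriv _ _).ennreal_toReal
  -- `D₀` is built to have the same distributional derivative as `u`; the difference is then a
  -- constant, which becomes the initial value.
  set D₀ : PiecewiseAC a F := ⟨0, f, c, hfm, hPi.sub hNi, fun s hs => by simp [hc, hs]⟩ with hD₀
  have hv : IntegrableOn (fun x => u x - D₀.left x) (Ioo a b) := hint.sub (D₀.integrableOn_left b)
  obtain ⟨C, hC⟩ := ae_eq_const_of_integral_mul_deriv_eq_zero hab hv fun η hη hηc hηs => by
    have hη1 : ContDiff ℝ 1 η := hη.of_le (by exact_mod_cast le_top)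
    have hdc : Continuous (deriv η) := hη1.continuous_deriv le_rfl
    obtain ⟨B, hB⟩ := hηc.deriv.exists_bound_of_continuous hdc
    obtain ⟨B', hB'⟩ := hηc.exists_bound_of_continuous hη.continuous
    have hbd : ∀ {w : ℝ → ℝ}, IntegrableOn w (Ioo a b) →
        IntegrableOn (fun x => w x * deriv η x) (Ioo a b) := fun hw =>
      hw.mul_bdd hdc.aestronglyMeasurable (ae_of_all _ hB)
    have hbd' : ∀ {w : ℝ → ℝ}, Integrable w → Integrable (fun x => w x * η x) := fun hw =>
      hw.mul_bdd hη.continuous.aestronglyMeasurable (ae_of_all _ hB')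
    simp_rw [sub_mul]
    rw [integral_sub (hbd hint) (hbd (D₀.integrableOn_left b)), hμ η hη hηc hηs,
      D₀.integral_left_mul_deriv hab hF hη hηs,
      integral_eq_sum_singularPart_add P hP hη.continuous hηc hηs,
      integral_eq_sum_singularPart_add N hN hη.continuous hηc hηs]
    have h1 : ∫ x, D₀.dens x * η x = (∫ x, (P.rnDeriv volume x).toReal * η x) -
        ∫ x, (N.rnDeriv volume x).toReal * η x := by
      rw [← integral_sub (hbd' hPi) (hbd' hNi)]
      exact integral_congr_ae (ae_of_all _ fun x => by simp only [hD₀, hf]; ring)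
    have h2 : ∑ s ∈ F, D₀.jump s * η s = (∑ s ∈ F, (P.singularPart volume).real {s} * η s) -
        ∑ s ∈ F, (N.singularPart volume).real {s} * η s := by
      rw [← Finset.sum_sub_distrib]
      exact Finset.sum_congr rfl fun s hs => by simp only [hD₀, hc, hs, if_true]; ring
    rw [h1, h2]; ring
  refine ⟨⟨C, f, c, hfm, hPi.sub hNi, fun s hs => by simp [hc, hs]⟩, ?_⟩
  rw [PiecewiseAC.Represents, EventuallyEq, ae_restrict_iff' measurableSet_Ioo]
  filter_upwards [hC] with x hx hxI
  have := hx hxI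
  simp only [PiecewiseAC.left, PiecewiseAC.ac, hD₀] at this ⊢
  linarith

/-- A piecewise absolutely continuous function is in `SBV`. -/
theorem PiecewiseAC.Represents.sbv {a b : ℝ} (hab : a < b) {F : Finset ℝ} (hF : ↑F ⊆ Ioo a b)
    {D : PiecewiseAC a F} {u : ℝ → ℝ} (h : D.Represents b u) : SBV a b u := by
  refine ⟨h.integrableOn, ?_⟩
  -- The derivative is assembled directly as a Jordan decomposition: positive and negative atoms,
  -- positive and negative densities. Their mutual singularity makes the variation and the singular
  -- part readable from the data.
  set P : Measure ℝ := ∑ s ∈ F, ENNReal.ofReal (D.jump s) • Measure.dirac s with hP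
  set N : Measure ℝ := ∑ s ∈ F, ENNReal.ofReal (-D.jump s) • Measure.dirac s with hN
  set p : Measure ℝ := volume.withDensity fun x => ENNReal.ofReal (D.dens x) with hp
  set n : Measure ℝ := volume.withDensity fun x => ENNReal.ofReal (-D.dens x) with hn
  have hpf : IsFiniteMeasure p := isFiniteMeasure_withDensity_ofReal D.integrable_dens.2
  have hnf : IsFiniteMeasure n := isFiniteMeasure_withDensity_ofReal D.integrable_dens.neg.2
  have hdirac : ∀ (c : ℝ → ℝ) (E : Set ℝ), (∀ s ∈ F, s ∈ E → c s ≤ 0) → MeasurableSet E →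
      (∑ s ∈ F, ENNReal.ofReal (c s) • Measure.dirac s : Measure ℝ) E = 0 := by
    intro c E hE hEm
    rw [Measure.finsetSum_apply]
    refine Finset.sum_eq_zero fun s hs => ?_
    rw [Measure.smul_apply, smul_eq_mul, Measure.dirac_apply' _ hEm]
    by_cases hsE : s ∈ E
    · rw [ENNReal.ofReal_of_nonpos (hE s hs hsE), zero_mul]
    · simp [hsE]
  have hfinite : ∀ c : ℝ → ℝ, IsFiniteMeasure
      (∑ s ∈ F, ENNReal.ofReal (c s) • Measure.dirac s : Measure ℝ) := by
    intro c
    refine ⟨?_⟩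
    rw [Measure.finsetSum_apply, ENNReal.sum_lt_top]
    intro s _
    simp
  have hPf : IsFiniteMeasure P := hfinite _
  have hNf : IsFiniteMeasure N := hfinite _
  have hFm : MeasurableSet (F : Set ℝ) := F.measurableSet
  have hsing : ∀ c : ℝ → ℝ,
      (∑ s ∈ F, ENNReal.ofReal (c s) • Measure.dirac s : Measure ℝ) ⟂ₘ volume := by
    intro c
    refine ⟨(F : Set ℝ)ᶜ, hFm.compl, hdirac c _ (fun s hs hs' => absurd hs hs') hFm.compl, ?_⟩
    rw [compl_compl]
    exact F.finite_toSet.measure_zero _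
  have hPN : P ⟂ₘ N := by
    refine ⟨{x | D.jump x ≤ 0}, measurableSet_le D.measurable_jump measurable_const,
      hdirac _ _ (fun s _ hs => hs) (measurableSet_le D.measurable_jump measurable_const),
      hdirac _ _ (fun s _ hs => ?_)
        (measurableSet_le D.measurable_jump measurable_const).compl⟩
    simp only [mem_compl_iff, mem_ofPred_eq, not_le] at hs
    linarith
  have hpv : p ≪ volume := withDensity_absolutelyContinuous _ _
  have hnv : n ≪ volume := withDensity_absolutelyContinuous _ _
  have hms : P + p ⟂ₘ N + n := by
    refine Measure.MutuallySingular.add_left (Measure.MutuallySingular.add_right hPN ?_)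
      (Measure.MutuallySingular.add_right ?_
        (withDensity_ofReal_mutuallySingular D.measurable_dens))
    · exact (hsing _).mono_ac Measure.AbsolutelyContinuous.rfl hnv
    · exact ((hsing _).mono_ac Measure.AbsolutelyContinuous.rfl hpv).symm
  set j : JordanDecomposition ℝ := ⟨P + p, N + n, hms⟩ with hj
  have hjd : j.toSignedMeasure.toJordanDecomposition = j :=
    JordanDecomposition.toJordanDecomposition_toSignedMeasure j
  refine ⟨j.toSignedMeasure, ?_, ?_⟩
  · intro η hη hηc hηs
    obtain ⟨B, hB⟩ := hηc.exists_bound_of_continuous hη.continuous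
    have hi : ∀ Q : Measure ℝ, IsFiniteMeasure Q → Integrable η Q := fun Q _ =>
      Integrable.of_bound hη.continuous.aestronglyMeasurable B (ae_of_all _ hB)
    have h1 : ∫ x in Ioo a b, u x * deriv η x = ∫ x in Ioo a b, D.left x * deriv η x :=
      integral_congr_ae (h.mono fun x hx => by simp only [hx])
    have hdens : ∀ f : ℝ → ℝ, Measurable f →
        ∫ x, η x ∂(volume.withDensity fun x => ENNReal.ofReal (f x)) =
          ∫ x, (max (f x) 0) * η x := by
      intro f hf
      rw [integral_withDensity_eq_integral_toReal_smul hf.ennreal_ofReal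
        (ae_of_all _ fun _ => ENNReal.ofReal_lt_top)]
      rfl
    have hsum : ∀ c : ℝ → ℝ,
        ∫ x, η x ∂(∑ s ∈ F, ENNReal.ofReal (c s) • Measure.dirac s : Measure ℝ) =
          ∑ s ∈ F, (max (c s) 0) * η s := by
      intro c
      rw [integral_finsetSum_measure fun s _ => hi _ (Measure.smul_finite _ (by simp))]
      refine Finset.sum_congr rfl fun s _ => ?_
      rw [integral_smul_measure, integral_dirac]
      rfl
    rw [h1, D.integral_left_mul_deriv hab hF hη hηs, hjd]
    simp only [hj]
    rw [integral_add_measure (hi _ hPf) (hi _ hpf), integral_add_measure (hi _ hNf) (hi _ hnf),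
      hdens _ D.measurable_dens, hdens _ D.measurable_dens.fun_neg, hsum, hsum]
    have hmax : ∀ y : ℝ, max y 0 - max (-y) 0 = y := max_zero_sub_max_neg_zero_eq_self
    have hbd : ∀ {w : ℝ → ℝ}, Integrable w → Integrable (fun x => w x * η x) := fun hw =>
      hw.mul_bdd hη.continuous.aestronglyMeasurable (ae_of_all _ hB)
    have h2 : ∫ x, D.dens x * η x =
        (∫ x, max (D.dens x) 0 * η x) - ∫ x, max (-D.dens x) 0 * η x := by
      rw [← integral_sub (hbd D.integrable_dens.pos_part) (hbd D.integrable_dens.neg_part)]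
      exact integral_congr_ae (ae_of_all _ fun x => by simp only [← sub_mul, hmax])
    have h3 : ∑ s ∈ F, D.jump s * η s =
        (∑ s ∈ F, max (D.jump s) 0 * η s) - ∑ s ∈ F, max (-D.jump s) 0 * η s := by
      rw [← Finset.sum_sub_distrib]
      exact Finset.sum_congr rfl fun s _ => by rw [← sub_mul, hmax]
    rw [h2, h3]
    ring
  · rw [SignedMeasure.singularPart_totalVariation, hjd]
    simp only [hj]
    rw [← Measure.eq_singularPart D.measurable_dens.ennreal_ofReal (hsing D.jump) rfl,
      ← Measure.eq_singularPart D.measurable_dens.fun_neg.ennreal_ofReal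
        (hsing fun s => -D.jump s) rfl]
    have hset : Ioo a b \ singularSet a b u = Ioo a b ∩ {x | D.jump x = 0} := by
      ext x
      simp only [Set.mem_sdiff, mem_inter_iff, mem_ofPred_eq]
      refine and_congr_right fun hx => ?_
      rw [h.mem_singularSet_iff hx, not_not]
    have hmeas : MeasurableSet (Ioo a b ∩ {x | D.jump x = 0}) :=
      measurableSet_Ioo.inter (D.measurable_jump (measurableSet_singleton 0))
    rw [hset, Measure.add_apply, hdirac _ _ (fun s _ hs => le_of_eq hs.2) hmeas,
      hdirac _ _ (fun s _ hs => by simp only [show D.jump s = 0 from hs.2, neg_zero, le_refl]) hmeas,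
      add_zero]

/-! ### The length measure of an extended graph -/

lemma norm_plane_le (p : Plane) : ‖p‖ ≤ |p 0| + |p 1| := by
  rw [EuclideanSpace.norm_eq, Fin.sum_univ_two, Real.sqrt_le_left (by positivity)]
  simp only [Real.norm_eq_abs]
  nlinarith [abs_nonneg (p 0), abs_nonneg (p 1)]

lemma plane_eta (p : Plane) : (!₂[p 0, p 1] : Plane) = p := by
  ext i; fin_cases i <;> rfl

lemma isometry_vertical (s : ℝ) : Isometry fun t : ℝ => (!₂[s, t] : Plane) := by
  refine Isometry.of_dist_eq fun x y => ?_
  rw [EuclideanSpace.dist_eq, Fin.sum_univ_two]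
  simp [Real.sqrt_sq_eq_abs, Real.dist_eq]

lemma measurable_plane_mk {X : Type*} [MeasurableSpace X] {f g : X → ℝ} (hf : Measurable f)
    (hg : Measurable g) :
    Measurable fun x => (!₂[f x, g x] : Plane) := by
  refine (WithLp.measurable_toLp 2 (Fin 2 → ℝ)).comp (measurable_pi_lambda _ fun i => ?_)
  fin_cases i
  · exact hf
  · exact hg

lemma measurable_plane_apply (i : Fin 2) : Measurable fun p : Plane => p i :=
  (by fun_prop : Continuous fun p : Plane => p i).measurable

lemma hasDerivAt_plane_mk {f g : ℝ → ℝ} {f' g' x : ℝ} (hf : HasDerivAt f f' x)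
    (hg : HasDerivAt g g' x) :
    HasDerivAt (fun x => (!₂[f x, g x] : Plane)) !₂[f', g'] x := by
  have h : HasDerivAt (fun x => ![f x, g x]) ![f', g'] x := by
    rw [hasDerivAt_pi]
    intro i
    fin_cases i
    · exact hf
    · exact hg
  exact ((PiLp.hasFDerivAt_toLp (𝕜 := ℝ) 2 (![f x, g x])).comp_hasDerivAt x h :)

lemma measurable_vertical (s : ℝ) : Measurable fun t : ℝ => (!₂[s, t] : Plane) :=
  measurable_plane_mk measurable_const measurable_id

namespace PiecewiseAC

variable {a b : ℝ} {F : Finset ℝ}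

/-- The translate of the graph of the continuous part that has made the jumps in `A`. -/
def branch (D : PiecewiseAC a F) (A : Finset ℝ) (x : ℝ) : Plane :=
  !₂[x, D.ac x + ∑ s ∈ A, D.jump s]

/-- The graph of the left continuous representative. -/
def point (D : PiecewiseAC a F) (x : ℝ) : Plane := !₂[x, D.left x]

/-- The extended graph. -/
def graph (b : ℝ) (D : PiecewiseAC a F) : Set Plane :=
  {p | p 0 ∈ Ioo a b ∧ min (D.left (p 0)) (D.right (p 0)) ≤ p 1 ∧
    p 1 ≤ max (D.left (p 0)) (D.right (p 0))}

variable (D : PiecewiseAC a F)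

lemma point_eq_branch (x : ℝ) : D.point x = D.branch (F.filter (· < x)) x := by
  rw [point, branch, left, Finset.sum_filter]

lemma measurable_point : Measurable D.point := measurable_plane_mk measurable_id D.measurable_left

/-- A Lipschitz parametrization of a branch. -/
lemma exists_lipschitz_branch_param (A : Finset ℝ) :
    ∃ X : ℝ → ℝ, Function.Surjective X ∧ LipschitzWith 1 X ∧
      (∃ K, LipschitzWith K fun σ => D.branch A (X σ)) ∧
      ∀ N : Set ℝ, volume N = 0 → volume (X ⁻¹' N) = 0 := by
  obtain ⟨X, h1, h2, h3, h4⟩ := exists_lipschitz_graph_param D.integrable_dens a D.const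
  refine ⟨X, h1, h2, ⟨2, LipschitzWith.of_dist_le_mul fun σ τ => ?_⟩, h4⟩
  have h5 := h2.dist_le_mul σ τ
  have h6 := h3.dist_le_mul σ τ
  rw [dist_eq_norm]
  refine (norm_plane_le _).trans ?_
  simp only [Real.dist_eq, NNReal.coe_one, one_mul] at h5 h6
  have h7 : |(D.branch A (X σ) - D.branch A (X τ)) 0| = |X σ - X τ| := by simp [branch]
  have h8 : |(D.branch A (X σ) - D.branch A (X τ)) 1| = |D.ac (X σ) - D.ac (X τ)| := by
    simp [branch]
  rw [h7, h8, Real.dist_eq]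
  simp only [ac]
  push_cast
  linarith

/-- Absolute continuity enters here: `N` pulls back to a null set of parameters, and a Lipschitz
curve sends it to a set of zero length. The length formula covers only points of differentiability,
so the rest must be discarded this way. -/
lemma hausdorffMeasure_branch_image_eq_zero (A : Finset ℝ) {N : Set ℝ} (hN : volume N = 0) :
    Measure.hausdorffMeasure 1 (D.branch A '' N) = 0 := by
  obtain ⟨X, h1, _, ⟨K, h3⟩, h4⟩ := D.exists_lipschitz_branch_param A
  have h5 : D.branch A '' N = (fun σ => D.branch A (X σ)) '' (X ⁻¹' N) := by
    rw [← Function.comp_def, image_comp, image_preimage_eq _ h1]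
  rw [h5]
  have h6 := h3.hausdorffMeasure_image_le (d := 1) zero_le_one (X ⁻¹' N)
  rw [hausdorffMeasure_real, h4 N hN, mul_zero] at h6
  exact le_antisymm h6 zero_le

/-- The graph of `left` lies in the finite union of the branches, one for each set of jumps already
made. -/
lemma hausdorffMeasure_point_image_eq_zero {N : Set ℝ} (hN : volume N = 0) :
    Measure.hausdorffMeasure 1 (D.point '' N) = 0 := by
  refine measure_mono_null (t := ⋃ A ∈ F.powerset, D.branch A '' N) ?_ ?_
  · rintro _ ⟨x, hx, rfl⟩
    rw [point_eq_branch]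
    exact mem_biUnion (Finset.mem_coe.2 (Finset.mem_powerset.2 (Finset.filter_subset _ _)))
      (mem_image_of_mem _ hx)
  · refine (measure_biUnion_null_iff F.powerset.countable_toSet).2 ?_
    exact fun A _ => D.hausdorffMeasure_branch_image_eq_zero A hN

/-- The length of the graph over a bounded set. -/
lemma hausdorffMeasure_point_image {S : Set ℝ} (hS : MeasurableSet S) (hfin : volume S ≠ ⊤) :
    Measure.hausdorffMeasure 1 (D.point '' S) =
      ∫⁻ x in S, ENNReal.ofReal (√(1 + D.dens x ^ 2)) := by
  have h1 := D.ae_hasDerivAt_left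
  rw [ae_iff] at h1
  obtain ⟨N, hN1, hN2, hN3⟩ := exists_measurable_superset_of_null h1
  have hinj : Function.Injective D.point := fun x y hxy => by
    have := congrArg (fun p : Plane => p 0) hxy
    simpa [point] using this
  have h2 : Measure.hausdorffMeasure 1 (D.point '' S) =
      Measure.hausdorffMeasure 1 (D.point '' (S \ N)) := by
    refine le_antisymm ?_ (measure_mono (image_mono sdiff_subset))
    have h3 : D.point '' S ⊆ D.point '' (S \ N) ∪ D.point '' N := by
      rw [← image_union]
      exact image_mono (by rw [sdiff_union_self]; exact subset_union_left)
    refine (measure_mono h3).trans ((measure_union_le _ _).trans ?_)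
    rw [D.hausdorffMeasure_point_image_eq_zero hN3, add_zero]
  have h4 : volume (S \ N) ≠ ⊤ := ne_top_of_le_ne_top hfin (measure_mono sdiff_subset)
  rw [h2, hausdorffMeasure_one_image_eq_lintegral (γ' := fun x => !₂[1, D.dens x])
    (hS.diff hN2) h4 ?_ (measurable_plane_mk measurable_const D.measurable_dens) hinj.injOn]
  · have h5 : ∀ x, ‖(!₂[1, D.dens x] : Plane)‖ₑ = ENNReal.ofReal (√(1 + D.dens x ^ 2)) := by
      intro x
      rw [← ofReal_norm, EuclideanSpace.norm_eq, Fin.sum_univ_two]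
      simp
    simp_rw [h5]
    exact setLIntegral_congr (sdiff_null_ae_eq_self hN3)
  · intro x hx
    have h6 : HasDerivAt D.left (D.dens x) x := by
      by_contra hcon
      exact hx.2 (hN1 hcon)
    exact (hasDerivAt_plane_mk (hasDerivAt_id' x) h6).hasDerivWithinAt

lemma measurableSet_graph (b : ℝ) : MeasurableSet (D.graph b) := by
  have hl : Measurable fun p : Plane => D.left (p 0) :=
    D.measurable_left.comp (measurable_plane_apply 0)
  have hr : Measurable fun p : Plane => D.right (p 0) :=
    D.measurable_right.comp (measurable_plane_apply 0)
  exact ((measurable_plane_apply 0) measurableSet_Ioo).inter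
    ((measurableSet_le (hl.min hr) (measurable_plane_apply 1)).inter
      (measurableSet_le (measurable_plane_apply 1) (hl.max hr)))

/-- The length measure of the extended graph. -/
theorem restrict_graph_eq (hF : ↑F ⊆ Ioo a b) :
    (Measure.hausdorffMeasure 1).restrict (D.graph b) =
      Measure.map D.point ((volume.restrict (Ioo a b)).withDensity
        fun x => ENNReal.ofReal (√(1 + D.dens x ^ 2))) +
      ∑ s ∈ F, Measure.map (fun t => (!₂[s, t] : Plane))
        (volume.restrict (uIcc (D.left s) (D.right s))) := by
  ext E hE
  have hFm : MeasurableSet {p : Plane | p 0 ∈ (F : Set ℝ)} :=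
    (measurable_plane_apply 0) F.measurableSet
  have hsm : ∀ s : ℝ, MeasurableSet {p : Plane | p 0 = s} := fun s =>
    (measurable_plane_apply 0) (measurableSet_singleton s)
  rw [Measure.restrict_apply hE, Measure.add_apply, Measure.finsetSum_apply,
    Measure.map_apply D.measurable_point hE, withDensity_apply _ (D.measurable_point hE),
    Measure.restrict_restrict (D.measurable_point hE),
    ← measure_inter_add_sdiff (E ∩ D.graph b) hFm, add_comm]
  congr 1
  · have h1 : (E ∩ D.graph b) \ {p : Plane | p 0 ∈ (F : Set ℝ)} =
        D.point '' ((D.point ⁻¹' E ∩ Ioo a b) \ F) := by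
      ext p
      constructor
      · rintro ⟨⟨hpE, hpI, hp1, hp2⟩, hpF⟩
        have hj : D.right (p 0) = D.left (p 0) := by
          rw [right, D.jump_eq_zero _ (by simpa using hpF), add_zero]
        rw [hj, min_self] at hp1
        rw [hj, max_self] at hp2
        have hpp : D.point (p 0) = p := by
          rw [point, le_antisymm hp1 hp2]; exact plane_eta p
        exact ⟨p 0, ⟨⟨by rw [mem_preimage, hpp]; exact hpE, hpI⟩, hpF⟩, hpp⟩
      · rintro ⟨x, ⟨⟨hxE, hxI⟩, hxF⟩, rfl⟩
        refine ⟨⟨hxE, ?_⟩, by simpa [point] using hxF⟩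
        simp only [graph, point, mem_ofPred_eq]
        exact ⟨hxI, min_le_left _ _, le_max_left _ _⟩
    have hfin : volume ((D.point ⁻¹' E ∩ Ioo a b) \ (F : Set ℝ)) ≠ ⊤ :=
      ne_top_of_le_ne_top (by simp : volume (Ioo a b) ≠ ⊤)
        (measure_mono (sdiff_subset.trans inter_subset_right))
    rw [h1, D.hausdorffMeasure_point_image
      (((D.measurable_point hE).inter measurableSet_Ioo).diff F.measurableSet) hfin]
    exact setLIntegral_congr (sdiff_null_ae_eq_self (F.finite_toSet.measure_zero _))
  · have h2 : (E ∩ D.graph b) ∩ {p : Plane | p 0 ∈ (F : Set ℝ)} =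
        ⋃ s ∈ F, (E ∩ D.graph b) ∩ {p : Plane | p 0 = s} := by
      ext p; simp
    rw [h2, measure_biUnion_finset]
    · refine Finset.sum_congr rfl fun s hs => ?_
      have h3 : (E ∩ D.graph b) ∩ {p : Plane | p 0 = s} =
          (fun t => (!₂[s, t] : Plane)) ''
            ((fun t => (!₂[s, t] : Plane)) ⁻¹' E ∩ uIcc (D.left s) (D.right s)) := by
        ext p
        constructor
        · rintro ⟨⟨hpE, hpI, hp1, hp2⟩, hps⟩
          have hps : p 0 = s := hps
          have hpp : (!₂[s, p 1] : Plane) = p := by rw [← hps]; exact plane_eta p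
          rw [hps] at hp1 hp2
          exact ⟨p 1, ⟨by rw [mem_preimage, hpp]; exact hpE, hp1, hp2⟩, hpp⟩
        · rintro ⟨t, ⟨htE, ht1, ht2⟩, rfl⟩
          refine ⟨⟨htE, ?_⟩, by simp⟩
          simp only [graph, mem_ofPred_eq]
          exact ⟨hF hs, ht1, ht2⟩
      rw [h3, (isometry_vertical s).hausdorffMeasure_image (Or.inl zero_le_one),
        hausdorffMeasure_real, Measure.map_apply (measurable_vertical s) hE,
        Measure.restrict_apply (measurable_vertical s hE)]
    · intro s _ t _ hst
      rw [Function.onFun, Set.disjoint_left]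
      rintro p ⟨_, hp⟩ ⟨_, hp'⟩
      exact hst ((show p 0 = s from hp).symm.trans hp')
    · exact fun s _ => (hE.inter (D.measurableSet_graph b)).inter (hsm s)

lemma measurable_sqrt : Measurable fun x => √(1 + D.dens x ^ 2) :=
  (measurable_const.add (D.measurable_dens.pow_const 2)).sqrt

lemma integrableOn_sqrt (b : ℝ) : IntegrableOn (fun x => √(1 + D.dens x ^ 2)) (Ioo a b) := by
  refine Integrable.mono' (g := fun x => 1 + |D.dens x|)
    ((integrableOn_const (by simp)).add D.integrable_dens.abs.integrableOn)
    D.measurable_sqrt.aestronglyMeasurable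
    (ae_of_all _ fun x => ?_)
  rw [Real.norm_of_nonneg (Real.sqrt_nonneg _), Real.sqrt_le_left (by positivity)]
  nlinarith [abs_nonneg (D.dens x), sq_abs (D.dens x)]

lemma isFiniteMeasure_restrict_graph (hF : ↑F ⊆ Ioo a b) :
    IsFiniteMeasure ((Measure.hausdorffMeasure 1 : Measure Plane).restrict (D.graph b)) := by
  have h1 : IsFiniteMeasure ((volume.restrict (Ioo a b)).withDensity
      fun x => ENNReal.ofReal (√(1 + D.dens x ^ 2))) :=
    isFiniteMeasure_withDensity_ofReal (D.integrableOn_sqrt b).2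
  have h2 : ∀ s, IsFiniteMeasure (volume.restrict (uIcc (D.left s) (D.right s))) := fun s =>
    ⟨by simp [uIcc]⟩
  rw [D.restrict_graph_eq hF]
  infer_instance

/-- Null sets of abscissae are negligible on the graph but not on the vertical segments, which carry
length over single points; hence the alternative. -/
lemma ae_graph (hF : ↑F ⊆ Ioo a b) {N : Set ℝ} (hN : volume N = 0) :
    ∀ᵐ p ∂(Measure.hausdorffMeasure 1 : Measure Plane).restrict (D.graph b),
      p 0 ∉ N ∨ D.jump (p 0) ≠ 0 := by
  obtain ⟨N', hNN', hm, hN'⟩ := exists_measurable_superset_of_null hN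
  have hQm : MeasurableSet {p : Plane | p 0 ∉ N' ∨ D.jump (p 0) ≠ 0} :=
    ((measurable_plane_apply 0) hm.compl).union ((D.measurable_jump.comp (measurable_plane_apply 0))
      (measurableSet_singleton 0).compl)
  have h : ∀ᵐ p ∂(Measure.hausdorffMeasure 1 : Measure Plane).restrict (D.graph b),
      p 0 ∉ N' ∨ D.jump (p 0) ≠ 0 := by
    rw [D.restrict_graph_eq hF, ae_add_measure_iff]
    constructor
    · rw [ae_map_iff D.measurable_point.aemeasurable hQm]
      refine (withDensity_absolutelyContinuous _ _).ae_le (ae_restrict_of_ae ?_)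
      filter_upwards [measure_eq_zero_iff_ae_notMem.1 hN'] with x hx
      left; simpa [point] using hx
    · rw [ae_finsetSum_measure_iff]
      intro s _
      rw [ae_map_iff (measurable_vertical s).aemeasurable hQm]
      by_cases hj : D.jump s = 0
      · have : (volume.restrict (uIcc (D.left s) (D.right s))) = 0 := by
          rw [Measure.restrict_eq_zero, right, hj, add_zero, uIcc_self]
          exact Real.volume_singleton
        rw [this]; simp
      · exact ae_of_all _ fun t => Or.inr (by simpa using hj)
  filter_upwards [h] with p hp
  exact hp.imp_left fun h h' => h (hNN' h')

open Classical in
/-- The unit tangent to the extended graph. -/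
def tangent (p : Plane) : Plane :=
  if D.jump (p 0) ≠ 0 then !₂[0, Real.sign (D.jump (p 0))]
  else (√(1 + D.dens (p 0) ^ 2))⁻¹ • !₂[1, D.dens (p 0)]

lemma measurable_tangent : Measurable D.tangent := by
  have hj : Measurable fun p : Plane => D.jump (p 0) :=
    D.measurable_jump.comp (measurable_plane_apply 0)
  have hd : Measurable fun p : Plane => D.dens (p 0) :=
    D.measurable_dens.comp (measurable_plane_apply 0)
  refine Measurable.ite (hj (measurableSet_singleton 0).compl) ?_ ?_
  · have h : Measurable Real.sign := by
      unfold Real.sign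
      exact Measurable.ite measurableSet_Iio measurable_const
        (Measurable.ite measurableSet_Ioi measurable_const measurable_const)
    exact (measurable_plane_mk measurable_const h).comp hj
  · exact ((measurable_const.add (hd.pow_const 2)).sqrt.inv).smul
      ((measurable_plane_mk measurable_const measurable_id).comp hd)

lemma norm_tangent (p : Plane) : ‖D.tangent p‖ = 1 := by
  rw [tangent]
  split_ifs with h
  · rw [EuclideanSpace.norm_eq, Fin.sum_univ_two]
    rcases lt_or_gt_of_ne h with h | h
    · simp [Real.sign_of_neg h]
    · simp [Real.sign_of_pos h]
  · have h1 : 0 < √(1 + D.dens (p 0) ^ 2) := Real.sqrt_pos.2 (by positivity)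
    rw [norm_smul, norm_inv, Real.norm_of_nonneg h1.le, EuclideanSpace.norm_eq, Fin.sum_univ_two]
    simp only [Real.norm_eq_abs, sq_abs]
    simp [h1.ne']

lemma abs_tangent_apply_le (p : Plane) (i : Fin 2) : |D.tangent p i| ≤ 1 :=
  (PiLp.norm_apply_le (D.tangent p) i).trans (D.norm_tangent p).le

lemma integral_graph {h : Plane → ℝ} (hF : ↑F ⊆ Ioo a b) (hm : Measurable h) {B : ℝ}
    (hB : ∀ p, |h p| ≤ B) :
    ∫ p in D.graph b, h p ∂Measure.hausdorffMeasure 1 =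
      (∫ x in Ioo a b, √(1 + D.dens x ^ 2) * h (D.point x)) +
      ∑ s ∈ F, ∫ t in uIcc (D.left s) (D.right s), h !₂[s, t] := by
  have hfin := D.isFiniteMeasure_restrict_graph hF
  have hi : Integrable h ((Measure.hausdorffMeasure 1 : Measure Plane).restrict (D.graph b)) :=
    Integrable.of_bound hm.aestronglyMeasurable B (ae_of_all _ hB)
  rw [D.restrict_graph_eq hF] at hi ⊢
  obtain ⟨hi1, hi2⟩ := integrable_add_measure.1 hi
  rw [integral_add_measure hi1 hi2, integral_map D.measurable_point.aemeasurable
    hm.aestronglyMeasurable, integral_withDensity_eq_integral_toReal_smul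
      D.measurable_sqrt.ennreal_ofReal
      (ae_of_all _ fun _ => ENNReal.ofReal_lt_top),
    integral_finsetSum_measure fun s hs => integrable_finsetSum_measure.1 hi2 s hs]
  congr 1
  · refine integral_congr_ae (ae_of_all _ fun x => ?_)
    simp only [ENNReal.toReal_ofReal (Real.sqrt_nonneg _), smul_eq_mul]
  · exact Finset.sum_congr rfl fun s _ =>
      integral_map (measurable_vertical s).aemeasurable hm.aestronglyMeasurable

/-- The first component of the extended graph, as a vector measure. -/
lemma integral_graph_tangent_zero {ψ : Plane → ℝ} (hF : ↑F ⊆ Ioo a b) (hm : Measurable ψ) {B : ℝ}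
    (hB : ∀ p, |ψ p| ≤ B) :
    ∫ p in D.graph b, ψ p * D.tangent p 0 ∂Measure.hausdorffMeasure 1 =
      ∫ x in Ioo a b, ψ (D.point x) := by
  have hB0 : 0 ≤ B := (abs_nonneg _).trans (hB 0)
  rw [D.integral_graph hF (B := B) (h := fun p => ψ p * D.tangent p 0)
    (hm.mul ((measurable_plane_apply 0).comp D.measurable_tangent))
    (fun p => by
      rw [abs_mul]
      calc |ψ p| * |D.tangent p 0| ≤ B * 1 := by gcongr; exacts [hB p, D.abs_tangent_apply_le p 0]
        _ = B := mul_one B)]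
  -- A genuine vertical segment has tangent with zero first component; a point of `F` without jump
  -- gives a segment of zero length.
  have h1 : ∑ s ∈ F, ∫ t in uIcc (D.left s) (D.right s),
      ψ !₂[s, t] * D.tangent !₂[s, t] 0 = 0 := by
    refine Finset.sum_eq_zero fun s _ => ?_
    by_cases hj : D.jump s = 0
    · rw [right, hj, add_zero, uIcc_self, setIntegral_measure_zero _ Real.volume_singleton]
    · refine integral_eq_zero_of_ae (ae_of_all _ fun t => ?_)
      simp [tangent, hj]
  rw [h1, add_zero]
  refine integral_congr_ae (ae_restrict_of_ae ?_)
  filter_upwards [ae_notMem_finset F] with x hx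
  have h2 : √(1 + D.dens x ^ 2) ≠ 0 := (Real.sqrt_pos.2 (by positivity)).ne'
  simp [tangent, point, D.jump_eq_zero x hx]
  field_simp

/-- The second component of the extended graph, as a vector measure. -/
lemma integral_graph_tangent_one {ψ : Plane → ℝ} (hF : ↑F ⊆ Ioo a b) (hm : Measurable ψ) {B : ℝ}
    (hB : ∀ p, |ψ p| ≤ B) :
    ∫ p in D.graph b, ψ p * D.tangent p 1 ∂Measure.hausdorffMeasure 1 =
      (∫ x in Ioo a b, ψ (D.point x) * D.dens x) +
      ∑ s ∈ F, ∫ t in D.left s..D.right s, ψ !₂[s, t] := by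
  have hB0 : 0 ≤ B := (abs_nonneg _).trans (hB 0)
  rw [D.integral_graph hF (B := B) (h := fun p => ψ p * D.tangent p 1)
    (hm.mul ((measurable_plane_apply 1).comp D.measurable_tangent))
    (fun p => by
      rw [abs_mul]
      calc |ψ p| * |D.tangent p 1| ≤ B * 1 := by gcongr; exacts [hB p, D.abs_tangent_apply_le p 1]
        _ = B := mul_one B)]
  congr 1
  · refine integral_congr_ae (ae_restrict_of_ae ?_)
    filter_upwards [ae_notMem_finset F] with x hx
    have h2 : √(1 + D.dens x ^ 2) ≠ 0 := (Real.sqrt_pos.2 (by positivity)).ne'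
    simp [tangent, point, D.jump_eq_zero x hx]
    field_simp
  · refine Finset.sum_congr rfl fun s _ => ?_
    -- The sign in the tangent turns the integral over the unoriented segment into the oriented
    -- interval integral.
    rcases lt_trichotomy (D.jump s) 0 with hj | hj | hj
    · have hlr : D.right s ≤ D.left s := by rw [right]; linarith
      rw [intervalIntegral.integral_of_ge hlr, uIcc_of_ge hlr, integral_Icc_eq_integral_Ioc,
        ← integral_neg]
      refine integral_congr_ae (ae_of_all _ fun t => ?_)
      simp [tangent, hj.ne, Real.sign_of_neg hj]
    · rw [right, hj, add_zero, uIcc_self, setIntegral_measure_zero _ Real.volume_singleton]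
      simp
    · have hlr : D.left s ≤ D.right s := by rw [right]; linarith
      rw [intervalIntegral.integral_of_le hlr, uIcc_of_le hlr, integral_Icc_eq_integral_Ioc]
      refine integral_congr_ae (ae_of_all _ fun t => ?_)
      simp [tangent, hj.ne', Real.sign_of_pos hj]

end PiecewiseAC

/-! ### The current `Γ_u` expressed through the piecewise absolutely continuous data. -/

namespace PiecewiseAC

variable {a b : ℝ} {F : Finset ℝ} {D : PiecewiseAC a F} {u : ℝ → ℝ}

lemma Represents.extendedGraph_eq (h : D.Represents b u) : extendedGraph a b u = D.graph b := by
  ext p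
  simp only [extendedGraph, graph, mem_ofPred_eq]
  refine and_congr_right fun hp => ?_
  rw [h.leftTrace_eq hp, h.rightTrace_eq hp]

lemma Represents.ae_graphTangent_eq (h : D.Represents b u) (hF : ↑F ⊆ Ioo a b) :
    ∀ᵐ p ∂(Measure.hausdorffMeasure 1 : Measure Plane).restrict (D.graph b),
      graphTangent a b u p = D.tangent p := by
  have h1 := h.ae_approxDeriv_eq
  rw [ae_iff] at h1
  filter_upwards [D.ae_graph hF h1, ae_restrict_mem (D.measurableSet_graph b)] with p hp hpg
  have hpI := hpg.1
  rw [graphTangent, tangent]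
  by_cases hj : D.jump (p 0) = 0
  · rw [if_neg (by rw [h.mem_singularSet_iff hpI]; simpa using hj), if_neg (by simpa using hj)]
    have h2 : approxDeriv u (p 0) = D.dens (p 0) := by
      rcases hp with hp | hp
      · by_contra hcon
        exact hp fun h3 => hcon (h3 hpI)
      · exact absurd hj hp
    rw [h2]
  · rw [if_pos ((h.mem_singularSet_iff hpI).2 hj), if_pos hj, h.leftTrace_eq hpI,
      h.rightTrace_eq hpI, right, add_sub_cancel_left]

lemma Represents.graphCurrent_apply (h : D.Represents b u) (hF : ↑F ⊆ Ioo a b)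
    (σ : TestForm a b) :
    graphCurrent a b u σ = ∫ p in D.graph b, σ p (D.tangent p) ∂Measure.hausdorffMeasure 1 := by
  rw [graphCurrent, Triple.current]
  simp only [graphTriple, one_mul]
  rw [h.extendedGraph_eq]
  refine integral_congr_ae ?_
  filter_upwards [h.ae_graphTangent_eq hF] with p hp
  rw [hp]

end PiecewiseAC

/-! ### Sums of extended graphs -/

section Sum

variable {a b : ℝ} {F : Finset ℝ} {ι : Type*} [Fintype ι]

/-- The sum of the currents carried by a family of extended graphs. -/
def sumCurrent (b : ℝ) (D : ι → PiecewiseAC a F) : TestForm a b → ℝ := fun σ =>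
  ∑ i, ∫ p in (D i).graph b, σ p ((D i).tangent p) ∂Measure.hausdorffMeasure 1

lemma sum_graphCurrent_eq (hF : ↑F ⊆ Ioo a b) {D : ι → PiecewiseAC a F} {u : ι → ℝ → ℝ}
    (h : ∀ i, (D i).Represents b (u i)) : ∑ i, graphCurrent a b (u i) = sumCurrent b D := by
  ext σ
  rw [Finset.sum_apply, sumCurrent]
  exact Finset.sum_congr rfl fun i _ => (h i).graphCurrent_apply hF σ

/-- The test form `g dx_j`. -/
def coordinateForm {g : Plane → ℝ} (j : Fin 2) (hg : ContDiff ℝ ∞ g) (hc : HasCompactSupport g)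
    (hs : tsupport g ⊆ strip a b) : TestForm a b where
  toFun p := g p • (EuclideanSpace.proj j : Plane →L[ℝ] ℝ)
  contDiff' := hg.smul contDiff_const
  hasCompactSupport' := hc.smul_right
  tsupport_subset' := (tsupport_smul_subset_left g _).trans hs

lemma coordinateForm_apply {g : Plane → ℝ} (j : Fin 2) (hg : ContDiff ℝ ∞ g)
    (hc : HasCompactSupport g) (hs : tsupport g ⊆ strip a b) (p v : Plane) :
    coordinateForm j hg hc hs p v = g p * v j := rfl

lemma integrable_tangent_apply (hF : ↑F ⊆ Ioo a b) (D : PiecewiseAC a F) (j : Fin 2) :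
    Integrable (fun p => D.tangent p j)
      ((Measure.hausdorffMeasure 1 : Measure Plane).restrict (D.graph b)) := by
  have := D.isFiniteMeasure_restrict_graph hF
  exact Integrable.of_bound ((measurable_plane_apply j).comp
    D.measurable_tangent).aestronglyMeasurable 1 (ae_of_all _ fun p => D.abs_tangent_apply_le p j)

lemma measurableSet_strip (a b : ℝ) : MeasurableSet (strip a b : Set Plane) :=
  (strip a b).isOpen.measurableSet

/-- Two presentations of the same current define the same vector measure. -/
theorem Triple.IsRectifiable.integral_orient_eq {R : Triple} (hR : R.IsRectifiable a b)
    (hF : ↑F ⊆ Ioo a b) {D : ι → PiecewiseAC a F} (hT : R.current a b = sumCurrent b D)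
    (j : Fin 2) {ψ : Plane → ℝ} (hψ : Measurable ψ) {B : ℝ} (hB : ∀ p, |ψ p| ≤ B) :
    ∫ p in R.carrier, ψ p * (R.mult p * R.orient p j) ∂Measure.hausdorffMeasure 1 =
      ∑ i, ∫ p in (D i).graph b, ψ p * (D i).tangent p j ∂Measure.hausdorffMeasure 1 := by
  set H : Measure Plane := Measure.hausdorffMeasure 1 with hH
  -- The presentation `R` is added to the family as the index `none`, with opposite sign. Equality
  -- of the currents then says that the whole sum vanishes on the forms `g dx_j`.
  set ρ : Option ι → Measure Plane := fun o => o.elim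
    ((H.restrict R.carrier).withDensity fun p => ENNReal.ofReal (R.mult p))
    fun i => H.restrict ((D i).graph b) with hρ
  set h : Option ι → Plane → ℝ := fun o => o.elim (fun p => -R.orient p j)
    fun i p => (D i).tangent p j with hh
  have hfin : ∀ o, IsFiniteMeasure (ρ o) := by
    rintro (_ | i)
    · exact isFiniteMeasure_withDensity_ofReal hR.mult_integrable.2
    · exact (D i).isFiniteMeasure_restrict_graph hF
  have hac : ρ none ≪ H.restrict R.carrier := withDensity_absolutelyContinuous _ _
  have hsupp : ∀ o, ρ o (strip a b : Set Plane)ᶜ = 0 := by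
    rintro (_ | i)
    · refine hac ?_
      rw [Measure.restrict_apply (measurableSet_strip a b).compl]
      convert measure_empty (μ := H)
      exact Set.eq_empty_of_forall_notMem fun p hp => hp.1 (hR.subset hp.2)
    · change H.restrict ((D i).graph b) _ = 0
      rw [Measure.restrict_apply (measurableSet_strip a b).compl]
      convert measure_empty (μ := H)
      exact Set.eq_empty_of_forall_notMem fun p hp => hp.1 hp.2.1
  have hint : ∀ o, Integrable (h o) (ρ o) := by
    rintro (_ | i)
    · refine Integrable.neg (Integrable.of_bound (C := 1) ?_ ?_)
      · exact ((measurable_plane_apply j).comp_aemeasurable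
          (hR.orient_aemeasurable.mono_ac hac)).aestronglyMeasurable
      · filter_upwards [hac.ae_le hR.orient_unit] with p hp
        exact (PiLp.norm_apply_le (R.orient p) j).trans hp.le
    · exact integrable_tangent_apply hF (D i) j
  have expand : ∀ g : Plane → ℝ, ∑ o, ∫ p, g p * h o p ∂ρ o =
      -(∫ p in R.carrier, g p * (R.mult p * R.orient p j) ∂H) +
        ∑ i, ∫ p in (D i).graph b, g p * (D i).tangent p j ∂H := by
    intro g
    rw [Fintype.sum_option]
    congr 1
    simp only [hρ, hh, Option.elim]
    rw [integral_withDensity_eq_integral_toReal_smul₀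
      hR.mult_integrable.1.aemeasurable.ennreal_ofReal
      (ae_of_all _ fun _ => ENNReal.ofReal_lt_top), ← integral_neg]
    refine integral_congr_ae ?_
    have hpos : ∀ᵐ p ∂H.restrict R.carrier, 0 ≤ R.mult p := by
      filter_upwards [ae_restrict_mem₀ hR.nullMeasurable] with p hp using (hR.mult_pos p hp).le
    filter_upwards [hpos] with p hp
    rw [ENNReal.toReal_ofReal hp, smul_eq_mul]
    ring
  have key := sum_integral_mul_eq_zero_of_contDiff (strip a b).isOpen ρ hsupp h hint
    (fun g hg hgc hgs => by
      rw [expand]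
      have h1 := congrFun hT (coordinateForm j hg hgc hgs)
      simp only [Triple.current, sumCurrent, coordinateForm_apply] at h1
      rw [← h1, neg_add_eq_zero]
      exact integral_congr_ae (ae_of_all _ fun p => by simp only; ring))
    hψ hB
  rw [expand] at key
  linarith

/-! ### The upper bound -/

/-- The Mumford-Shah energy. -/
def energy (b α β : ℝ) (g : ℝ → ℝ) (D : PiecewiseAC a F) : ℝ≥0∞ :=
  (∫⁻ x in Ioo a b, ENNReal.ofReal (D.dens x ^ 2 + β * (D.left x - g x) ^ 2)) +
    ∑ s ∈ F, if D.jump s ≠ 0 then ENNReal.ofReal α else 0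

lemma Triple.inner_normal (R : Triple) (v p : Plane) :
    inner ℝ v (R.normal p) = v 0 * R.orient p 1 - v 1 * R.orient p 0 := by
  rw [PiLp.inner_apply, Fin.sum_univ_two, Triple.normal]
  simp
  ring

variable {α β : ℝ} {g : ℝ → ℝ}

/-- The pairing of a bounded field with a rectifiable presentation of a sum of extended graphs. -/
lemma Triple.IsRectifiable.integral_inner_normal_eq {R : Triple} (hR : R.IsRectifiable a b)
    (hF : ↑F ⊆ Ioo a b) {D : ι → PiecewiseAC a F} (hT : R.current a b = sumCurrent b D)
    {φ : Plane → Plane} (hφ : Measurable φ) {B : ℝ} (hB : ∀ p i, |φ p i| ≤ B) :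
    IntegrableOn (fun p => R.mult p * inner ℝ (φ p) (R.normal p)) R.carrier
      (Measure.hausdorffMeasure 1) ∧
    ∫ p in R.carrier, R.mult p * inner ℝ (φ p) (R.normal p) ∂Measure.hausdorffMeasure 1 =
      ∑ i, ((∫ x in Ioo a b, (φ ((D i).point x) 0 * (D i).dens x - φ ((D i).point x) 1)) +
        ∑ s ∈ F, ∫ t in (D i).left s..(D i).right s, φ !₂[s, t] 0) := by
  set H : Measure Plane := Measure.hausdorffMeasure 1 with hH
  have hm : ∀ i, Measurable fun p => φ p i := fun i => (measurable_plane_apply i).comp hφ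
  have hθ : ∀ j, IntegrableOn (fun p => R.mult p * R.orient p j) R.carrier H := by
    intro j
    refine hR.mult_integrable.mul_bdd (c := 1) ((measurable_plane_apply j).comp_aemeasurable
      hR.orient_aemeasurable).aestronglyMeasurable ?_
    filter_upwards [hR.orient_unit] with p hp
    exact (PiLp.norm_apply_le (R.orient p) j).trans hp.le
  have hi : ∀ i j, IntegrableOn (fun p => φ p i * (R.mult p * R.orient p j)) R.carrier H :=
    fun i j => (hθ j).bdd_mul (c := B) (hm i).aestronglyMeasurable
      (ae_of_all _ fun p => hB p i)
  have hfun : (fun p => R.mult p * inner ℝ (φ p) (R.normal p)) = fun p =>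
      φ p 0 * (R.mult p * R.orient p 1) - φ p 1 * (R.mult p * R.orient p 0) := by
    ext p; rw [R.inner_normal]; ring
  rw [hfun]
  refine ⟨(hi 0 1).sub (hi 1 0), ?_⟩
  rw [integral_sub (hi 0 1) (hi 1 0), hR.integral_orient_eq hF hT 1 (hm 0) (fun p => hB p 0),
    hR.integral_orient_eq hF hT 0 (hm 1) (fun p => hB p 1), ← Finset.sum_sub_distrib]
  refine Finset.sum_congr rfl fun i _ => ?_
  rw [(D i).integral_graph_tangent_zero hF (hm 1) (fun p => hB p 1),
    (D i).integral_graph_tangent_one hF (hm 0) (fun p => hB p 0), integral_sub]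
  · ring
  · exact (D i).integrable_dens.integrableOn.bdd_mul (c := B)
      ((hm 0).comp (D i).measurable_point).aestronglyMeasurable (ae_of_all _ fun x => hB _ 0)
  · exact Measure.integrableOn_of_bounded (M := B) (by simp)
      ((hm 1).comp (D i).measurable_point).aestronglyMeasurable (ae_of_all _ fun x => hB _ 1)

lemma aemeasurable_energy_density (D : PiecewiseAC a F)
    (hg : AEStronglyMeasurable g (volume.restrict (Ioo a b))) :
    AEMeasurable (fun x => D.dens x ^ 2 + β * (D.left x - g x) ^ 2)
      (volume.restrict (Ioo a b)) :=
  (D.measurable_dens.pow_const 2).aemeasurable.add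
    (((D.measurable_left.aemeasurable.sub hg.aemeasurable).pow_const 2).const_mul β)

open Classical in
/-- Restriction of a field to the set where it is bounded by `n`. -/
def truncate (φ : Plane → Plane) (n : ℕ) (p : Plane) : Plane :=
  if |φ p 0| ≤ n ∧ |φ p 1| ≤ n then φ p else 0

lemma measurable_truncate {φ : Plane → Plane} (hφ : Measurable φ) (n : ℕ) :
    Measurable (truncate φ n) := by
  have hm : ∀ i, Measurable fun p => |φ p i| := fun i =>
    ((measurable_plane_apply i).comp hφ).abs
  exact Measurable.ite ((measurableSet_le (hm 0) measurable_const).inter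
    (measurableSet_le (hm 1) measurable_const)) hφ measurable_const

lemma abs_truncate_le (φ : Plane → Plane) (n : ℕ) (p : Plane) (i : Fin 2) :
    |truncate φ n p i| ≤ n := by
  rw [truncate]
  split_ifs with h
  · fin_cases i
    · exact h.1
    · exact h.2
  · simp

lemma eventually_truncate_eq (φ : Plane → Plane) (p : Plane) :
    ∀ᶠ n in atTop, truncate φ n p = φ p := by
  obtain ⟨N, hN⟩ := exists_nat_ge (max |φ p 0| |φ p 1|)
  filter_upwards [eventually_ge_atTop N] with n hn
  have h1 : max |φ p 0| |φ p 1| ≤ (n : ℝ) := hN.trans (by exact_mod_cast hn)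
  rw [truncate, if_pos ⟨(le_max_left _ _).trans h1, (le_max_right _ _).trans h1⟩]

/-- On a graph, `φˣ d - φᵗ ≤ φˣ d - (φˣ)²/4 + β (t - g)² ≤ d² + β (t - g)²` by completing the
square; a jump contributes at most `α`. -/
lemma integral_inner_normal_le {R : Triple} (hR : R.IsRectifiable a b) (hα : 0 < α) (hβ : 0 ≤ β)
    (hg : AEStronglyMeasurable g (volume.restrict (Ioo a b)))
    (hF : ↑F ⊆ Ioo a b) {D : ι → PiecewiseAC a F} (hT : R.current a b = sumCurrent b D)
    {φ : Plane → Plane} (hφ : φ ∈ admissible a b α β g)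
    (hint : IntegrableOn (fun p => R.mult p * inner ℝ (φ p) (R.normal p)) R.carrier
      (Measure.hausdorffMeasure 1)) :
    ENNReal.ofReal (∫ p in R.carrier, R.mult p * inner ℝ (φ p) (R.normal p)
      ∂Measure.hausdorffMeasure 1) ≤ ∑ i, energy b α β g (D i) := by
  rcases eq_or_ne (∑ i, energy b α β g (D i)) ⊤ with htop | htop
  · rw [htop]; exact le_top
  set H : Measure Plane := Measure.hausdorffMeasure 1 with hH
  obtain ⟨hφm, hφ1, hφ2⟩ := hφ
  set q : ι → ℝ → ℝ := fun i x => (D i).dens x ^ 2 + β * ((D i).left x - g x) ^ 2 with hq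
  have hq0 : ∀ i x, 0 ≤ q i x := fun i x => by positivity
  have hqi : ∀ i, IntegrableOn (q i) (Ioo a b) := by
    intro i
    refine ⟨(aemeasurable_energy_density (D i) hg).aestronglyMeasurable, ?_⟩
    rw [hasFiniteIntegral_iff_ofReal (ae_of_all _ (hq0 i))]
    have h1 : energy b α β g (D i) ≠ ⊤ := fun h => htop (ENNReal.sum_eq_top.2 ⟨i, by simp, h⟩)
    exact lt_of_le_of_lt le_self_add h1.lt_top
  -- An unbounded field cannot be evaluated graph by graph directly, since cancellation in the
  -- current may hide a divergence on individual graphs. Its truncations can be, and they converge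
  -- by domination.
  have hlim1 : Tendsto (fun n : ℕ => ∫ p in R.carrier,
      R.mult p * inner ℝ (truncate φ n p) (R.normal p) ∂H) atTop
      (𝓝 (∫ p in R.carrier, R.mult p * inner ℝ (φ p) (R.normal p) ∂H)) := by
    refine tendsto_integral_of_dominated_convergence
      (fun p => ‖R.mult p * inner ℝ (φ p) (R.normal p)‖) (fun n => ?_) hint.norm
      (fun n => ae_of_all _ fun p => ?_) (ae_of_all _ fun p => ?_)
    · exact (hR.integral_inner_normal_eq hF hT (measurable_truncate hφm n)
        (abs_truncate_le φ n)).1.1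
    · rw [truncate]
      split_ifs
      · exact le_rfl
      · rw [inner_zero_left, mul_zero, norm_zero]
        exact norm_nonneg _
    · refine tendsto_const_nhds.congr' ?_
      filter_upwards [eventually_truncate_eq φ p] with n hn
      rw [hn]
  have hlim2 : ∀ s ∈ F, ∀ l r : ℝ, Tendsto (fun n : ℕ => ∫ t in l..r, truncate φ n !₂[s, t] 0) atTop
      (𝓝 (∫ t in l..r, φ !₂[s, t] 0)) := by
    intro s hs l r
    refine intervalIntegral.tendsto_integral_filter_of_dominated_convergence
      (fun t => ‖φ !₂[s, t] 0‖) (Eventually.of_forall fun n => ?_)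
      (Eventually.of_forall fun n => ae_of_all _ fun t _ => ?_)
      (hφ2 s (hF hs) l r).1.norm (ae_of_all _ fun t _ => ?_)
    · exact ((measurable_plane_apply 0).comp ((measurable_truncate hφm n).comp
        (measurable_vertical s))).aestronglyMeasurable
    · rw [truncate]
      split_ifs <;> simp
    · refine tendsto_const_nhds.congr' ?_
      filter_upwards [eventually_truncate_eq φ !₂[s, t]] with n hn
      rw [hn]
  -- Truncation keeps the bound on graphs, as a zero field contributes zero there, but may destroy
  -- the constraint on vertical integrals. The jump terms are therefore kept and bounded by `α` only
  -- in the limit.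
  have hbound : ∀ n : ℕ, ∫ p in R.carrier, R.mult p * inner ℝ (truncate φ n p) (R.normal p) ∂H ≤
      ∑ i, ((∫ x in Ioo a b, q i x) +
        ∑ s ∈ F, ∫ t in (D i).left s..(D i).right s, truncate φ n !₂[s, t] 0) := by
    intro n
    rw [(hR.integral_inner_normal_eq hF hT (measurable_truncate hφm n) (abs_truncate_le φ n)).2]
    refine Finset.sum_le_sum fun i _ => add_le_add_left ?_ _
    have hm : ∀ j, Measurable fun x => truncate φ n ((D i).point x) j := fun j =>
      (measurable_plane_apply j).comp ((measurable_truncate hφm n).comp (D i).measurable_point)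
    refine setIntegral_mono_on ?_ (hqi i) measurableSet_Ioo fun x hx => ?_
    · refine Integrable.sub ?_ ?_
      · exact (D i).integrable_dens.integrableOn.bdd_mul (c := n)
          (hm 0).aestronglyMeasurable (ae_of_all _ fun x => abs_truncate_le φ n _ 0)
      · exact Measure.integrableOn_of_bounded (M := n) (by simp)
          (hm 1).aestronglyMeasurable (ae_of_all _ fun x => abs_truncate_le φ n _ 1)
    · rw [truncate]
      split_ifs
      · have h1 := hφ1 x hx ((D i).left x)
        rw [← PiecewiseAC.point] at h1
        simp only [hq]
        nlinarith [sq_nonneg (φ ((D i).point x) 0 / 2 - (D i).dens x)]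
      · simpa using hq0 i x
  have hle : ∫ p in R.carrier, R.mult p * inner ℝ (φ p) (R.normal p) ∂H ≤
      ∑ i, ((∫ x in Ioo a b, q i x) + ∑ s ∈ F, if (D i).jump s ≠ 0 then α else 0) := by
    refine (le_of_tendsto_of_tendsto' hlim1 (tendsto_finsetSum _ fun i _ =>
      (tendsto_finsetSum _ fun s hs => hlim2 s hs _ _).const_add _) hbound).trans ?_
    refine Finset.sum_le_sum fun i _ => add_le_add_right (Finset.sum_le_sum fun s hs => ?_) _
    split_ifs with hj
    · exact (le_abs_self _).trans (hφ2 s (hF hs) _ _).2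
    · rw [not_not] at hj
      rw [PiecewiseAC.right, hj, add_zero, intervalIntegral.integral_same]
  refine (ENNReal.ofReal_le_ofReal hle).trans (le_of_eq ?_)
  have hnn : ∀ i s, 0 ≤ if (D i).jump s ≠ 0 then α else 0 := fun i s => by
    split_ifs
    · exact hα.le
    · exact le_rfl
  rw [ENNReal.ofReal_sum_of_nonneg fun i _ => add_nonneg
    (integral_nonneg (hq0 i)) (Finset.sum_nonneg fun s _ => hnn i s)]
  refine Finset.sum_congr rfl fun i _ => ?_
  rw [ENNReal.ofReal_add (integral_nonneg (hq0 i)) (Finset.sum_nonneg fun s _ => hnn i s),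
    ofReal_integral_eq_lintegral_ofReal (hqi i) (ae_of_all _ (hq0 i)),
    ENNReal.ofReal_sum_of_nonneg fun s _ => hnn i s, energy]
  congr 1
  refine Finset.sum_congr rfl fun s _ => ?_
  split_ifs <;> simp

/-- The lifted functional of a sum of extended graphs is at most the sum of the energies. -/
theorem G_sumCurrent_le (hα : 0 < α) (hβ : 0 ≤ β)
    (hg : AEStronglyMeasurable g (volume.restrict (Ioo a b))) (hF : ↑F ⊆ Ioo a b)
    (D : ι → PiecewiseAC a F) :
    G a b α β g (sumCurrent b D) ≤ ((∑ i, energy b α β g (D i) : ℝ≥0∞) : EReal) := by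
  refine iSup_le fun R => iSup_le fun hR => iSup_le fun φ => iSup_le fun hφ => iSup_le fun hi => ?_
  have h := integral_inner_normal_le hR.1 hα hβ hg hF hR.2 hφ hi
  refine le_trans ?_ (EReal.coe_ennreal_le_coe_ennreal_iff.2 h)
  rw [EReal.coe_ennreal_ofReal]
  exact EReal.coe_le_coe_iff.2 (le_max_left _ _)

end Sum

/-! ### A rectifiable presentation of a sum of extended graphs -/

section SumTriple

variable {a b : ℝ} {F : Finset ℝ} {ι : Type*} [Fintype ι]

/-- The density of the sum of extended graphs with respect to length. -/
def sumTangent (b : ℝ) (D : ι → PiecewiseAC a F) (p : Plane) : Plane :=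
  ∑ i, ((D i).graph b).indicator (D i).tangent p

/-- The presentation of the sum of extended graphs by carrier, multiplicity and orientation. -/
def sumTriple (b : ℝ) (D : ι → PiecewiseAC a F) : Triple where
  carrier := {p | sumTangent b D p ≠ 0}
  mult p := ‖sumTangent b D p‖
  orient p := ‖sumTangent b D p‖⁻¹ • sumTangent b D p

variable (D : ι → PiecewiseAC a F)

lemma measurable_sumTangent : Measurable (sumTangent b D) :=
  Finset.measurable_fun_sum _ fun i _ =>
    (D i).measurable_tangent.indicator ((D i).measurableSet_graph b)

lemma exists_mem_graph_of_sumTangent_ne_zero {p : Plane} (hp : sumTangent b D p ≠ 0) :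
    ∃ i, p ∈ (D i).graph b := by
  by_contra hcon
  push Not at hcon
  exact hp (Finset.sum_eq_zero fun i _ => indicator_of_notMem (hcon i) _)

lemma norm_sumTangent_le (p : Plane) :
    ‖sumTangent b D p‖ ≤ ∑ i, ((D i).graph b).indicator (fun _ => (1 : ℝ)) p := by
  refine (norm_sum_le _ _).trans (Finset.sum_le_sum fun i _ => ?_)
  by_cases h : p ∈ (D i).graph b
  · rw [indicator_of_mem h, indicator_of_mem h, (D i).norm_tangent]
  · rw [indicator_of_notMem h, indicator_of_notMem h, norm_zero]

lemma sumTangent_eq_smul {p w : Plane}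
    (h : ∀ i, p ∈ (D i).graph b → ∃ r : ℝ, (D i).tangent p = r • w) :
    ∃ r : ℝ, sumTangent b D p = r • w := by
  have h' : ∀ i, ∃ r : ℝ, ((D i).graph b).indicator (D i).tangent p = r • w := by
    intro i
    by_cases hp : p ∈ (D i).graph b
    · rw [indicator_of_mem hp]; exact h i hp
    · exact ⟨0, by rw [indicator_of_notMem hp, zero_smul]⟩
  choose r hr using h'
  refine ⟨∑ i, r i, ?_⟩
  rw [sumTangent, Finset.sum_smul]
  exact Finset.sum_congr rfl fun i _ => hr i

/-- Points where the tangents cancel are not in the carrier, so there the common direction `w` spans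
the same line as the orientation. The factor `k` admits curves of arbitrary, possibly zero, speed.
-/
lemma exists_smul_orient {p w : Plane} (hp : p ∈ (sumTriple b D).carrier)
    (h : ∀ i, p ∈ (D i).graph b → ∃ r : ℝ, (D i).tangent p = r • w) (k : ℝ) :
    ∃ c : ℝ, k • w = c • (sumTriple b D).orient p := by
  obtain ⟨r, hr⟩ := sumTangent_eq_smul D h
  have hV : sumTangent b D p ≠ 0 := hp
  have hr0 : r ≠ 0 := fun h0 => hV (by rw [hr, h0, zero_smul])
  have hn : ‖sumTangent b D p‖ ≠ 0 := norm_ne_zero_iff.2 hV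
  refine ⟨k * r⁻¹ * ‖sumTangent b D p‖, ?_⟩
  change _ = _ • (‖sumTangent b D p‖⁻¹ • sumTangent b D p)
  rw [smul_smul, mul_assoc, mul_inv_cancel₀ hn, mul_one, hr, smul_smul, mul_assoc,
    inv_mul_cancel₀ hr0, mul_one]

namespace PiecewiseAC

variable {D' : PiecewiseAC a F}

lemma eq_left_of_mem_graph {p : Plane} (hp : p ∈ D'.graph b) (hj : D'.jump (p 0) = 0) :
    p 1 = D'.left (p 0) := by
  obtain ⟨_, h1, h2⟩ := hp
  rw [right, hj, add_zero, min_self] at h1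
  rw [right, hj, add_zero, max_self] at h2
  exact le_antisymm h2 h1

lemma tangent_of_jump_eq_zero {p : Plane} (hj : D'.jump (p 0) = 0) :
    D'.tangent p = (√(1 + D'.dens (p 0) ^ 2))⁻¹ • !₂[1, D'.dens (p 0)] := by
  rw [tangent, if_neg (by simpa using hj)]

lemma tangent_of_jump_ne_zero {p : Plane} (hj : D'.jump (p 0) ≠ 0) :
    D'.tangent p = !₂[0, Real.sign (D'.jump (p 0))] := by
  rw [tangent, if_pos hj]

/-- Almost everywhere, two graphs that meet have the same slope. -/
lemma ae_dens_eq_of_left_eq (D₁ D₂ : PiecewiseAC a F) :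
    ∀ᵐ x, D₁.left x = D₂.left x → D₁.dens x = D₂.dens x := by
  have h : ∀ᵐ x, HasDerivAt (fun x => D₁.left x - D₂.left x) (D₁.dens x - D₂.dens x) x := by
    filter_upwards [D₁.ae_hasDerivAt_left, D₂.ae_hasDerivAt_left] with x h1 h2
    exact h1.fun_sub h2
  filter_upwards [ae_deriv_eq_zero_of_eq_zero h] with x hx h'
  exact sub_eq_zero.1 (hx (sub_eq_zero.2 h'))

/-- The Lipschitz curves run along whole branches, also where these are not part of the graph of
`D₂`, so slopes must be compared with branches. -/
lemma ae_dens_eq_of_left_eq_branch (D₁ D₂ : PiecewiseAC a F) (A : Finset ℝ) :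
    ∀ᵐ x, D₁.left x = D₂.branch A x 1 → D₁.dens x = D₂.dens x := by
  have h : ∀ᵐ x, HasDerivAt (fun x => D₁.left x - (D₂.ac x + ∑ s ∈ A, D₂.jump s))
      (D₁.dens x - D₂.dens x) x := by
    filter_upwards [D₁.ae_hasDerivAt_left, D₂.ae_hasDerivAt_ac] with x h1 h2
    exact h1.fun_sub (h2.add_const _)
  filter_upwards [ae_deriv_eq_zero_of_eq_zero h] with x hx h'
  exact sub_eq_zero.1 (hx (sub_eq_zero.2 h'))

end PiecewiseAC

/-- A graph that does not jump at `s` meets the vertical line only at its left trace. Away from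
these finitely many points every graph through the point is vertical. -/
lemma ae_deriv_vertical (s : ℝ) :
    ∀ᵐ t : ℝ, (!₂[s, t] : Plane) ∈ (sumTriple b D).carrier →
      ∃ c : ℝ, deriv (fun t => (!₂[s, t] : Plane)) t = c • (sumTriple b D).orient !₂[s, t] := by
  have h1 : ∀ᵐ t : ℝ, ∀ i, t ≠ (D i).left s :=
    ae_all_iff.2 fun i => by simp [ae_iff, measure_singleton]
  filter_upwards [h1] with t ht hmem
  rw [(hasDerivAt_plane_mk (hasDerivAt_const t s) (hasDerivAt_id' t)).deriv]
  have := exists_smul_orient D hmem (w := !₂[0, 1]) (fun i hi => ?_) 1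
  · rwa [one_smul] at this
  · have hj : (D i).jump s ≠ 0 := fun hj =>
      ht i (PiecewiseAC.eq_left_of_mem_graph hi (by simpa using hj))
    refine ⟨Real.sign ((D i).jump s), ?_⟩
    rw [PiecewiseAC.tangent_of_jump_ne_zero (by simpa using hj)]
    ext k; fin_cases k <;> simp

/-- Almost everywhere in `x`, all graphs through a point of the branch have its slope; `hN`
transfers this to almost every parameter. -/
lemma ae_deriv_branch (i : ι) (A : Finset ℝ) {X : ℝ → ℝ} (hX : LipschitzWith 1 X)
    (hN : ∀ N : Set ℝ, volume N = 0 → volume (X ⁻¹' N) = 0) :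
    ∀ᵐ σ : ℝ, (D i).branch A (X σ) ∈ (sumTriple b D).carrier →
      ∃ c : ℝ, deriv (fun σ => (D i).branch A (X σ)) σ =
        c • (sumTriple b D).orient ((D i).branch A (X σ)) := by
  have pull : ∀ {P : ℝ → Prop}, (∀ᵐ x, P x) → ∀ᵐ σ, P (X σ) := fun hP => by
    rw [ae_iff] at hP ⊢
    exact hN _ hP
  have h1 : ∀ᵐ x, ∀ j, (D j).left x = (D i).branch A x 1 → (D j).dens x = (D i).dens x :=
    ae_all_iff.2 fun j => PiecewiseAC.ae_dens_eq_of_left_eq_branch (D j) (D i) A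
  filter_upwards [pull h1, pull (D i).ae_hasDerivAt_ac, pull (PiecewiseAC.ae_notMem_finset F),
    hX.ae_differentiableAt_real] with σ hσ1 hσ2 hσ3 hσ4 hmem
  have hd : HasDerivAt (fun σ => (D i).branch A (X σ))
      !₂[deriv X σ, (D i).dens (X σ) * deriv X σ] σ :=
    hasDerivAt_plane_mk hσ4.hasDerivAt ((hσ2.comp σ hσ4.hasDerivAt).add_const _)
  have hw : (!₂[deriv X σ, (D i).dens (X σ) * deriv X σ] : Plane) =
      deriv X σ • !₂[1, (D i).dens (X σ)] := by
    ext k; fin_cases k <;> simp [mul_comm]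
  rw [hd.deriv, hw]
  refine exists_smul_orient D hmem (fun j hj => ?_) _
  have hj0 : (D j).jump (((D i).branch A (X σ)) 0) = 0 := (D j).jump_eq_zero _ hσ3
  have h2 : (D j).dens (X σ) = (D i).dens (X σ) :=
    hσ1 j (PiecewiseAC.eq_left_of_mem_graph hj hj0).symm
  refine ⟨(√(1 + (D i).dens (X σ) ^ 2))⁻¹, ?_⟩
  rw [PiecewiseAC.tangent_of_jump_eq_zero hj0, ← h2]
  rfl

lemma sumTriple_curves :
    ∃ γ : ℕ → ℝ → Plane, (∀ j, ∃ L, LipschitzWith L (γ j)) ∧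
      Measure.hausdorffMeasure 1 ((sumTriple b D).carrier \ ⋃ j, range (γ j)) = 0 ∧
      ∀ j, ∀ᵐ s : ℝ, γ j s ∈ (sumTriple b D).carrier →
        ∃ c : ℝ, deriv (γ j) s = c • (sumTriple b D).orient (γ j s) := by
  choose X hX1 hX2 hX3 hX4 using fun q : ι × F.powerset =>
    (D q.1).exists_lipschitz_branch_param q.2
  -- All branches and all vertical lines over `F` cover the carrier. The constant curve at `none`
  -- only makes the index type nonempty, so that `ℕ` can enumerate it.
  let κ : Option ((ι × F.powerset) ⊕ F) → ℝ → Plane := fun o =>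
    match o with
    | none => fun _ => 0
    | some (Sum.inl q) => fun σ => (D q.1).branch q.2 (X q σ)
    | some (Sum.inr s) => fun t => !₂[(s : ℝ), t]
  obtain ⟨e, he⟩ := exists_surjective_nat (Option ((ι × F.powerset) ⊕ F))
  have hlip : ∀ o, ∃ L, LipschitzWith L (κ o) := by
    rintro (_ | q | s)
    · exact ⟨0, LipschitzWith.const 0⟩
    · exact hX3 q
    · exact ⟨1, (isometry_vertical s).lipschitz⟩
  have htan : ∀ o, ∀ᵐ s : ℝ, κ o s ∈ (sumTriple b D).carrier →
      ∃ c : ℝ, deriv (κ o) s = c • (sumTriple b D).orient (κ o s) := by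
    rintro (_ | q | s)
    · refine ae_of_all _ fun s _ => ⟨0, ?_⟩
      change deriv (fun _ : ℝ => (0 : Plane)) s = _
      rw [deriv_const, zero_smul]
    · exact ae_deriv_branch D q.1 q.2 (hX2 q) (hX4 q)
    · exact ae_deriv_vertical D s
  refine ⟨fun j => κ (e j), fun j => hlip (e j), ?_, fun j => htan (e j)⟩
  · convert measure_empty (μ := (Measure.hausdorffMeasure 1 : Measure Plane))
    refine sdiff_eq_empty.2 fun p hp => ?_
    obtain ⟨i, hi⟩ := exists_mem_graph_of_sumTangent_ne_zero D hp
    rw [mem_iUnion]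
    by_cases hpF : p 0 ∈ F
    · obtain ⟨j, hj⟩ := he (some (Sum.inr ⟨p 0, hpF⟩))
      refine ⟨j, p 1, ?_⟩
      change κ (e j) (p 1) = p
      rw [hj]
      exact plane_eta p
    · let A : F.powerset := ⟨F.filter (· < p 0), Finset.mem_powerset.2 (Finset.filter_subset _ _)⟩
      obtain ⟨j, hj⟩ := he (some (Sum.inl (i, A)))
      obtain ⟨σ, hσ⟩ := hX1 (i, A) (p 0)
      refine ⟨j, σ, ?_⟩
      change κ (e j) σ = p
      rw [hj]
      change (D i).branch (F.filter (· < p 0)) (X (i, A) σ) = p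
      rw [hσ, ← PiecewiseAC.point_eq_branch, PiecewiseAC.point,
        ← PiecewiseAC.eq_left_of_mem_graph hi ((D i).jump_eq_zero _ hpF)]
      exact plane_eta p

lemma sumTriple_isRectifiable (hF : ↑F ⊆ Ioo a b) : (sumTriple b D).IsRectifiable a b := by
  have hm := measurable_sumTangent (b := b) D
  have hcm : MeasurableSet (sumTriple b D).carrier := hm (measurableSet_singleton 0).compl
  have hint : Integrable (fun p => ∑ i, ((D i).graph b).indicator (fun _ => (1 : ℝ)) p)
      (Measure.hausdorffMeasure 1) := by
    refine integrable_finsetSum _ fun i _ => ?_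
    have := (D i).isFiniteMeasure_restrict_graph hF
    exact (integrable_indicator_iff ((D i).measurableSet_graph b)).2 (integrable_const 1)
  refine ⟨fun p hp => ?_, hcm.nullMeasurableSet, fun p hp => norm_pos_iff.2 hp, ?_, ?_, ?_,
    sumTriple_curves D⟩
  · obtain ⟨i, hi⟩ := exists_mem_graph_of_sumTangent_ne_zero D hp
    exact hi.1
  · refine (hint.mono' hm.norm.aestronglyMeasurable (ae_of_all _ fun p => ?_)).integrableOn
    rw [norm_norm]
    exact norm_sumTangent_le D p
  · exact (hm.norm.inv.smul hm).aemeasurable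
  · filter_upwards [ae_restrict_mem hcm] with p hp
    change ‖‖sumTangent b D p‖⁻¹ • sumTangent b D p‖ = 1
    rw [norm_smul, norm_inv, norm_norm, inv_mul_cancel₀ (norm_ne_zero_iff.2 hp)]

lemma sumTriple_current (hF : ↑F ⊆ Ioo a b) :
    (sumTriple b D).current a b = sumCurrent b D := by
  ext σ
  have h1 : (sumTriple b D).current a b σ =
      ∫ p in (sumTriple b D).carrier, σ p (sumTangent b D p) ∂Measure.hausdorffMeasure 1 := by
    refine setIntegral_congr_fun
      (measurable_sumTangent (b := b) D (measurableSet_singleton 0).compl) fun p hp => ?_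
    change ‖sumTangent b D p‖ * σ p (‖sumTangent b D p‖⁻¹ • sumTangent b D p) = _
    rw [map_smul, smul_eq_mul, mul_inv_cancel_left₀ (norm_ne_zero_iff.2 hp)]
  have h2 : ∀ p, σ p (sumTangent b D p) =
      ∑ i, ((D i).graph b).indicator (fun p => σ p ((D i).tangent p)) p := by
    intro p
    rw [sumTangent, map_sum]
    refine Finset.sum_congr rfl fun i _ => ?_
    by_cases hp : p ∈ (D i).graph b
    · rw [indicator_of_mem hp, indicator_of_mem hp]
    · rw [indicator_of_notMem hp, indicator_of_notMem hp, map_zero]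
  rw [h1, setIntegral_eq_integral_of_forall_compl_eq_zero fun p hp => by
    have : sumTangent b D p = 0 := not_not.1 hp
    rw [this, map_zero]]
  simp_rw [h2]
  obtain ⟨C, hC⟩ := σ.hasCompactSupport.exists_bound_of_continuous σ.continuous
  rw [integral_finsetSum _ fun i _ => ?_, sumCurrent]
  · exact Finset.sum_congr rfl fun i _ => integral_indicator ((D i).measurableSet_graph b)
  · rw [integrable_indicator_iff ((D i).measurableSet_graph b)]
    have := (D i).isFiniteMeasure_restrict_graph hF
    refine Integrable.of_bound (C := C) ?_ (ae_of_all _ fun p => ?_)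
    · exact (isBoundedBilinearMap_apply.continuous.comp_stronglyMeasurable
        (σ.continuous.stronglyMeasurable.prodMk
          (D i).measurable_tangent.stronglyMeasurable)).aestronglyMeasurable
    · refine ((σ p).le_opNorm _).trans ?_
      rw [(D i).norm_tangent, mul_one]
      exact hC p

end SumTriple

/-! ### The lower bound -/

/-- A smooth function separating two finite sets of reals, with bounded derivative. -/
lemma exists_separating_potential {A B : Set ℝ} (hA : A.Finite) (hB : B.Finite)
    (hd : Disjoint A B) :
    ∃ Φ : ℝ → ℝ, ContDiff ℝ 1 Φ ∧ (∀ x ∈ A, Φ x = 0) ∧ (∀ x ∈ B, Φ x = 1) ∧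
      (∀ x, Φ x ∈ Icc (0 : ℝ) 1) ∧ ∃ C, ∀ x, |deriv Φ x| ≤ C := by
  obtain ⟨M, hM⟩ : ∃ M, ∀ x ∈ B, |x| < M := by
    obtain ⟨M, hM⟩ := (hB.image abs).bddAbove
    exact ⟨M + 1, fun x hx => (hM (mem_image_of_mem _ hx)).trans_lt (lt_add_one M)⟩
  -- Prescribing zero also far from the origin gives compact support, hence a bounded derivative.
  have hcl : IsClosed (A ∪ {x : ℝ | M ≤ |x|}) :=
    hA.isClosed.union (isClosed_le continuous_const continuous_abs)
  have hdis : Disjoint (A ∪ {x : ℝ | M ≤ |x|}) B := by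
    rw [Set.disjoint_union_left]
    refine ⟨hd, Set.disjoint_left.2 fun x hx hxB => ?_⟩
    exact absurd (hM x hxB) (not_lt.2 hx)
  obtain ⟨f, h0, h1, h01⟩ := exists_contMDiffMap_zero_one_of_isClosed (n := 1)
    (modelWithCornersSelf ℝ ℝ) hcl hB.isClosed hdis
  have hf : ContDiff ℝ 1 f := f.contMDiff.contDiff
  have hc : HasCompactSupport f := by
    refine HasCompactSupport.intro (isCompact_Icc (a := -M) (b := M)) fun x hx => h0 (Or.inr ?_)
    by_contra hcon
    exact hx (abs_le.1 (not_le.1 hcon).le)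
  exact ⟨f, hf, fun x hx => h0 (Or.inl hx), fun x hx => h1 hx, h01,
    hc.deriv.exists_bound_of_continuous (hf.continuous_deriv le_rfl)⟩

/-- A field in `K` must be Borel and satisfy its constraint for every `x` with the given `g`. The
test field uses `g'` and is set to zero over the null set where the two differ, apart from the lines
over `F`. -/
lemma exists_bounded_measurable_version {a b : ℝ} {g : ℝ → ℝ}
    (hg : MemLp g ⊤ (volume.restrict (Ioo a b))) :
    ∃ (g' : ℝ → ℝ) (C : ℝ), Measurable g' ∧ 0 ≤ C ∧ (∀ x, |g' x| ≤ C) ∧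
      ∀ᵐ x, x ∈ Ioo a b → g x = g' x := by
  set C := (eLpNorm g ⊤ (volume.restrict (Ioo a b))).toReal with hC
  have hC0 : 0 ≤ C := ENNReal.toReal_nonneg
  have hbd : ∀ᵐ x ∂volume.restrict (Ioo a b), |g x| ≤ C := by
    filter_upwards [enorm_ae_le_eLpNormEssSup g (volume.restrict (Ioo a b))] with x hx
    rw [← eLpNorm_exponent_top] at hx
    have := ENNReal.toReal_mono hg.2.ne hx
    rwa [toReal_enorm] at this
  have hm : Measurable (hg.1.mk g) := hg.1.stronglyMeasurable_mk.measurable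
  refine ⟨fun x => max (-C) (min C (hg.1.mk g x)), C, measurable_const.max (measurable_const.min hm),
    hC0, fun x => ?_, ?_⟩
  · rw [abs_le]
    exact ⟨le_max_left _ _, max_le (by linarith) (min_le_left _ _)⟩
  · rw [← ae_restrict_iff' measurableSet_Ioo]
    filter_upwards [hbd, hg.1.ae_eq_mk] with x h1 h2
    rw [← h2, min_eq_right (abs_le.1 h1).2, max_eq_right (abs_le.1 h1).1]

/-! ### The calibrating field and its pairing with the graphs. -/

section LowerBound

variable {a b : ℝ} {F : Finset ℝ} {ι : Type*} [Fintype ι]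

/-- Twice the slope `d`, cut off where it exceeds `N`. -/
def cutSlope (N : ℕ) (d : ℝ) : ℝ := if |d| ≤ N then 2 * d else 0

lemma measurable_cutSlope (N : ℕ) : Measurable (cutSlope N) :=
  Measurable.ite (measurableSet_le measurable_abs measurable_const)
    (measurable_const.mul measurable_id) measurable_const

lemma abs_cutSlope_le (N : ℕ) (d : ℝ) : |cutSlope N d| ≤ 2 * N := by
  rw [cutSlope]
  split_ifs with h
  · rw [abs_mul, abs_two]; linarith
  · simp

open Classical in
/-- The number of graphs through a point. -/
def graphCount (D : ι → PiecewiseAC a F) (p : Plane) : ℝ :=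
  ∑ i, if p 1 = (D i).left (p 0) then 1 else 0

open Classical in
/-- The average of the slopes of the graphs through a point. -/
def meanSlope (N : ℕ) (D : ι → PiecewiseAC a F) (p : Plane) : ℝ :=
  (∑ i, if p 1 = (D i).left (p 0) then cutSlope N ((D i).dens (p 0)) else 0) / graphCount D p

lemma measurableSet_on_graph (D : PiecewiseAC a F) :
    MeasurableSet {p : Plane | p 1 = D.left (p 0)} :=
  measurableSet_eq_fun (measurable_plane_apply 1)
    (D.measurable_left.comp (measurable_plane_apply 0))

lemma measurable_graphCount (D : ι → PiecewiseAC a F) : Measurable (graphCount D) :=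
  Finset.measurable_fun_sum _ fun i _ =>
    Measurable.ite (measurableSet_on_graph (D i)) measurable_const measurable_const

lemma measurable_meanSlope (N : ℕ) (D : ι → PiecewiseAC a F) : Measurable (meanSlope N D) :=
  (Finset.measurable_fun_sum _ fun i _ =>
    Measurable.ite (measurableSet_on_graph (D i)) ((measurable_cutSlope N).comp
      ((D i).measurable_dens.comp (measurable_plane_apply 0))) measurable_const).div
    (measurable_graphCount D)

lemma graphCount_nonneg (D : ι → PiecewiseAC a F) (p : Plane) : 0 ≤ graphCount D p :=
  Finset.sum_nonneg fun i _ => by split_ifs <;> norm_num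

lemma graphCount_pos {D : ι → PiecewiseAC a F} {p : Plane} {i : ι}
    (h : p 1 = (D i).left (p 0)) : 0 < graphCount D p := by
  refine Finset.sum_pos' (fun i _ => by split_ifs <;> norm_num) ⟨i, Finset.mem_univ i, ?_⟩
  rw [if_pos h]; norm_num

lemma exists_of_graphCount_ne_zero {D : ι → PiecewiseAC a F} {p : Plane}
    (h : graphCount D p ≠ 0) : ∃ i, p 1 = (D i).left (p 0) := by
  by_contra hcon
  push Not at hcon
  exact h (Finset.sum_eq_zero fun i _ => if_neg (hcon i))

lemma abs_meanSlope_le (N : ℕ) (D : ι → PiecewiseAC a F) (p : Plane) :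
    |meanSlope N D p| ≤ 2 * N := by
  rw [meanSlope, abs_div, abs_of_nonneg (graphCount_nonneg D p)]
  refine div_le_of_le_mul₀ (graphCount_nonneg D p) (by positivity) ?_
  refine (Finset.abs_sum_le_sum_abs _ _).trans ?_
  rw [graphCount, Finset.mul_sum]
  refine Finset.sum_le_sum fun i _ => ?_
  split_ifs
  · rw [mul_one]; exact abs_cutSlope_le N _
  · simp

/-- Averaging is a Borel way to attach one slope to each point; nothing is lost where the graphs
through the point have equal slopes, which is almost everywhere. -/
lemma meanSlope_eq (N : ℕ) {D : ι → PiecewiseAC a F} {p : Plane} {i : ι}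
    (h : p 1 = (D i).left (p 0))
    (h' : ∀ j, p 1 = (D j).left (p 0) → (D j).dens (p 0) = (D i).dens (p 0)) :
    meanSlope N D p = cutSlope N ((D i).dens (p 0)) := by
  rw [meanSlope, div_eq_iff (graphCount_pos h).ne', graphCount, Finset.mul_sum]
  refine Finset.sum_congr rfl fun j _ => ?_
  split_ifs with hj
  · rw [h' j hj, mul_one]
  · rw [mul_zero]

open Classical in
/-- A calibrating field: on vertical lines over `F` it is given by `χ`, elsewhere it is supported on
the graphs, where it is determined by the slope. -/
def testField (β : ℝ) (N : ℕ) (D : ι → PiecewiseAC a F) (χ : ℝ → ℝ → ℝ) (K : ℝ) (g : ℝ → ℝ)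
    (Z : Set ℝ) (p : Plane) : Plane :=
  if p 0 ∈ F then !₂[∑ s ∈ F, if p 0 = s then χ s (p 1) else 0, K]
  else if p 0 ∈ Z ∨ graphCount D p = 0 then 0
  else !₂[meanSlope N D p, meanSlope N D p ^ 2 / 4 - β * (p 1 - g (p 0)) ^ 2]

variable {α β : ℝ} {N : ℕ} {D : ι → PiecewiseAC a F} {χ : ℝ → ℝ → ℝ} {K : ℝ} {g g' : ℝ → ℝ}
  {Z : Set ℝ}

lemma measurable_testField (hχ : ∀ s, Measurable (χ s)) (hg' : Measurable g')
    (hZ : MeasurableSet Z) : Measurable (testField β N D χ K g' Z) := by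
  have h0 := measurable_plane_apply 0
  have h1 := measurable_plane_apply 1
  refine Measurable.ite (h0 F.measurableSet) (measurable_plane_mk ?_ measurable_const)
    (Measurable.ite ((h0 hZ).union ((measurable_graphCount D) (measurableSet_singleton 0)))
      measurable_const (measurable_plane_mk (measurable_meanSlope N D) ?_))
  · exact Finset.measurable_fun_sum _ fun s _ =>
      Measurable.ite (h0 (measurableSet_singleton s)) ((hχ s).comp h1) measurable_const
  · exact (((measurable_meanSlope N D).pow_const 2).div_const 4).sub
      (((h1.sub (hg'.comp h0)).pow_const 2).const_mul β)

lemma testField_of_mem {s : ℝ} (hs : s ∈ F) (t : ℝ) :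
    testField β N D χ K g' Z !₂[s, t] = !₂[χ s t, K] := by
  rw [testField, if_pos (by simpa using hs)]
  simp [hs]

/-- The term `β (t - g')²` is bounded because, off the lines over `F`, the field lives on the
graphs, where `|t| ≤ B`. -/
lemma testField_bounded (hβ : 0 ≤ β) {C B Γ : ℝ} (hχ : ∀ s ∈ F, ∀ t, |χ s t| ≤ C)
    (hB : ∀ i x, |(D i).left x| ≤ B) (hg' : ∀ x, |g' x| ≤ Γ) (p : Plane) (i : Fin 2) :
    |testField β N D χ K g' Z p i| ≤ |C| + |K| + 2 * N + N ^ 2 + β * (B + Γ) ^ 2 := by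
  have hnn : 0 ≤ β * (B + Γ) ^ 2 := by positivity
  have hN : (0 : ℝ) ≤ N := Nat.cast_nonneg N
  have hC := abs_nonneg C
  have hK := abs_nonneg K
  by_cases hp : p 0 ∈ F
  · have h := testField_of_mem (β := β) (N := N) (D := D) (χ := χ) (K := K) (g' := g') (Z := Z)
      hp (p 1)
    rw [plane_eta] at h
    rw [h]
    fin_cases i
    · have := (hχ _ hp (p 1)).trans (le_abs_self C)
      simp only [Fin.zero_eta, Matrix.cons_val_zero]
      nlinarith
    · simp only [Fin.mk_one, Matrix.cons_val_one, Matrix.cons_val_fin_one]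
      nlinarith
  · rw [testField, if_neg hp]
    split_ifs with h
    · simp only [PiLp.zero_apply, abs_zero]
      positivity
    · rw [not_or] at h
      obtain ⟨j, hj⟩ := exists_of_graphCount_ne_zero h.2
      have hm := abs_meanSlope_le N D p
      fin_cases i
      · simp only [Fin.zero_eta, Matrix.cons_val_zero]
        nlinarith
      · simp only [Fin.mk_one, Matrix.cons_val_one, Matrix.cons_val_fin_one]
        have h1 : meanSlope N D p ^ 2 ≤ (2 * N) ^ 2 := sq_le_sq' (abs_le.1 hm).1 (abs_le.1 hm).2
        have h2 : |p 1 - g' (p 0)| ≤ B + Γ := by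
          rw [hj]
          exact (abs_sub _ _).trans (add_le_add (hB _ _) (hg' _))
        have h3 : (p 1 - g' (p 0)) ^ 2 ≤ (B + Γ) ^ 2 := sq_le_sq' (abs_le.1 h2).1 (abs_le.1 h2).2
        have h4 : β * (p 1 - g' (p 0)) ^ 2 ≤ β * (B + Γ) ^ 2 := mul_le_mul_of_nonneg_left h3 hβ
        have h5 : 0 ≤ β * (p 1 - g' (p 0)) ^ 2 := by positivity
        rw [abs_le]
        constructor <;> nlinarith [sq_nonneg (meanSlope N D p)]

/-- Over `F`, a vertical integral of `α Φ'` is `α` times a difference of two numbers in `[0, 1]`,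
and the constant `K` dominates `(φˣ)²/4`. Elsewhere the pointwise constraint is an equality on the
graphs or holds trivially for the zero field, and `φˣ` vanishes for all but finitely many `t`. -/
lemma testField_mem_admissible (hβ : 0 ≤ β) (hα : 0 < α) {Φ : ℝ → ℝ → ℝ}
    (hΦ : ∀ s, ContDiff ℝ 1 (Φ s)) (hΦ01 : ∀ s x, Φ s x ∈ Icc (0 : ℝ) 1)
    (hχ : ∀ s t, χ s t = α * deriv (Φ s) t) (hK : ∀ s ∈ F, ∀ t, χ s t ^ 2 / 4 ≤ K)
    (hg' : Measurable g') (hZ : MeasurableSet Z) (hgZ : ∀ x ∈ Ioo a b, x ∉ Z → g x = g' x) :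
    testField β N D χ K g' Z ∈ admissible a b α β g := by
  have hχc : ∀ s, Continuous (χ s) := fun s => by
    have : χ s = fun t => α * deriv (Φ s) t := funext (hχ s)
    rw [this]
    exact continuous_const.mul ((hΦ s).continuous_deriv le_rfl)
  refine ⟨measurable_testField (fun s => (hχc s).measurable) hg' hZ, fun x hx t => ?_,
    fun x hx t₁ t₂ => ?_⟩
  · have hsq : 0 ≤ β * (t - g x) ^ 2 := by positivity
    by_cases hxF : x ∈ F
    · rw [testField_of_mem hxF]
      have := hK x hxF t
      simp only [Matrix.cons_val_zero, Matrix.cons_val_one,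
        Matrix.cons_val_fin_one]
      linarith
    · rw [testField, if_neg (by simpa using hxF)]
      split_ifs with h
      · simpa using hsq
      · rw [not_or] at h
        have hgx : g x = g' x := hgZ x hx (by simpa using h.1)
        simp only [Matrix.cons_val_zero, Matrix.cons_val_one,
          Matrix.cons_val_fin_one, hgx]
        exact le_rfl
  · by_cases hxF : x ∈ F
    · simp_rw [testField_of_mem hxF]
      simp only [Matrix.cons_val_zero]
      refine ⟨(hχc x).intervalIntegrable _ _, ?_⟩
      simp_rw [hχ]
      rw [intervalIntegral.integral_const_mul, intervalIntegral.integral_deriv_eq_sub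
        (fun t _ => (hΦ x).differentiable one_ne_zero t)
        (((hΦ x).continuous_deriv le_rfl).intervalIntegrable _ _), abs_mul, abs_of_pos hα]
      have h1 := hΦ01 x t₁
      have h2 := hΦ01 x t₂
      have h3 : |Φ x t₂ - Φ x t₁| ≤ 1 := by
        rw [abs_le]; constructor <;> linarith [h1.1, h1.2, h2.1, h2.2]
      nlinarith
    · have hz : (fun t => testField β N D χ K g' Z !₂[x, t] 0) =ᵐ[volume] fun _ => (0 : ℝ) := by
        have h1 : ∀ᵐ t : ℝ, ∀ i, t ≠ (D i).left x :=
          ae_all_iff.2 fun i => by simp [ae_iff, measure_singleton]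
        filter_upwards [h1] with t ht
        have h2 : graphCount D !₂[x, t] = 0 := by
          by_contra hcon
          obtain ⟨i, hi⟩ := exists_of_graphCount_ne_zero hcon
          exact ht i (by simpa using hi)
        rw [testField, if_neg (by simpa using hxF), if_pos (Or.inr h2)]
        rfl
      refine ⟨IntervalIntegrable.congr_ae intervalIntegrable_const (ae_restrict_of_ae hz.symm), ?_⟩
      rw [intervalIntegral.integral_congr_ae (g := fun _ => (0 : ℝ)) (hz.mono fun t ht _ => ht)]
      simpa using hα.le

/-- The family has no pair of jumps at `s` that could be joined at a common endpoint. -/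
def Matched (D : ι → PiecewiseAC a F) (s : ℝ) : Prop :=
  ∀ i j, (D i).jump s ≠ 0 → (D j).jump s ≠ 0 → (D i).left s ≠ (D j).right s

/-- `Matched` says that the left and the right endpoints of the genuine jumps at `s` form disjoint
finite sets, which can be separated. -/
lemma exists_calibrating_potential (hD : ∀ s, Matched D s) (s : ℝ) :
    ∃ Φ : ℝ → ℝ, ContDiff ℝ 1 Φ ∧ (∀ i, (D i).jump s ≠ 0 → Φ ((D i).right s) - Φ ((D i).left s) = 1) ∧
      (∀ x, Φ x ∈ Icc (0 : ℝ) 1) ∧ ∃ C, ∀ x, |deriv Φ x| ≤ C := by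
  obtain ⟨Φ, h1, h2, h3, h4, h5⟩ := exists_separating_potential
    (A := (fun i => (D i).left s) '' {i | (D i).jump s ≠ 0})
    (B := (fun i => (D i).right s) '' {i | (D i).jump s ≠ 0}) (Set.toFinite _) (Set.toFinite _) (by
      rw [Set.disjoint_left]
      rintro _ ⟨i, hi, rfl⟩ ⟨j, hj, hij⟩
      exact hD s i j hi hj hij.symm)
  refine ⟨Φ, h1, fun i hi => ?_, h4, h5⟩
  rw [h2 _ (mem_image_of_mem _ hi), h3 _ (mem_image_of_mem _ hi)]
  norm_num

/-- The energy with the slope cut off at `N`. -/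
def cutEnergy (b α β : ℝ) (g : ℝ → ℝ) (N : ℕ) (D : PiecewiseAC a F) : ℝ≥0∞ :=
  (∫⁻ x in Ioo a b, ENNReal.ofReal
      ((if |D.dens x| ≤ N then D.dens x ^ 2 else 0) + β * (D.left x - g x) ^ 2)) +
    ∑ s ∈ F, if D.jump s ≠ 0 then ENNReal.ofReal α else 0

/-- Monotone convergence; the limit may be infinite, since the slope is only integrable and not
necessarily square integrable. -/
lemma tendsto_cutEnergy (D : PiecewiseAC a F)
    (hg : AEStronglyMeasurable g (volume.restrict (Ioo a b))) :
    Tendsto (fun N => cutEnergy b α β g N D) atTop (𝓝 (energy b α β g D)) := by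
  refine Tendsto.add_const _ ?_
  refine lintegral_tendsto_of_tendsto_of_monotone (fun N => ?_) (ae_of_all _ fun x N M hNM => ?_)
    (ae_of_all _ fun x => ?_)
  · refine AEMeasurable.ennreal_ofReal (AEMeasurable.add (Measurable.aemeasurable ?_)
      (((D.measurable_left.aemeasurable.sub hg.aemeasurable).pow_const 2).const_mul β))
    exact Measurable.ite (measurableSet_le D.measurable_dens.abs measurable_const)
      (D.measurable_dens.pow_const 2) measurable_const
  · refine ENNReal.ofReal_le_ofReal (add_le_add_left ?_ _)
    have hNM' : (N : ℝ) ≤ M := by exact_mod_cast hNM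
    split_ifs with h1 h2 h2
    · exact le_rfl
    · exact absurd (h1.trans hNM') h2
    · positivity
    · exact le_rfl
  · refine tendsto_const_nhds.congr' ?_
    obtain ⟨N, hN⟩ := exists_nat_ge |D.dens x|
    filter_upwards [eventually_ge_atTop N] with M hM
    rw [if_pos (hN.trans (by exact_mod_cast hM))]

/-- Cutting the slope at `N` keeps the calibrating field bounded, so that its pairing converges
absolutely and splits over the graphs. Both inequalities of the upper bound then become equalities,
up to the cut. -/
lemma sum_cutEnergy_le_lift {R : Triple} (hR : R.IsRectifiable a b) (hα : 0 < α) (hβ : 0 ≤ β)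
    (hg : MemLp g ⊤ (volume.restrict (Ioo a b))) (hF : ↑F ⊆ Ioo a b)
    (hT : R.current a b = sumCurrent b D) (hD : ∀ s, Matched D s) (N : ℕ) :
    ((∑ i, cutEnergy b α β g N (D i) : ℝ≥0∞) : EReal) ≤ R.lift a b α β g := by
  obtain ⟨g', Γ, hg'm, hΓ0, hΓ, hgg'⟩ := exists_bounded_measurable_version hg
  rw [ae_iff] at hgg'
  obtain ⟨Z, hZ1, hZm, hZ0⟩ := exists_measurable_superset_of_null hgg'
  have hgZ : ∀ x ∈ Ioo a b, x ∉ Z → g x = g' x := by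
    intro x hx hxZ
    by_contra hcon
    exact hxZ (hZ1 fun h => hcon (h hx))
  choose Φ hΦ1 hΦ2 hΦ3 C hC using exists_calibrating_potential hD
  choose Bi hBi0 hBi using fun i => (D i).exists_bound_left
  set χ : ℝ → ℝ → ℝ := fun s t => α * deriv (Φ s) t with hχ
  -- One constant bounds the field on all vertical lines over `F`, so `c² / 4` serves as the second
  -- component there.
  set c : ℝ := ∑ s ∈ F, α * C s with hc
  have hC0 : ∀ s, 0 ≤ C s := fun s => (abs_nonneg _).trans (hC s 0)
  have hχc : ∀ s ∈ F, ∀ t, |χ s t| ≤ c := by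
    intro s hs t
    rw [hχ, abs_mul, abs_of_pos hα]
    exact (mul_le_mul_of_nonneg_left (hC s t) hα.le).trans
      (Finset.single_le_sum (f := fun s => α * C s) (fun s _ => mul_nonneg hα.le (hC0 s)) hs)
  have hK : ∀ s ∈ F, ∀ t, χ s t ^ 2 / 4 ≤ c ^ 2 / 4 := by
    intro s hs t
    have h := hχc s hs t
    have := sq_le_sq' (abs_le.1 h).1 (abs_le.1 h).2
    linarith
  have hB : ∀ i x, |(D i).left x| ≤ ∑ i, Bi i := fun i x => (hBi i x).trans
    (Finset.single_le_sum (f := Bi) (fun i _ => hBi0 i) (Finset.mem_univ i))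
  set φ := testField β N D χ (c ^ 2 / 4) g' Z with hφ
  have hadm : φ ∈ admissible a b α β g := testField_mem_admissible hβ hα hΦ1 hΦ3
    (fun _ _ => rfl) hK hg'm hZm hgZ
  obtain ⟨hint, heq⟩ := hR.integral_inner_normal_eq hF hT hadm.1
    (testField_bounded hβ hχc hB hΓ)
  set q : ι → ℝ → ℝ := fun i x =>
    (if |(D i).dens x| ≤ N then (D i).dens x ^ 2 else 0) + β * ((D i).left x - g x) ^ 2 with hq
  have hq0 : ∀ i x, 0 ≤ q i x := fun i x => by
    have : 0 ≤ if |(D i).dens x| ≤ (N : ℝ) then (D i).dens x ^ 2 else 0 := by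
      split_ifs <;> positivity
    positivity
  have hgraph : ∀ i, ∀ᵐ x ∂volume.restrict (Ioo a b),
      φ ((D i).point x) 0 * (D i).dens x - φ ((D i).point x) 1 = q i x := by
    intro i
    rw [ae_restrict_iff' measurableSet_Ioo]
    -- Graphs that meet share their slope almost everywhere, so the field takes the value required
    -- by each graph through the point.
    have h1 : ∀ᵐ x, ∀ j, (D j).left x = (D i).left x → (D j).dens x = (D i).dens x :=
      ae_all_iff.2 fun j => PiecewiseAC.ae_dens_eq_of_left_eq (D j) (D i)
    filter_upwards [h1, PiecewiseAC.ae_notMem_finset F, measure_eq_zero_iff_ae_notMem.1 hZ0]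
      with x hx1 hx2 hx3 hxI
    have hon : (D i).point x 1 = (D i).left ((D i).point x 0) := rfl
    have hslope : meanSlope N D ((D i).point x) = cutSlope N ((D i).dens x) :=
      meanSlope_eq N hon fun j hj => hx1 j hj.symm
    have hval : φ ((D i).point x) = !₂[cutSlope N ((D i).dens x),
        cutSlope N ((D i).dens x) ^ 2 / 4 - β * ((D i).left x - g x) ^ 2] := by
      rw [hφ, testField, if_neg (show ¬ (D i).point x 0 ∈ F from hx2),
        if_neg (by rw [not_or]; exact ⟨hx3, (graphCount_pos hon).ne'⟩), hslope, hgZ x hxI hx3]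
      rfl
    rw [hval]
    simp only [Matrix.cons_val_zero, Matrix.cons_val_one,
      Matrix.cons_val_fin_one, hq, cutSlope]
    split_ifs <;> ring
  have hjump : ∀ i, ∀ s ∈ F, ∫ t in (D i).left s..(D i).right s, φ !₂[s, t] 0 =
      if (D i).jump s ≠ 0 then α else 0 := by
    intro i s hs
    simp_rw [hφ, testField_of_mem hs]
    simp only [Matrix.cons_val_zero, hχ]
    rw [intervalIntegral.integral_const_mul, intervalIntegral.integral_deriv_eq_sub
      (fun t _ => (hΦ1 s).differentiable one_ne_zero t)
      (((hΦ1 s).continuous_deriv le_rfl).intervalIntegrable _ _)]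
    split_ifs with hj
    · rw [hΦ2 s i hj, mul_one]
    · rw [not_not] at hj
      rw [PiecewiseAC.right, hj, add_zero, sub_self, mul_zero]
  have hqi : ∀ i, IntegrableOn (q i) (Ioo a b) := by
    intro i
    have hm : ∀ j, Measurable fun x => φ ((D i).point x) j := fun j =>
      (measurable_plane_apply j).comp (hadm.1.comp (D i).measurable_point)
    refine Integrable.congr ?_ (hgraph i)
    refine Integrable.sub ?_ ?_
    · exact (D i).integrable_dens.integrableOn.bdd_mul (hm 0).aestronglyMeasurable
        (ae_of_all _ fun x => testField_bounded hβ hχc hB hΓ _ 0)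
    · exact Measure.integrableOn_of_bounded (by simp) (hm 1).aestronglyMeasurable
        (ae_of_all _ fun x => testField_bounded hβ hχc hB hΓ _ 1)
  have htotal : ENNReal.ofReal (∫ p in R.carrier, R.mult p * inner ℝ (φ p) (R.normal p)
      ∂Measure.hausdorffMeasure 1) = ∑ i, cutEnergy b α β g N (D i) := by
    have hnn : ∀ i s, 0 ≤ if (D i).jump s ≠ 0 then α else 0 := fun i s => by
      split_ifs
      · exact hα.le
      · exact le_rfl
    have h1 : ∀ i, (∫ x in Ioo a b, (φ ((D i).point x) 0 * (D i).dens x - φ ((D i).point x) 1)) +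
        ∑ s ∈ F, ∫ t in (D i).left s..(D i).right s, φ !₂[s, t] 0 =
        (∫ x in Ioo a b, q i x) + ∑ s ∈ F, if (D i).jump s ≠ 0 then α else 0 := fun i => by
      rw [integral_congr_ae (hgraph i), Finset.sum_congr rfl (hjump i)]
    rw [heq]
    simp_rw [h1]
    rw [ENNReal.ofReal_sum_of_nonneg fun i _ => add_nonneg
      (integral_nonneg (hq0 i)) (Finset.sum_nonneg fun s _ => hnn i s)]
    refine Finset.sum_congr rfl fun i _ => ?_
    rw [ENNReal.ofReal_add (integral_nonneg (hq0 i)) (Finset.sum_nonneg fun s _ => hnn i s),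
      ofReal_integral_eq_lintegral_ofReal (hqi i) (ae_of_all _ (hq0 i)),
      ENNReal.ofReal_sum_of_nonneg fun s _ => hnn i s, cutEnergy]
    congr 1
    refine Finset.sum_congr rfl fun s _ => ?_
    split_ifs <;> simp
  have hnonneg : 0 ≤ ∫ p in R.carrier, R.mult p * inner ℝ (φ p) (R.normal p)
      ∂Measure.hausdorffMeasure 1 := by
    rw [heq]
    refine Finset.sum_nonneg fun i _ => add_nonneg ?_ (Finset.sum_nonneg fun s hs => ?_)
    · rw [integral_congr_ae (hgraph i)]
      exact integral_nonneg (hq0 i)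
    · rw [hjump i s hs]
      split_ifs
      · exact hα.le
      · exact le_rfl
  rw [← htotal, EReal.coe_ennreal_ofReal, max_eq_left hnonneg]
  exact le_iSup_of_le φ (le_iSup_of_le hadm (le_iSup_of_le hint le_rfl))

/-- The lifted functional of a matched sum of extended graphs is the sum of the energies. -/
theorem G_sumCurrent_eq (hα : 0 < α) (hβ : 0 ≤ β)
    (hg : MemLp g ⊤ (volume.restrict (Ioo a b))) (hF : ↑F ⊆ Ioo a b)
    (hD : ∀ s, Matched D s) :
    G a b α β g (sumCurrent b D) = ((∑ i, energy b α β g (D i) : ℝ≥0∞) : EReal) := by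
  refine le_antisymm (G_sumCurrent_le hα hβ hg.1 hF D) ?_
  have hR := sumTriple_isRectifiable (b := b) D hF
  have hT := sumTriple_current D hF
  refine le_iSup_of_le (sumTriple b D) (le_iSup_of_le ⟨hR, hT⟩ ?_)
  have hlim : Tendsto (fun N => ((∑ i, cutEnergy b α β g N (D i) : ℝ≥0∞) : EReal)) atTop
      (𝓝 ((∑ i, energy b α β g (D i) : ℝ≥0∞) : EReal)) :=
    (continuous_coe_ennreal_ereal.tendsto _).comp
      (tendsto_finsetSum _ fun i _ => tendsto_cutEnergy (D i) hg.1)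
  exact le_of_tendsto' hlim fun N => sum_cutEnergy_le_lift hR hα hβ hg hF hT hD N

end LowerBound

/-! ### Rearrangement at the jumps -/

/-- Two families of reals can be paired so that no unequal pairs have a common endpoint. -/
lemma exists_perm_matching {ι : Type*} [Fintype ι] (l r : ι → ℝ) :
    ∃ π : Equiv.Perm ι, ∀ i j, l i ≠ r (π i) → l j ≠ r (π j) → l i ≠ r (π j) := by
  classical
  -- Take a pairing with the most equal pairs. If `l i = r (π j)` for unequal pairs `i` and `j`,
  -- exchanging their partners makes `i` equal and spoils no equal pair, contradicting maximality.
  obtain ⟨π, hπ⟩ := Finite.exists_max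
    fun π : Equiv.Perm ι => (Finset.univ.filter fun i => l i = r (π i)).card
  refine ⟨π, fun i j hi hj hij => ?_⟩
  have hlt : (Finset.univ.filter fun k => l k = r (π k)).card <
      (Finset.univ.filter fun k => l k = r (((Equiv.swap i j).trans π) k)).card := by
    refine Finset.card_lt_card ((Finset.ssubset_iff_of_subset fun k hk => ?_).2 ⟨i, ?_, ?_⟩)
    · rw [Finset.mem_filter] at hk ⊢
      have hki : k ≠ i := fun h => hi (h ▸ hk.2)
      have hkj : k ≠ j := fun h => hj (h ▸ hk.2)
      rw [Equiv.trans_apply, Equiv.swap_apply_of_ne_of_ne hki hkj]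
      exact hk
    · rw [Finset.mem_filter, Equiv.trans_apply, Equiv.swap_apply_left]
      exact ⟨Finset.mem_univ _, hij⟩
    · rw [Finset.mem_filter, not_and]
      exact fun _ => hi
  exact absurd (hπ _) (not_le.2 hlt)

/-! ### Splicing two functions at a jump point. -/

namespace PiecewiseAC

variable {a b : ℝ} {F : Finset ℝ}

/-- The function that equals `D₁` to the left of `x₀` and `D₂` to the right of it. -/
def splice (D₁ D₂ : PiecewiseAC a F) {x₀ : ℝ} (h₀ : x₀ ∈ F) : PiecewiseAC a F where
  const := D₁.const
  dens x := if x ≤ x₀ then D₁.dens x else D₂.dens x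
  -- The jump at `x₀` leads from the left trace of `D₁` to the right trace of `D₂`; this makes the
  -- spliced function equal to `D₂` beyond `x₀` although its initial value is that of `D₁`.
  jump s := if s < x₀ then D₁.jump s else if s = x₀ then D₂.right x₀ - D₁.left x₀ else D₂.jump s
  measurable_dens := Measurable.ite measurableSet_Iic D₁.measurable_dens D₂.measurable_dens
  integrable_dens := by
    refine (D₁.integrable_dens.abs.add D₂.integrable_dens.abs).mono'
      (Measurable.ite measurableSet_Iic D₁.measurable_dens
        D₂.measurable_dens).aestronglyMeasurable (ae_of_all _ fun x => ?_)
    have h1 := abs_nonneg (D₁.dens x)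
    have h2 := abs_nonneg (D₂.dens x)
    rw [Real.norm_eq_abs, Pi.add_apply]
    split_ifs <;> linarith
  jump_eq_zero s hs := by
    have : s ≠ x₀ := fun h => hs (h ▸ h₀)
    rw [if_neg this, D₁.jump_eq_zero s hs, D₂.jump_eq_zero s hs, ite_self]

variable (D₁ D₂ : PiecewiseAC a F) {x₀ : ℝ} (h₀ : x₀ ∈ F)

lemma splice_jump_of_lt {x : ℝ} (hx : x < x₀) : (splice D₁ D₂ h₀).jump x = D₁.jump x :=
  if_pos hx

lemma splice_jump_self : (splice D₁ D₂ h₀).jump x₀ = D₂.right x₀ - D₁.left x₀ := by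
  simp [splice]

lemma splice_jump_of_gt {x : ℝ} (hx : x₀ < x) : (splice D₁ D₂ h₀).jump x = D₂.jump x := by
  simp [splice, hx.not_gt, hx.ne']

lemma splice_ac_of_le (ha : a < x₀) {x : ℝ} (hx : x ≤ x₀) :
    (splice D₁ D₂ h₀).ac x = D₁.ac x := by
  rw [ac, ac]
  congr 1
  refine intervalIntegral.integral_congr_ae (ae_of_all _ fun t ht => ?_)
  have : t ≤ max a x := ht.2
  exact if_pos (this.trans (max_le ha.le hx))

lemma splice_left_of_le (ha : a < x₀) {x : ℝ} (hx : x ≤ x₀) :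
    (splice D₁ D₂ h₀).left x = D₁.left x := by
  rw [left, left, splice_ac_of_le D₁ D₂ h₀ ha hx]
  congr 1
  refine Finset.sum_congr rfl fun s _ => ?_
  split_ifs with h
  · exact splice_jump_of_lt D₁ D₂ h₀ (h.trans_le hx)
  · rfl

/-- The value just after `x₀` is `D₂.right x₀`, and all later increments, continuous and jump, are
those of `D₂`. -/
lemma splice_left_of_gt (ha : a < x₀) {x : ℝ} (hx : x₀ < x) :
    (splice D₁ D₂ h₀).left x = D₂.left x := by
  set E := splice D₁ D₂ h₀ with hE
  have h1 : E.ac x = D₁.ac x₀ + (D₂.ac x - D₂.ac x₀) := by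
    have h2 : E.ac x = E.ac x₀ + ∫ t in x₀..x, E.dens t := by
      rw [ac, ac, add_assoc, intervalIntegral.integral_add_adjacent_intervals
        (E.intervalIntegrable_dens _ _) (E.intervalIntegrable_dens _ _)]
    have h3 : D₂.ac x = D₂.ac x₀ + ∫ t in x₀..x, D₂.dens t := by
      rw [ac, ac, add_assoc, intervalIntegral.integral_add_adjacent_intervals
        (D₂.intervalIntegrable_dens _ _) (D₂.intervalIntegrable_dens _ _)]
    have h4 : ∫ t in x₀..x, E.dens t = ∫ t in x₀..x, D₂.dens t := by
      refine intervalIntegral.integral_congr_ae (ae_of_all _ fun t ht => ?_)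
      rw [uIoc_of_le hx.le] at ht
      exact if_neg (not_le.2 ht.1)
    rw [h2, h3, h4, hE, splice_ac_of_le D₁ D₂ h₀ ha le_rfl]
    ring
  have h5 : (∑ s ∈ F, if s < x then E.jump s else 0) =
      (∑ s ∈ F, if s < x₀ then D₁.jump s else 0) + (D₂.right x₀ - D₁.left x₀) +
        ((∑ s ∈ F, if s < x then D₂.jump s else 0) - ∑ s ∈ F, if s ≤ x₀ then D₂.jump s else 0) := by
    have h6 : D₂.right x₀ - D₁.left x₀ =
        ∑ s ∈ F, if s = x₀ then D₂.right x₀ - D₁.left x₀ else 0 := by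
      rw [Finset.sum_ite_eq', if_pos h₀]
    rw [h6, ← Finset.sum_sub_distrib, ← Finset.sum_add_distrib, ← Finset.sum_add_distrib]
    refine Finset.sum_congr rfl fun s _ => ?_
    rcases lt_trichotomy s x₀ with h | h | h
    · simp [h, h.le, h.ne, h.trans hx, hE, splice_jump_of_lt D₁ D₂ h₀ h]
    · subst h
      simp [hx, hE, splice_jump_self D₁ D₂ h₀]
    · simp [h.not_gt, h.not_ge, h.ne', hE, splice_jump_of_gt D₁ D₂ h₀ h]
  have h7 := D₂.right_eq x₀
  rw [left, h1, h5, h7]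
  simp only [left]
  ring

lemma splice_right_of_lt (ha : a < x₀) {x : ℝ} (hx : x < x₀) :
    (splice D₁ D₂ h₀).right x = D₁.right x := by
  rw [right, right, splice_left_of_le D₁ D₂ h₀ ha hx.le, splice_jump_of_lt D₁ D₂ h₀ hx]

lemma splice_right_self (ha : a < x₀) : (splice D₁ D₂ h₀).right x₀ = D₂.right x₀ := by
  rw [right, splice_left_of_le D₁ D₂ h₀ ha le_rfl, splice_jump_self]
  ring

lemma splice_right_of_gt (ha : a < x₀) {x : ℝ} (hx : x₀ < x) :
    (splice D₁ D₂ h₀).right x = D₂.right x := by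
  rw [right, right, splice_left_of_gt D₁ D₂ h₀ ha hx, splice_jump_of_gt D₁ D₂ h₀ hx]

end PiecewiseAC

/-! ### Rearrangement of a family of graphs without change of its current. -/

section Rearrange

open PiecewiseAC

variable {a b : ℝ} {F : Finset ℝ} {ι : Type*} [Fintype ι]

lemma TestForm.exists_bound_coordinate (σ : TestForm a b) :
    ∃ C, ∀ (p : Plane) (j : Fin 2), |σ p (EuclideanSpace.single j 1)| ≤ C := by
  obtain ⟨C, hC⟩ := σ.hasCompactSupport.exists_bound_of_continuous σ.continuous
  refine ⟨C, fun p j => ((σ p).le_opNorm _).trans ?_⟩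
  simpa using hC p

lemma TestForm.continuous_coordinate (σ : TestForm a b) (j : Fin 2) :
    Continuous fun p => σ p (EuclideanSpace.single j (1 : ℝ)) :=
  σ.continuous.clm_apply continuous_const

lemma plane_linear_apply (f : Plane →L[ℝ] ℝ) (v : Plane) :
    f v = f (EuclideanSpace.single 0 1) * v 0 + f (EuclideanSpace.single 1 1) * v 1 := by
  have hv : v = v 0 • EuclideanSpace.single 0 (1 : ℝ) + v 1 • EuclideanSpace.single 1 (1 : ℝ) := by
    ext k; fin_cases k <;> simp
  conv_lhs => rw [hv]
  rw [map_add, map_smul, map_smul, smul_eq_mul, smul_eq_mul]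
  ring

/-- The current of a sum of extended graphs in coordinates. -/
lemma sumCurrent_apply (hF : ↑F ⊆ Ioo a b) (D : ι → PiecewiseAC a F) (σ : TestForm a b) :
    sumCurrent b D σ =
      (∫ x in Ioo a b, ∑ i, (σ ((D i).point x) (EuclideanSpace.single 0 1) +
        σ ((D i).point x) (EuclideanSpace.single 1 1) * (D i).dens x)) +
      ∑ s ∈ F, ∑ i, ∫ t in (D i).left s..(D i).right s,
        σ !₂[s, t] (EuclideanSpace.single 1 1) := by
  obtain ⟨C, hC⟩ := TestForm.exists_bound_coordinate σ
  have hm : ∀ j, Measurable fun p => σ p (EuclideanSpace.single j (1 : ℝ)) := fun j =>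
    (TestForm.continuous_coordinate σ j).measurable
  have hi0 : ∀ i, IntegrableOn (fun x => σ ((D i).point x) (EuclideanSpace.single 0 1))
      (Ioo a b) := fun i => Measure.integrableOn_of_bounded (M := C) (by simp)
    ((hm 0).comp (D i).measurable_point).aestronglyMeasurable (ae_of_all _ fun x => hC _ 0)
  have hi1 : ∀ i, IntegrableOn (fun x => σ ((D i).point x) (EuclideanSpace.single 1 1) *
      (D i).dens x) (Ioo a b) := fun i => (D i).integrable_dens.integrableOn.bdd_mul (c := C)
    ((hm 1).comp (D i).measurable_point).aestronglyMeasurable (ae_of_all _ fun x => hC _ 1)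
  rw [integral_finsetSum _ fun i _ => (hi0 i).fun_add (hi1 i), Finset.sum_comm (s := F),
    ← Finset.sum_add_distrib, sumCurrent]
  refine Finset.sum_congr rfl fun i _ => ?_
  have hti : ∀ j k, IntegrableOn (fun p => σ p (EuclideanSpace.single j 1) * (D i).tangent p k)
      ((D i).graph b) (Measure.hausdorffMeasure 1) := fun j k =>
    (integrable_tangent_apply hF (D i) k).bdd_mul (c := C) (hm j).aestronglyMeasurable
      (ae_of_all _ fun p => hC p j)
  simp_rw [fun p => plane_linear_apply (σ p) ((D i).tangent p)]
  rw [integral_add (hti 0 0) (hti 1 1),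
    (D i).integral_graph_tangent_zero hF (hm 0) (fun p => hC p 0),
    (D i).integral_graph_tangent_one hF (hm 1) (fun p => hC p 1), integral_add (hi0 i) (hi1 i)]
  ring

/-- Exchanging the members of the family to the right of a point does not change the sum of the
currents. -/
lemma sumCurrent_splice (hF : ↑F ⊆ Ioo a b) (D : ι → PiecewiseAC a F) {x₀ : ℝ} (h₀ : x₀ ∈ F)
    (π : Equiv.Perm ι) :
    sumCurrent b (fun i => splice (D i) (D (π i)) h₀) = sumCurrent b D := by
  have ha : a < x₀ := (hF h₀).1
  ext σ
  rw [sumCurrent_apply hF, sumCurrent_apply hF]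
  congr 1
  · refine integral_congr_ae (ae_of_all _ fun x => ?_)
    simp only [point]
    rcases le_or_gt x x₀ with hx | hx
    · refine Finset.sum_congr rfl fun i _ => ?_
      rw [splice_left_of_le _ _ h₀ ha hx]
      simp only [splice, if_pos hx]
    -- To the right of `x₀` the new family is the old one permuted by `π`.
    · rw [← Equiv.sum_comp π fun i => σ !₂[x, (D i).left x] (EuclideanSpace.single 0 1) +
        σ !₂[x, (D i).left x] (EuclideanSpace.single 1 1) * (D i).dens x]
      refine Finset.sum_congr rfl fun i _ => ?_
      rw [splice_left_of_gt _ _ h₀ ha hx]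
      simp only [splice, if_neg (not_le.2 hx)]
  · refine Finset.sum_congr rfl fun s _ => ?_
    rcases lt_trichotomy s x₀ with hs | hs | hs
    · refine Finset.sum_congr rfl fun i _ => ?_
      rw [splice_left_of_le _ _ h₀ ha hs.le, splice_right_of_lt _ _ h₀ ha hs]
    · subst hs
      have hc : Continuous fun t : ℝ => σ !₂[s, t] (EuclideanSpace.single 1 (1 : ℝ)) :=
        (TestForm.continuous_coordinate σ 1).comp (isometry_vertical s).continuous
      -- Written with a fixed primitive, the vertical terms sum to a function of the right endpoints
      -- minus a function of the left endpoints; the permutation affects neither sum.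
      have hsub : ∀ l r : ℝ, ∫ t in l..r, σ !₂[s, t] (EuclideanSpace.single 1 (1 : ℝ)) =
          (∫ t in (0 : ℝ)..r, σ !₂[s, t] (EuclideanSpace.single 1 (1 : ℝ))) -
            ∫ t in (0 : ℝ)..l, σ !₂[s, t] (EuclideanSpace.single 1 (1 : ℝ)) := fun l r =>
        (intervalIntegral.integral_interval_sub_left (hc.intervalIntegrable _ _)
          (hc.intervalIntegrable _ _)).symm
      rw [Finset.sum_congr rfl fun i _ => hsub _ _, Finset.sum_sub_distrib,
        Finset.sum_congr rfl fun i _ => hsub ((D i).left s) ((D i).right s),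
        Finset.sum_sub_distrib]
      congr 1
      · rw [← Equiv.sum_comp π fun i => ∫ t in (0 : ℝ)..(D i).right s,
          σ !₂[s, t] (EuclideanSpace.single 1 (1 : ℝ))]
        refine Finset.sum_congr rfl fun i _ => ?_
        rw [splice_right_self _ _ h₀ ha]
      · refine Finset.sum_congr rfl fun i _ => ?_
        rw [splice_left_of_le _ _ h₀ ha le_rfl]
    · rw [← Equiv.sum_comp π fun i => ∫ t in (D i).left s..(D i).right s,
          σ !₂[s, t] (EuclideanSpace.single 1 (1 : ℝ))]
      refine Finset.sum_congr rfl fun i _ => ?_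
      rw [splice_left_of_gt _ _ h₀ ha hs, splice_right_of_gt _ _ h₀ ha hs]

/-- A family of extended graphs can be rearranged to match at all jumps. -/
theorem exists_matched (hF : ↑F ⊆ Ioo a b) (D : ι → PiecewiseAC a F) :
    ∃ D' : ι → PiecewiseAC a F, sumCurrent b D' = sumCurrent b D ∧ ∀ s, Matched D' s := by
  -- The jump points can be treated one at a time in any order: splicing at `x₀` changes nothing to
  -- its left and permutes the whole family to its right, so matching at the other points persists.
  suffices h : ∀ A : Finset ℝ, A ⊆ F → ∃ D' : ι → PiecewiseAC a F,
      sumCurrent b D' = sumCurrent b D ∧ ∀ s ∈ A, Matched D' s by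
    obtain ⟨D', h1, h2⟩ := h F subset_rfl
    refine ⟨D', h1, fun s => ?_⟩
    by_cases hs : s ∈ F
    · exact h2 s hs
    · exact fun i _ hi => absurd ((D' i).jump_eq_zero s hs) hi
  intro A
  induction A using Finset.induction_on with
  | empty => exact fun _ => ⟨D, rfl, by simp⟩
  | insert x₀ A hx₀ ih =>
    intro hA
    obtain ⟨E, hE1, hE2⟩ := ih ((Finset.subset_insert _ _).trans hA)
    have h₀ : x₀ ∈ F := hA (Finset.mem_insert_self _ _)
    have ha : a < x₀ := (hF h₀).1
    obtain ⟨π, hπ⟩ := exists_perm_matching (fun i => (E i).left x₀) (fun i => (E i).right x₀)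
    refine ⟨fun i => splice (E i) (E (π i)) h₀, (sumCurrent_splice hF E h₀ π).trans hE1,
      fun s hs i j => ?_⟩
    rcases lt_trichotomy s x₀ with h | h | h
    · have hsA : s ∈ A := (Finset.mem_insert.1 hs).resolve_left h.ne
      rw [splice_jump_of_lt _ _ h₀ h, splice_jump_of_lt _ _ h₀ h,
        splice_left_of_le _ _ h₀ ha h.le, splice_right_of_lt _ _ h₀ ha h]
      exact hE2 s hsA i j
    · subst h
      rw [splice_jump_self, splice_jump_self, splice_left_of_le _ _ h₀ ha le_rfl,
        splice_right_self _ _ h₀ ha]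
      exact fun hi hj => hπ i j (fun h => hi (sub_eq_zero.2 h.symm))
        (fun h => hj (sub_eq_zero.2 h.symm))
    · have hsA : s ∈ A := (Finset.mem_insert.1 hs).resolve_left h.ne'
      rw [splice_jump_of_gt _ _ h₀ h, splice_jump_of_gt _ _ h₀ h,
        splice_left_of_gt _ _ h₀ ha h, splice_right_of_gt _ _ h₀ ha h]
      exact hE2 s hsA (π i) (π j)

lemma coe_ennreal_sum (f : ι → ℝ≥0∞) : ((∑ i, f i : ℝ≥0∞) : EReal) = ∑ i, (f i : EReal) :=
  map_sum (⟨⟨fun x : ℝ≥0∞ => (x : EReal), EReal.coe_ennreal_zero⟩, EReal.coe_ennreal_add⟩ :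
    ℝ≥0∞ →+ EReal) f Finset.univ

/-- With one function the condition says only that a genuine jump has distinct endpoints; hence `G`
of a single graph is its energy. -/
lemma matched_single (D : PiecewiseAC a F) (s : ℝ) : Matched (fun _ : Unit => D) s := by
  intro _ _ h _ h'
  apply h
  rw [PiecewiseAC.right] at h'
  linarith

end Rearrange

end MumfordShah

end

/-! ### The decomposition theorem. -/

theorem mainTheorem5 (a b : ℝ) (hab : a < b) (α β : ℝ) (hα : 0 < α) (hβ : 0 ≤ β)
    (g : ℝ → ℝ) (hg : MeasureTheory.MemLp g ⊤ (MeasureTheory.volume.restrict (Set.Ioo a b)))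
    (k : ℕ) (u : Fin k → ℝ → ℝ) (hu : ∀ i, MumfordShah.SBV a b (u i))
    (hS : (⋃ i, MumfordShah.singularSet a b (u i)).Finite) :
    ∃ w : Fin k → ℝ → ℝ,
      (∀ i, MumfordShah.SBV a b (w i)) ∧
      ∑ i, MumfordShah.graphCurrent a b (u i) = ∑ i, MumfordShah.graphCurrent a b (w i) ∧
      MumfordShah.G a b α β g (∑ i, MumfordShah.graphCurrent a b (u i)) =
        ∑ i, MumfordShah.G a b α β g (MumfordShah.graphCurrent a b (w i)) := by
  have hF : ((hS.toFinset : Finset ℝ) : Set ℝ) ⊆ Set.Ioo a b := by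
    intro x hx
    rw [hS.coe_toFinset, Set.mem_iUnion] at hx
    obtain ⟨i, hi⟩ := hx
    exact hi.1
  choose D hD using fun i => (hu i).exists_represents hab hF (by
    rw [hS.coe_toFinset]; exact Set.subset_iUnion (fun i => MumfordShah.singularSet a b (u i)) i)
  obtain ⟨D', hD', hmatch⟩ := MumfordShah.exists_matched hF D
  -- The functions `w` are the left continuous representatives of the rearranged data, so they
  -- represent themselves.
  have hw : ∀ i, (D' i).Represents b (D' i).left := fun i => Filter.EventuallyEq.rfl
  refine ⟨fun i => (D' i).left, fun i => (hw i).sbv hab hF, ?_, ?_⟩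
  · rw [MumfordShah.sum_graphCurrent_eq hF hD, MumfordShah.sum_graphCurrent_eq hF hw, hD']
  · rw [MumfordShah.sum_graphCurrent_eq hF hD, ← hD',
      MumfordShah.G_sumCurrent_eq hα hβ hg hF hmatch, MumfordShah.coe_ennreal_sum]
    refine Finset.sum_congr rfl fun i _ => ?_
    -- A single graph is treated as a family indexed by `Unit`, so that the formula for `G` of a
    -- matched sum applies to it.
    have h := MumfordShah.sum_graphCurrent_eq hF (fun _ : Unit => hw i)
    rw [Finset.univ_unique, Finset.sum_singleton] at h
    rw [h, MumfordShah.G_sumCurrent_eq hα hβ hg hF (MumfordShah.matched_single (D' i)),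
      Finset.univ_unique, Finset.sum_singleton]
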